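/- Let $n\ge 0$ and $k\ge 1$ be integers and let $m_1,\dots,m_k\ge 2$ be integers. Assume that it is not the case that $n=0$ and $k=1$, nor that $n=0$, $k=2$ and $m_1=m_2=2$. Let $G=F_{2n}*\mathbb Z_{m_1}*\cdots*\mathbb Z_{m_k}$, where $h_1,\dots,h_{2n}$ is the standard basis of the free group $F_{2n}$ and $e_i$ is the standard generator of $\mathbb Z_{m_i}$, and put $\alpha=e_1\cdots e_k[h_1,h_2]\cdots[h_{2n-1},h_{2n}]$, where $[g,h]=ghg^{-1}h^{-1}$. Definitions. A circular order on a group $\Gamma$ is a map $c\colon\Gamma^3\to\{0,\pm1\}$ such that $c(g_1,g_2,g_3)=0$ if and only if $g_i=g_j$ for some $i\ne j$; $c(g_2,g_3,g_4)-c(g_1,g_3,g_4)+c(g_1,g_2,g_4)-c(g_1,g_2,g_3)=0$; and $c(gg_1,gg_2,gg_3)=c(g_1,g_2,g_3)$. It is isolated if it is an isolated point of the space of all circular orders on $\Gamma$, with the topology induced from the product topology of $\{0,\pm1\}^{\Gamma^3}$. For $\phi\in\mathrm{Aut}(\Gamma)$, the circular order $c_\phi(g_1,g_2,g_3)=c(\phi(g_1),\phi(g_2),\phi(g_3))$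 is called an automorphic image of $c$. A subgroup $H\le\Gamma$ is convex for $c$ if there is a left order $<$ on $H$ such that $c(x,y,z)=c'(y,z)-c'(x,z)+c'(x,y)$ for all $x,y,z\in H$, where $c'(x,y)$ is $1$, $0$ or $-1$ according as $x<y$, $x=y$ or $y<x$, and such that $g\in H$ whenever $g\in\Gamma$, $h_1,h_2\in H$, $h_1<1<h_2$ and $c(h_1,g,h_2)=1$. The linear part of $c$ is the largest convex subgroup. Let $\mathrm{Homeo}_+(S^1)$ be the group of orientation-preserving homeomorphisms of $S^1=\mathbb R/\mathbb Z$, and let $\mathrm{ord}(x,y,z)\in\{0,\pm1\}$ be the orientation of a triple of points of $S^1$ ($1$ if they are distinct and in counterclockwise order, $-1$ if they are distinct and in clockwise order, $0$ otherwise). Then there are a homomorphism $\rho\colon G\to\mathrm{Homeo}_+(S^1)$, a point $x_0\in S^1$, an infinite set $D$ of positive integers, and for each $d\in D$ an isolated circular order $c^{(d)}$ on $G$, such that the following hold. 1. $\rho$ is Fuchsian: it is the action on $\partial\mathbb H^2\cong S^1$ of an injective homomorphism $G\to\mathrm{PSL}(2,\mathbb R)$ with discrete image. 2. $\rho$ is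 a ping-pong action: there are pairwise disjoint closed arcs $E_1,\dots,E_k,P_1,\dots,P_{2n},N_1,\dots,N_{2n}$ of $S^1$ with $\rho(e_i^{\,j})(S^1\setminus E_i)\subset E_i$ for $1\le i\le k$ and $0<j<m_i$, and $\rho(h_j)(S^1\setminus N_j)\subset P_j$ for $1\le j\le 2n$. 3. For each $d\in D$, the order $c^{(d)}$ comes from a lift of $\rho$ to the $d$-fold cover $p_d\colon S^1\to S^1$, $p_d(x)=dx$: there are a homomorphism $\rho^{(d)}\colon G\to\mathrm{Homeo}_+(S^1)$ with $p_d\circ\rho^{(d)}(g)=\rho(g)\circ p_d$ for all $g\in G$ and such that every $\rho^{(d)}(h_j)$ has a fixed point, and a point $\tilde x\in p_d^{-1}(x_0)$, with $c^{(d)}(g_1,g_2,g_3)=\mathrm{ord}(\rho^{(d)}(g_1)\tilde x,\rho^{(d)}(g_2)\tilde x,\rho^{(d)}(g_3)\tilde x)$ for all $g_1,g_2,g_3\in G$. 4. For each $d\in D$, the linear part of $c^{(d)}$ is $\langle\alpha^d\rangle$. 5. If $d,d'\in D$ and $d\ne d'$, then $c^{(d)}$ is not an automorphic image of $c^{(d')}$.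 -/

import Mathlib

open Matrix Function
open scoped LinearAlgebra.Projectivization MatrixGroups commutatorElement

noncomputable section

/-! ### Circular orders on a group -/

/-- A (left-invariant) circular order on a group: a homogeneous left-invariant cocycle with values
in `{-1, 0, 1}` that vanishes exactly on the degenerate triples. -/
@[ext]
structure GroupCircularOrder (Γ : Type*) [Group Γ] where
  toFun : Γ → Γ → Γ → SignType
  eq_zero_iff : ∀ a b c, toFun a b c = 0 ↔ a = b ∨ b = c ∨ a = c
  cocycle : ∀ a b c d,
    (toFun b c d : ℤ) - (toFun a c d : ℤ) + (toFun a b d : ℤ) - (toFun a b c : ℤ) = 0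
  left_inv : ∀ g a b c, toFun (g * a) (g * b) (g * c) = toFun a b c

namespace GroupCircularOrder

variable {Γ : Type*} [Group Γ]

/-- The topology on the set of circular orders induced by the product topology of
`{-1, 0, 1}^(Γ × Γ × Γ)`. -/
instance instTopologicalSpace : TopologicalSpace (GroupCircularOrder Γ) :=
  TopologicalSpace.induced GroupCircularOrder.toFun inferInstance

/-- `c` is an isolated point of the space of circular orders. -/
def IsIsolated (c : GroupCircularOrder Γ) : Prop :=
  IsOpen ({c} : Set (GroupCircularOrder Γ))

/-- The automorphic image `c_φ(a, b, c) = c(φ a, φ b, φ c)`. -/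
def autImage (c : GroupCircularOrder Γ) (φ : Γ ≃* Γ) : GroupCircularOrder Γ where
  toFun x y z := c.toFun (φ x) (φ y) (φ z)
  eq_zero_iff x y z := by simp [c.eq_zero_iff]
  cocycle x y z w := c.cocycle _ _ _ _
  left_inv g x y z := by simp [c.left_inv]

/-- A left order on a group, given by its strict order relation. -/
structure IsLeftOrder {H : Type*} [Group H] (lt : H → H → Prop) : Prop where
  irrefl : ∀ a, ¬ lt a a
  trans : ∀ a b c, lt a b → lt b c → lt a c
  total : ∀ a b, lt a b ∨ a = b ∨ lt b a
  left_inv : ∀ g a b, lt a b → lt (g * a) (g * b)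

open Classical in
/-- The function `c' : H × H → {-1, 0, 1}` of an order: `1` if `a < b`, `-1` if `b < a`, and `0`
otherwise. -/
def orderSign {H : Type*} (lt : H → H → Prop) (a b : H) : ℤ :=
  if lt a b then 1 else if lt b a then -1 else 0

/-- A subgroup `H` is convex for `c` if the restriction of `c` to `H` is a left order (it is the
coboundary of a left order on `H`), and every `g` lying on the positive arc from `h₁` to `h₂`, where
`h₁ < 1 < h₂` in `H`, belongs to `H`. -/
def IsConvex (c : GroupCircularOrder Γ) (H : Subgroup Γ) : Prop :=
  ∃ lt : H → H → Prop, IsLeftOrder lt ∧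
    (∀ x y z : H, (c.toFun x y z : ℤ) = orderSign lt y z - orderSign lt x z + orderSign lt x y) ∧
    ∀ (h₁ h₂ : H) (g : Γ), lt h₁ 1 → lt 1 h₂ → c.toFun h₁ g h₂ = 1 → g ∈ H

/-- `H` is the linear part of `c`: the largest convex subgroup. -/
def IsLinearPart (c : GroupCircularOrder Γ) (H : Subgroup Γ) : Prop :=
  IsGreatest {K : Subgroup Γ | c.IsConvex K} H

end GroupCircularOrder

/-! ### The circle and its orientation-preserving homeomorphisms -/

open Classical in
/-- The orientation of a triple of points of the circle `ℝ / ℤ`. -/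
def circleOrd (x y z : UnitAddCircle) : SignType :=
  if sbtw x y z then 1 else if sbtw z y x then -1 else 0

/-- The group of orientation-preserving homeomorphisms of the circle `ℝ / ℤ`. -/
def HomeoPlus : Subgroup (UnitAddCircle ≃ₜ UnitAddCircle) where
  carrier := {f | ∀ x y z, circleOrd (f x) (f y) (f z) = circleOrd x y z}
  mul_mem' {f g} hf hg x y z := by
    simpa [Homeomorph.mul_apply] using (hf (g x) (g y) (g z)).trans (hg x y z)
  one_mem' x y z := rfl
  inv_mem' {f} hf x y z := by
    have h := hf (f⁻¹ x) (f⁻¹ y) (f⁻¹ z)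
    have e : ∀ w, f (f⁻¹ w) = w := fun w => f.apply_symm_apply w
    rw [e, e, e] at h
    exact h.symm

/-- `σ` is a lift of the action `ρ` to the `d`-fold covering `x ↦ d • x` of the circle. -/
def IsCoverLift {G : Type*} [Group G] (d : ℕ) (ρ σ : G →* HomeoPlus) : Prop :=
  ∀ g x, d • (σ g).1 x = (ρ g).1 (d • x)

/-! ### Fuchsian actions -/

theorem sin_cos_ne_zero (t : ℝ) : (![Real.sin t, Real.cos t] : Fin 2 → ℝ) ≠ 0 := by
  intro h
  have h0 : Real.sin t = 0 := congrFun h 0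
  have h1 : Real.cos t = 0 := congrFun h 1
  have := Real.sin_sq_add_cos_sq t
  simp [h0, h1] at this

theorem boundary_periodic : Function.Periodic
    (fun t : ℝ => Projectivization.mk ℝ ![Real.sin (Real.pi * t), Real.cos (Real.pi * t)]
      (sin_cos_ne_zero _)) 1 := by
  intro t
  rw [Projectivization.mk_eq_mk_iff']
  refine ⟨-1, ?_⟩
  have : Real.pi * (t + 1) = Real.pi * t + Real.pi := by ring
  rw [this, Real.sin_add_pi, Real.cos_add_pi]
  ext i
  fin_cases i <;> simp

/-- The identification of the circle `ℝ / ℤ` with the boundary `ℝ ∪ {∞}` of the upper half-plane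
(the real projective line, on which `PSL(2, ℝ)` acts by Möbius transformations): `t` goes to
`tan (π t)`, with homogeneous coordinates `[sin (π t) : cos (π t)]`. -/
def boundaryPoint : UnitAddCircle → ℙ ℝ (Fin 2 → ℝ) :=
  boundary_periodic.lift

instance pslTopologicalSpace : TopologicalSpace (Matrix.ProjectiveSpecialLinearGroup (Fin 2) ℝ) :=
  inferInstanceAs (TopologicalSpace (SL(2, ℝ) ⧸ Subgroup.center SL(2, ℝ)))

/-- `ρ` is the action on the circle at infinity of a faithful representation of `G` onto a discrete
subgroup of `PSL(2, ℝ)`. -/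
def IsFuchsianAction {G : Type*} [Group G] (ρ : G →* HomeoPlus) : Prop :=
  ∃ A : G →* Matrix.ProjectiveSpecialLinearGroup (Fin 2) ℝ,
    Function.Injective A ∧ DiscreteTopology A.range ∧
    ∀ g x, boundaryPoint ((ρ g).1 x) = A g • boundaryPoint x

/-! ### Free products of cyclic groups -/

/-- The free product `F_{2n} * ℤ_{m_1} * ⋯ * ℤ_{m_k}`. -/
def CyclicFreeProduct (n : ℕ) {k : ℕ} (m : Fin k → ℕ) : Type :=
  Monoid.Coprod (FreeGroup (Fin (2 * n))) (Monoid.CoprodI fun i => Multiplicative (ZMod (m i)))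

instance CyclicFreeProduct.instGroup (n : ℕ) {k : ℕ} (m : Fin k → ℕ) : Group (CyclicFreeProduct n m) :=
  inferInstanceAs (Group (Monoid.Coprod (FreeGroup (Fin (2 * n)))
    (Monoid.CoprodI fun i => Multiplicative (ZMod (m i)))))

namespace CyclicFreeProduct

variable (n : ℕ) {k : ℕ} (m : Fin k → ℕ)

/-- The standard generator of the factor `ℤ_{m_i}`. -/
def e (i : Fin k) : CyclicFreeProduct n m :=
  Monoid.Coprod.inr (Monoid.CoprodI.of (i := i) (Multiplicative.ofAdd (1 : ZMod (m i))))

/-- The standard generators of `F_{2n}`. -/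
def h (j : Fin (2 * n)) : CyclicFreeProduct n m :=
  Monoid.Coprod.inl (FreeGroup.of j)

/-- `α = e_1 ⋯ e_k [h_1, h_2] ⋯ [h_{2n-1}, h_{2n}]`, where `[x, y] = x y x⁻¹ y⁻¹`. -/
def α : CyclicFreeProduct n m :=
  (List.ofFn fun i : Fin k => e n m i).prod *
    (List.ofFn fun j : Fin n =>
      ⁅h n m ⟨2 * j, by omega⟩, h n m ⟨2 * j + 1, by omega⟩⁆).prod

variable {n m}

/-- The standard generators act by ping-pong: there are pairwise disjoint closed arcs of the circle,
one for each `e_i` and one for each `h_j` and each `h_j⁻¹`, such that every nontrivial power of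
`e_i` maps the complement of the arc of `e_i` into that arc, and `h_j` maps the complement of the
arc of `h_j⁻¹` into the arc of `h_j`. -/
def IsPingPongAction (ρ : CyclicFreeProduct n m →* HomeoPlus) : Prop :=
  ∃ (E : Fin k → Set UnitAddCircle) (P N : Fin (2 * n) → Set UnitAddCircle),
    (∀ s, IsClosed (Sum.elim E (Sum.elim P N) s) ∧ IsConnected (Sum.elim E (Sum.elim P N) s)) ∧
    Pairwise (Disjoint on Sum.elim E (Sum.elim P N)) ∧
    (∀ i (j : ℕ), 0 < j → j < m i → (ρ (e n m i ^ j)).1 '' (E i)ᶜ ⊆ E i) ∧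
    ∀ j, (ρ (h n m j)).1 '' (N j)ᶜ ⊆ P j

end CyclicFreeProduct

end

noncomputable section

/-! ### Cyclic order of points of the circle read off from real coordinates -/

/-! Realise `G` as the group of a hyperbolic orbifold of genus n with k cone points and one open
end. A circle of circumference κ = k + 4n carries the arcs [j + 1/4, j + 3/4]: one for each e_i, and
four for each handle, in the cyclic order h, h'⁻¹, h⁻¹, h'. The generator e_i is a Möbius rotation
and h_j a Möbius map taking the complement of one arc exactly onto another. All computations take
place on the line, with increasing bijections commuting with translation by κ. Reducing them modulo
κ gives ρ, and modulo κd its lift to the d-fold cover.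

Ping-pong: a nontrivial element moves every integer point into an arc. So the orbit of 0 is free and
defines a circular order. In the base circle it also stays a fixed distance away from 0, which makes
ρ faithful and discrete.

The gaps between the arcs are centred at the integers. The letter `edge j` moves the gap around
`next j` so that it touches the gap around j on the right. Following `next` visits all κ gaps of the
base circle in one cycle and spells α. On the cover e_i makes r_i extra turns, where m_i r_i + 1 =
d, and one cycle changes the sheet by shift = k + 2n - 1 + ∑ r_i. If shift is coprime to d, all κd
gaps of the cover form a single cycle. Two facts follow: every integer has a first orbit point at or
after it (`exists_first`), and α^d moves 0 to the very next orbit point (`bdryLift_pow_first`).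

Isolation: the first orbit points cut the circle into finitely many cells. A letter contracts each
cell outside its source into another cell, and this nesting involves finitely many group elements.
An order that agrees on them must therefore place every reduced word in the same cell, by induction
on its length. The cells decide all triples (1, s, g) with s a letter, and these triples determine
the order.

Linear part: ⟨α^d⟩ is convex because no other orbit points lie between its own. If a convex subgroup
contains more, the supremum of the positions of its positive elements is a point fixed by all of
them. Since α^d has at most two fixed points per period, the subgroup contains every element whose
orbit point lies within one period below that point. Up to powers of α this is every element, so
ρ(G) fixes a point of the circle. But e_1 has none.

Distinctness: an automorphism relating two of the orders carries one linear part onto the other. Odd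
roots of nontrivial powers of α are powers of α, since the square of such a root preserves the
interval between the two fixed points of α around 0. With odd degrees this gives d ∣ d', and by
symmetry d = d'. Finally, infinitely many odd d satisfy the congruences and the coprimality because
the orbifold Euler characteristic is nonzero (`exists_coprime_degrees`). -/

theorem circleOrd_coe_of_lt {x y z : ℝ} (hxy : x < y) (hyz : y < z) (hzx : z < x + 1) :
    circleOrd (x : UnitAddCircle) (y : UnitAddCircle) (z : UnitAddCircle) = 1 := by
  have h : sbtw (x : UnitAddCircle) (y : UnitAddCircle) (z : UnitAddCircle) := by
    rw [sbtw_iff_not_btw]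
    intro hb
    have hb' := QuotientAddGroup.btw_coe_iff.1 hb
    have hp : (0 : ℝ) < 1 := one_pos
    -- `btw` compares representatives in a window starting at z; both y and x lie just before z, so
    -- each wraps around once.
    have e1 : toIcoMod hp z y = y + 1 :=
      (toIcoMod_eq_iff hp).2 ⟨⟨by linarith, by linarith⟩, -1, by simp⟩
    have e2 : toIocMod hp z x = x + 1 :=
      (toIocMod_eq_iff hp).2 ⟨⟨by linarith, by linarith⟩, -1, by simp⟩
    have : toIcoMod hp z y ≤ toIocMod hp z x := hb'
    rw [e1, e2] at this
    linarith
  simp [circleOrd, h]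

theorem circleOrd_swap_of_eq_one {p q r : UnitAddCircle} (h : circleOrd p q r = 1) :
    circleOrd r q p = -1 := by
  have h1 : sbtw p q r := by
    by_contra h1
    by_cases h2 : sbtw r q p <;> simp [circleOrd, h1, h2] at h
  have h2 : ¬ sbtw r q p := h1.not_sbtw
  simp [circleOrd, h1, h2]

theorem circleOrd_eq_zero_of_eq {p q r : UnitAddCircle} (h : p = q ∨ q = r ∨ p = r) :
    circleOrd p q r = 0 := by
  rcases h with rfl | rfl | rfl
  · simp [circleOrd, sbtw_irrefl_left, sbtw_irrefl_right]
  · simp [circleOrd, sbtw_irrefl_left, sbtw_irrefl_right]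
  · simp [circleOrd, sbtw_irrefl_left_right]

/-- The point of `ℝ / ℤ` with coordinate `x` when the circle is given circumference `N`. -/
def circlePt (N x : ℝ) : UnitAddCircle := ((x / N : ℝ) : UnitAddCircle)

theorem circlePt_eq_iff {N : ℝ} (hN : 0 < N) {x y : ℝ} :
    circlePt N x = circlePt N y ↔ ∃ z : ℤ, y = x + z * N := by
  unfold circlePt
  rw [QuotientAddGroup.eq]
  simp only [AddSubgroup.mem_zmultiples_iff, zsmul_eq_mul, mul_one]
  constructor
  · rintro ⟨z, hz⟩
    refine ⟨z, ?_⟩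
    rw [hz]
    field_simp
    ring
  · rintro ⟨z, rfl⟩
    refine ⟨z, ?_⟩
    field_simp
    ring

theorem circlePt_add_int_mul {N : ℝ} (hN : 0 < N) (x : ℝ) (z : ℤ) :
    circlePt N (x + z * N) = circlePt N x :=
  ((circlePt_eq_iff hN).2 ⟨z, rfl⟩).symm

theorem circlePt_surjective {N : ℝ} (hN : 0 < N) : Surjective (circlePt N) := by
  intro p
  induction p using QuotientAddGroup.induction_on with
  | H x => exact ⟨x * N, by simp only [circlePt]; congr 1; field_simp⟩

theorem circleOrd_circlePt_of_lt {N : ℝ} (hN : 0 < N) {x y z : ℝ} (hxy : x < y) (hyz : y < z)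
    (hzx : z < x + N) : circleOrd (circlePt N x) (circlePt N y) (circlePt N z) = 1 := by
  apply circleOrd_coe_of_lt
  · gcongr
  · gcongr
  · rw [div_lt_iff₀ hN, add_mul, one_mul, div_mul_cancel₀ _ hN.ne']
    exact hzx

/-- Every point has a coordinate in the half-open interval that starts at a given place. -/
theorem exists_circlePt_mem_Ico {N : ℝ} (hN : 0 < N) (x : ℝ) (p : UnitAddCircle) :
    ∃ y, circlePt N y = p ∧ x ≤ y ∧ y < x + N := by
  obtain ⟨y, rfl⟩ := circlePt_surjective hN p
  refine ⟨toIcoMod hN x y, ?_, left_le_toIcoMod hN x y, toIcoMod_lt_right hN x y⟩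
  rw [circlePt_eq_iff hN]
  exact ⟨toIcoDiv hN x y, by simp⟩

/-- Cutting the circle at x puts the other two points in one window [x, x + N), where orientation is
an inequality of real numbers. -/
theorem circlePt_trichotomy {N : ℝ} (hN : 0 < N) (x : ℝ) (q r : UnitAddCircle) :
    (circlePt N x = q ∨ q = r ∨ circlePt N x = r) ∨
    (∃ y z, circlePt N y = q ∧ circlePt N z = r ∧ x < y ∧ y < z ∧ z < x + N) ∨
    ∃ y z, circlePt N y = q ∧ circlePt N z = r ∧ x < z ∧ z < y ∧ y < x + N := by
  obtain ⟨y, rfl, hy, hy'⟩ := exists_circlePt_mem_Ico hN x q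
  obtain ⟨z, rfl, hz, hz'⟩ := exists_circlePt_mem_Ico hN x r
  rcases hy.eq_or_lt with rfl | hy
  · simp
  rcases hz.eq_or_lt with rfl | hz
  · simp
  rcases lt_trichotomy y z with h | rfl | h
  · exact Or.inr (Or.inl ⟨y, z, rfl, rfl, hy, h, hz'⟩)
  · simp
  · exact Or.inr (Or.inr ⟨y, z, rfl, rfl, hz, h, hy'⟩)

theorem circleOrd_circlePt_of_gt {N : ℝ} (hN : 0 < N) {x y z : ℝ} (hxz : x < z) (hzy : z < y)
    (hyx : y < x + N) : circleOrd (circlePt N x) (circlePt N y) (circlePt N z) = -1 := by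
  apply circleOrd_swap_of_eq_one
  have := circleOrd_circlePt_of_lt hN hzy hyx (by linarith)
  have e := circlePt_add_int_mul hN x 1
  push_cast at e
  rw [one_mul] at e
  rwa [e] at this

theorem circleOrd_circlePt_eq_one_iff {N : ℝ} (hN : 0 < N) {x : ℝ} {q r : UnitAddCircle} :
    circleOrd (circlePt N x) q r = 1 ↔
      ∃ y z, circlePt N y = q ∧ circlePt N z = r ∧ x < y ∧ y < z ∧ z < x + N := by
  constructor
  · intro h
    rcases circlePt_trichotomy hN x q r with h' | h' | ⟨y, z, rfl, rfl, h1, h2, h3⟩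
    · rw [circleOrd_eq_zero_of_eq h'] at h
      exact absurd h (by decide)
    · exact h'
    · rw [circleOrd_circlePt_of_gt hN h1 h2 h3] at h
      exact absurd h (by decide)
  · rintro ⟨y, z, rfl, rfl, h1, h2, h3⟩
    exact circleOrd_circlePt_of_lt hN h1 h2 h3

theorem circleOrd_eq_zero_iff {p q r : UnitAddCircle} :
    circleOrd p q r = 0 ↔ p = q ∨ q = r ∨ p = r := by
  refine ⟨fun h => ?_, circleOrd_eq_zero_of_eq⟩
  obtain ⟨x, rfl⟩ := circlePt_surjective one_pos p
  rcases circlePt_trichotomy one_pos x q r with h' | ⟨y, z, rfl, rfl, h1, h2, h3⟩ |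
    ⟨y, z, rfl, rfl, h1, h2, h3⟩
  · exact h'
  · rw [circleOrd_circlePt_of_lt one_pos h1 h2 h3] at h
    exact absurd h (by decide)
  · rw [circleOrd_circlePt_of_gt one_pos h1 h2 h3] at h
    exact absurd h (by decide)

/-- Once the circle is cut at 0, orientation becomes the coboundary of the linear order on [0, 1),
which makes the cocycle identity formal. -/
theorem circleOrd_circlePt_of_mem_Ico {x y z : ℝ} (hx : x ∈ Set.Ico (0 : ℝ) 1)
    (hy : y ∈ Set.Ico (0 : ℝ) 1) (hz : z ∈ Set.Ico (0 : ℝ) 1) :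
    (circleOrd (circlePt 1 x) (circlePt 1 y) (circlePt 1 z) : ℤ) =
      GroupCircularOrder.orderSign (· < ·) y z - GroupCircularOrder.orderSign (· < ·) x z +
        GroupCircularOrder.orderSign (· < ·) x y := by
  obtain ⟨hx, hx'⟩ := hx
  obtain ⟨hy, hy'⟩ := hy
  obtain ⟨hz, hz'⟩ := hz
  have e : ∀ w : ℝ, circlePt 1 (w + 1) = circlePt 1 w := fun w => by
    simpa using circlePt_add_int_mul one_pos w 1
  unfold GroupCircularOrder.orderSign
  rcases eq_or_ne x y with rfl | n1
  · rw [circleOrd_eq_zero_of_eq (by simp)]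
    simp
  rcases eq_or_ne y z with rfl | n2
  · rw [circleOrd_eq_zero_of_eq (by simp)]
    simp
  rcases eq_or_ne x z with rfl | n3
  · rw [circleOrd_eq_zero_of_eq (by simp)]
    rcases n1.lt_or_gt with h1 | h1 <;> simp [h1, h1.not_gt]
  rcases n1.lt_or_gt with h1 | h1 <;> rcases n2.lt_or_gt with h2 | h2 <;>
    rcases n3.lt_or_gt with h3 | h3
  · rw [circleOrd_circlePt_of_lt one_pos h1 h2 (by linarith)]
    simp [h1, h2, h3]
  · exact absurd h3 (by linarith)
  · rw [circleOrd_circlePt_of_gt one_pos h3 h2 (by linarith)]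
    simp [h1, h2, h3, h2.not_gt]
  -- Adding a period to the coordinates that are too small makes the three monotone; the remaining
  -- cases use the same device.
  · rw [← e z, circleOrd_circlePt_of_lt one_pos h1 (by linarith) (by linarith)]
    simp [h1, h2, h3, h2.not_gt, h3.not_gt]
  · rw [← e y, circleOrd_circlePt_of_gt one_pos h3 (by linarith) (by linarith)]
    simp [h1, h2, h3, h1.not_gt]
  · rw [← e y, ← e z, circleOrd_circlePt_of_lt one_pos (by linarith) (by linarith) (by linarith)]
    simp [h1, h2, h3, h1.not_gt, h3.not_gt]
  · exact absurd h3 (by linarith)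
  · rw [← e y, ← e z, circleOrd_circlePt_of_gt one_pos (by linarith) (by linarith) (by linarith)]
    simp [h1, h2, h3, h1.not_gt, h2.not_gt, h3.not_gt]

theorem circleOrd_cocycle (p q r s : UnitAddCircle) :
    (circleOrd q r s : ℤ) - (circleOrd p r s : ℤ) + (circleOrd p q s : ℤ) -
      (circleOrd p q r : ℤ) = 0 := by
  obtain ⟨x, rfl, hx⟩ := exists_circlePt_mem_Ico one_pos 0 p
  obtain ⟨y, rfl, hy⟩ := exists_circlePt_mem_Ico one_pos 0 q
  obtain ⟨z, rfl, hz⟩ := exists_circlePt_mem_Ico one_pos 0 r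
  obtain ⟨w, rfl, hw⟩ := exists_circlePt_mem_Ico one_pos 0 s
  rw [zero_add] at hx hy hz hw
  rw [circleOrd_circlePt_of_mem_Ico hx hy hz, circleOrd_circlePt_of_mem_Ico hx hy hw,
    circleOrd_circlePt_of_mem_Ico hx hz hw, circleOrd_circlePt_of_mem_Ico hy hz hw]
  ring

/-- The circular order on a group defined by a free orbit on the circle. -/
def GroupCircularOrder.ofOrbit {G : Type*} [Group G] (σ : G →* HomeoPlus) (x : UnitAddCircle)
    (hfree : ∀ g, (σ g).1 x = x → g = 1) : GroupCircularOrder G where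
  toFun a b c := circleOrd ((σ a).1 x) ((σ b).1 x) ((σ c).1 x)
  eq_zero_iff a b c := by
    have key : ∀ a b, (σ a).1 x = (σ b).1 x ↔ a = b := by
      refine fun a b => ⟨fun h => ?_, fun h => h ▸ rfl⟩
      have h1 : (σ (a⁻¹ * b)).1 x = x := by
        rw [map_mul, map_inv]
        change (σ a).1⁻¹ ((σ b).1 x) = x
        rw [← h]
        exact (σ a).1.symm_apply_apply x
      exact inv_mul_eq_one.1 (hfree _ h1)
    rw [circleOrd_eq_zero_iff, key, key, key]
  cocycle a b c d := circleOrd_cocycle _ _ _ _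
  left_inv g a b c := by
    have e : ∀ a, (σ (g * a)).1 x = (σ g).1 ((σ a).1 x) := fun a => by rw [map_mul]; rfl
    rw [e, e, e]
    exact (σ g).2 _ _ _

/-! ### Lifts of circle homeomorphisms to the line -/

/-- Increasing bijections of the line that commute with the translation by `N`. -/
def lineLift (N : ℕ) : Subgroup (Equiv.Perm ℝ) where
  carrier := {f | StrictMono f ∧ ∀ x, f (x + N) = f x + N}
  mul_mem' {f g} hf hg := ⟨hf.1.comp hg.1, fun x => by simp [hg.2, hf.2]⟩
  one_mem' := ⟨strictMono_id, fun x => rfl⟩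
  inv_mem' {f} hf := by
    refine ⟨fun x y hxy => ?_, fun x => ?_⟩
    · rw [← hf.1.lt_iff_lt]
      simpa using hxy
    · rw [Equiv.Perm.inv_eq_iff_eq, hf.2]
      simp

/-- The group of increasing bijections of the line that commute with the translation by `N`. -/
abbrev LineLift (N : ℕ) : Type := lineLift N

namespace LineLift

variable {N : ℕ}

theorem strictMono (f : LineLift N) : StrictMono f.1 := f.2.1

theorem lt_iff (f : LineLift N) {x y : ℝ} : f.1 x < f.1 y ↔ x < y := f.2.1.lt_iff_lt

theorem le_iff (f : LineLift N) {x y : ℝ} : f.1 x ≤ f.1 y ↔ x ≤ y := f.2.1.le_iff_le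

theorem apply_add_int (f : LineLift N) (x : ℝ) (z : ℤ) : f.1 (x + z * N) = f.1 x + z * N := by
  induction z using Int.induction_on with
  | zero => simp
  | succ i ih =>
    push_cast at ih ⊢
    rw [add_mul, one_mul, ← add_assoc, f.2.2, ih]
    ring
  | pred i ih =>
    push_cast at ih ⊢
    have := f.2.2 (x + (-i - 1) * N)
    rw [show x + (-(i : ℝ) - 1) * N + N = x + -i * N by ring, ih] at this
    linarith

protected theorem continuous (f : LineLift N) : Continuous f.1 :=
  f.strictMono.monotone.continuous_of_surjective f.1.surjective

@[simp]
theorem mul_apply (f g : LineLift N) (x : ℝ) : (f * g).1 x = f.1 (g.1 x) := rfl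

@[simp]
theorem one_apply (x : ℝ) : (1 : LineLift N).1 x = x := rfl

@[simp]
theorem inv_apply_self (f : LineLift N) (x : ℝ) : (f⁻¹).1 (f.1 x) = x := f.1.symm_apply_apply x

@[simp]
theorem apply_inv_self (f : LineLift N) (x : ℝ) : f.1 ((f⁻¹).1 x) = x := f.1.apply_symm_apply x

theorem ext {f g : LineLift N} (h : ∀ x, f.1 x = g.1 x) : f = g :=
  Subtype.ext (Equiv.ext h)

/-- The translation by a real number. -/
def translate (N : ℕ) (a : ℝ) : LineLift N :=
  ⟨Equiv.addRight a, fun x y h => by simpa using h, fun x => by simp; ring⟩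

@[simp]
theorem translate_apply (a x : ℝ) : (translate N a).1 x = x + a := rfl

theorem translate_mul (a b : ℝ) : translate N a * translate N b = translate N (a + b) :=
  ext fun x => by simp; ring

theorem translate_pow (a : ℝ) (j : ℕ) : translate N a ^ j = translate N (j * a) := by
  induction j with
  | zero => exact ext fun x => by simp
  | succ j ih => rw [pow_succ, ih, translate_mul]; congr 1; push_cast; ring

theorem translate_inv (a : ℝ) : (translate N a)⁻¹ = translate N (-a) := by
  rw [inv_eq_iff_mul_eq_one, translate_mul]
  exact ext fun x => by simp

theorem translate_period_commute (f : LineLift N) (z : ℤ) :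
    f * translate N (z * N) = translate N (z * N) * f :=
  ext fun x => by simp [f.apply_add_int]

variable [NeZero N]

theorem period_pos (N d : ℕ) [NeZero N] [NeZero d] : (0 : ℝ) < N * d := by
  have h1 : 0 < N := Nat.pos_of_ne_zero (NeZero.ne N)
  have h2 : 0 < d := Nat.pos_of_ne_zero (NeZero.ne d)
  positivity

variable (d : ℕ) [NeZero d]

theorem circleMap_periodic (f : LineLift N) :
    Function.Periodic (fun x : ℝ => circlePt (N * d) (f.1 (N * d * x))) 1 := by
  intro x
  have := f.apply_add_int (N * d * x) d
  push_cast at this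
  beta_reduce
  rw [mul_add, mul_one, show (N : ℝ) * d * x + N * d = N * d * x + d * N by ring, this,
    show f.1 (N * d * x) + d * N = f.1 (N * d * x) + ((1 : ℤ) : ℝ) * (N * d) by push_cast; ring]
  exact circlePt_add_int_mul (period_pos N d) _ _

/-- The map induced on the circle of circumference `N * d`. -/
def circleMap (f : LineLift N) : UnitAddCircle → UnitAddCircle := (circleMap_periodic d f).lift

theorem circleMap_circlePt (f : LineLift N) (x : ℝ) :
    circleMap d f (circlePt (N * d) x) = circlePt (N * d) (f.1 x) := by
  have h := period_pos N d
  have : circleMap d f ((x / (N * d) : ℝ) : UnitAddCircle) =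
      circlePt (N * d) (f.1 (N * d * (x / (N * d)))) := (circleMap_periodic d f).lift_coe _
  rw [mul_div_cancel₀ _ h.ne'] at this
  exact this

theorem circleMap_continuous (f : LineLift N) : Continuous (circleMap d f) := by
  refine continuous_quot_lift _ ?_
  exact (AddCircle.continuous_mk' 1).comp
    ((f.continuous.comp (continuous_const.mul continuous_id)).div_const _)

theorem circleMap_mul (f g : LineLift N) (p : UnitAddCircle) :
    circleMap d (f * g) p = circleMap d f (circleMap d g p) := by
  obtain ⟨x, rfl⟩ := circlePt_surjective (period_pos N d) p
  simp [circleMap_circlePt]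

theorem circleMap_one (p : UnitAddCircle) : circleMap d (1 : LineLift N) p = p := by
  obtain ⟨x, rfl⟩ := circlePt_surjective (period_pos N d) p
  simp [circleMap_circlePt]

theorem circleOrd_circleMap (f : LineLift N) (p q r : UnitAddCircle) :
    circleOrd (circleMap d f p) (circleMap d f q) (circleMap d f r) = circleOrd p q r := by
  have hN := period_pos N d
  obtain ⟨x, rfl⟩ := circlePt_surjective hN p
  have e : f.1 (x + N * d) = f.1 x + N * d := by
    have := f.apply_add_int x d
    push_cast at this
    rw [mul_comm (N : ℝ), this]
  rcases circlePt_trichotomy hN x q r with h | ⟨y, z, rfl, rfl, h1, h2, h3⟩ |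
    ⟨y, z, rfl, rfl, h1, h2, h3⟩
  · rw [circleOrd_eq_zero_of_eq h, circleOrd_eq_zero_of_eq]
    rcases h with h | h | h <;> simp [h]
  · simp only [circleMap_circlePt]
    rw [circleOrd_circlePt_of_lt hN h1 h2 h3,
      circleOrd_circlePt_of_lt hN (f.strictMono h1) (f.strictMono h2) (e ▸ f.strictMono h3)]
  · simp only [circleMap_circlePt]
    rw [circleOrd_circlePt_of_gt hN h1 h2 h3,
      circleOrd_circlePt_of_gt hN (f.strictMono h1) (f.strictMono h2) (e ▸ f.strictMono h3)]

/-- The action of `LineLift N` on the circle of circumference `N * d`, a `d`-fold cover of the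
circle of circumference `N`. -/
def toCircle : LineLift N →* HomeoPlus where
  toFun f :=
    ⟨{ toFun := circleMap d f
       invFun := circleMap d f⁻¹
       left_inv := fun p => by rw [← circleMap_mul, inv_mul_cancel, circleMap_one]
       right_inv := fun p => by rw [← circleMap_mul, mul_inv_cancel, circleMap_one]
       continuous_toFun := circleMap_continuous d f
       continuous_invFun := circleMap_continuous d f⁻¹ }, circleOrd_circleMap d f⟩
  map_one' := Subtype.ext (Homeomorph.ext fun p => circleMap_one d p)
  map_mul' f g := Subtype.ext (Homeomorph.ext fun p => circleMap_mul d f g p)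

@[simp]
theorem toCircle_circlePt (f : LineLift N) (x : ℝ) :
    (toCircle d f).1 (circlePt (N * d) x) = circlePt (N * d) (f.1 x) := circleMap_circlePt d f x

theorem toCircle_translate (z : ℤ) : toCircle d (translate N (z * (N * d))) = 1 := by
  refine Subtype.ext (Homeomorph.ext fun p => ?_)
  obtain ⟨x, rfl⟩ := circlePt_surjective (period_pos N d) p
  rw [toCircle_circlePt, translate_apply, circlePt_add_int_mul (period_pos N d)]
  rfl

/-- A lift of the identity is a deck translation. -/
theorem eq_translate_of_toCircle_eq_one {f : LineLift N} (hf : toCircle d f = 1) :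
    ∃ z : ℤ, f = translate N (z * (N * d)) := by
  have hN := period_pos N d
  have h1 : ∀ x, ∃ z : ℤ, f.1 x = x + z * (N * d) := fun x => by
    have := toCircle_circlePt d f x
    rw [hf] at this
    exact (circlePt_eq_iff hN).1 this
  obtain ⟨z, hz⟩ := h1 0
  have e : ∀ u : ℤ, ∀ x, f.1 (x + u * (N * d)) = f.1 x + u * (N * d) := fun u x => by
    have := f.apply_add_int x (u * d)
    push_cast at this
    rw [show (u : ℝ) * (N * d) = u * d * N by ring, this]
  -- The integer cannot depend on x: by monotonicity f x lies between f 0 and f 0 plus one period.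
  have h2 : ∀ x : ℝ, 0 ≤ x → x < N * d → f.1 x = x + z * (N * d) := by
    intro x hx hx'
    obtain ⟨u, hu⟩ := h1 x
    have h3 := f.le_iff.2 hx
    have h4 := f.lt_iff.2 hx'
    have h5 := e 1 0
    rw [zero_add, Int.cast_one, one_mul] at h5
    rw [h5] at h4
    rw [hz, hu] at h3 h4
    have : u = z := by
      have a1 : ((z - 1 : ℤ) : ℝ) * (N * d) < u * (N * d) := by push_cast; linarith
      have a2 : (u : ℝ) * (N * d) < ((z + 1 : ℤ) : ℝ) * (N * d) := by push_cast; linarith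
      have a3 := (mul_lt_mul_iff_left₀ hN).1 a1
      have a4 := (mul_lt_mul_iff_left₀ hN).1 a2
      have a5 : z - 1 < u := by exact_mod_cast a3
      have a6 : u < z + 1 := by exact_mod_cast a4
      omega
    rw [hu, this]
  refine ⟨z, ext fun x => ?_⟩
  have h6 : x = toIcoMod hN 0 x + toIcoDiv hN 0 x * (N * d) := by simp
  have h7 := h2 (toIcoMod hN 0 x) (left_le_toIcoMod hN 0 x)
    (by simpa using toIcoMod_lt_right hN 0 x)
  rw [h6, e, h7, translate_apply]
  ring

end LineLift

end

/-! ### Elementary properties of circular orders -/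

namespace GroupCircularOrder

variable {Γ : Type*} [Group Γ] (c : GroupCircularOrder Γ)

theorem _root_.SignType.intCast_cases (s : SignType) :
    (s = 1 ∧ (s : ℤ) = 1) ∨ (s = 0 ∧ (s : ℤ) = 0) ∨ (s = -1 ∧ (s : ℤ) = -1) := by
  cases s <;> simp

theorem _root_.SignType.intCast_injective {s t : SignType} (h : (s : ℤ) = t) : s = t := by
  rcases s.intCast_cases with ⟨h1, h2⟩ | ⟨h1, h2⟩ | ⟨h1, h2⟩ <;>
    rcases t.intCast_cases with ⟨h3, h4⟩ | ⟨h3, h4⟩ | ⟨h3, h4⟩ <;>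
    first
    | exact h1.trans h3.symm
    | omega

theorem intCast_eq_one_iff (a b x : Γ) : (c.toFun a b x : ℤ) = 1 ↔ c.toFun a b x = 1 := by
  rcases (c.toFun a b x).intCast_cases with ⟨h1, h2⟩ | ⟨h1, h2⟩ | ⟨h1, h2⟩ <;> simp [h1]

theorem bounds (a b x : Γ) : -1 ≤ (c.toFun a b x : ℤ) ∧ (c.toFun a b x : ℤ) ≤ 1 := by
  rcases (c.toFun a b x).intCast_cases with ⟨h1, h2⟩ | ⟨h1, h2⟩ | ⟨h1, h2⟩ <;> omega

theorem intCast_eq_zero {a b x : Γ} (h : a = b ∨ b = x ∨ a = x) : (c.toFun a b x : ℤ) = 0 := by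
  rw [(c.eq_zero_iff a b x).2 h]
  simp

theorem intCast_ne_zero {a b x : Γ} (h1 : a ≠ b) (h2 : b ≠ x) (h3 : a ≠ x) :
    (c.toFun a b x : ℤ) ≠ 0 := by
  intro h
  rcases (c.toFun a b x).intCast_cases with ⟨_, e2⟩ | ⟨e1, _⟩ | ⟨_, e2⟩
  · omega
  · rcases (c.eq_zero_iff a b x).1 e1 with h | h | h <;> contradiction
  · omega

theorem intCast_rotate (a b x : Γ) : (c.toFun b x a : ℤ) = c.toFun a b x := by
  have h := c.cocycle a b x a
  rw [c.intCast_eq_zero (a := a) (b := x) (x := a) (by simp),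
    c.intCast_eq_zero (a := a) (b := b) (x := a) (by simp)] at h
  omega

theorem intCast_swap (a b x : Γ) : (c.toFun b a x : ℤ) = -c.toFun a b x := by
  have h := c.cocycle a b a x
  rw [c.intCast_eq_zero (a := a) (b := a) (x := x) (by simp),
    c.intCast_eq_zero (a := a) (b := b) (x := a) (by simp)] at h
  omega

theorem intCast_swap_right (a b x : Γ) : (c.toFun a x b : ℤ) = -c.toFun a b x := by
  have h := c.cocycle a b x b
  rw [c.intCast_eq_zero (a := b) (b := x) (x := b) (by simp),
    c.intCast_eq_zero (a := a) (b := b) (x := b) (by simp)] at h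
  omega

theorem ne_of_eq_one {a b x : Γ} (h : c.toFun a b x = 1) : a ≠ b ∧ b ≠ x ∧ a ≠ x := by
  refine ⟨?_, ?_, ?_⟩ <;> rintro rfl
  · rw [(c.eq_zero_iff a a x).2 (by simp)] at h
    exact absurd h (by decide)
  · rw [(c.eq_zero_iff a b b).2 (by simp)] at h
    exact absurd h (by decide)
  · rw [(c.eq_zero_iff a b a).2 (by simp)] at h
    exact absurd h (by decide)

/-- Seen from `a`, a circular order is a transitive relation. -/
theorem trans_from {a x y z : Γ} (h1 : c.toFun a x y = 1) (h2 : c.toFun a y z = 1) :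
    c.toFun a x z = 1 := by
  rw [← intCast_eq_one_iff] at *
  have h := c.cocycle a x y z
  have := c.bounds x y z
  have := c.bounds a x z
  omega

theorem rotate_eq_one {a b x : Γ} (h : c.toFun a b x = 1) : c.toFun b x a = 1 := by
  rw [← intCast_eq_one_iff] at *
  rw [intCast_rotate, h]

/-- `g` lies in the closed positive arc from `a` to `b`. -/
def ClosedArc (a g b : Γ) : Prop := c.toFun a g b = 1 ∨ g = a ∨ g = b

variable {c}

/-- Nesting of [b, b'] in [a, a'] is encoded by conditions on the four endpoints alone. They can
thus be checked on a finite set while g is arbitrary. -/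
theorem ClosedArc.mono {a a' b b' g : Γ} (h : c.ClosedArc b g b') (h1 : c.ClosedArc a b b')
    (h2 : c.ClosedArc a b a') (h3 : c.ClosedArc a b' a') (h4 : c.ClosedArc b b' a') :
    c.ClosedArc a g a' := by
  rcases h with h | rfl | rfl
  · obtain ⟨n1, n2, n3⟩ := c.ne_of_eq_one h
    have k1 : b = a ∨ c.toFun a b b' = 1 := by
      rcases h1 with h1 | h1 | h1
      · exact Or.inr h1
      · exact Or.inl h1
      · exact absurd h1 n3
    have k2 : b' = a' ∨ c.toFun b b' a' = 1 := by
      rcases h4 with h4 | h4 | h4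
      · exact Or.inr h4
      · exact absurd h4.symm n3
      · exact Or.inl h4
    have k3 : c.toFun a g b' = 1 := by
      rcases k1 with rfl | k1
      · exact h
      · have := c.trans_from (c.rotate_eq_one (c.rotate_eq_one k1))
          (c.rotate_eq_one (c.rotate_eq_one h))
        exact c.rotate_eq_one this
    rcases k2 with rfl | k2
    · exact Or.inl k3
    · refine Or.inl (c.trans_from k3 ?_)
      rcases h3 with h3 | rfl | rfl
      · exact h3
      · exact absurd rfl (c.ne_of_eq_one k3).2.2
      · exact absurd rfl (c.ne_of_eq_one k2).2.1
  · exact h2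
  · exact h3

/-- The position of `g`, relative to points outside an open arc that contains it, is determined by
the endpoints of the arc. -/
theorem toFun_eq_of_mem_arc {c' : GroupCircularOrder Γ} {p q g x y : Γ} (h : c.toFun p g q = 1)
    (h' : c'.toFun p g q = 1) (hx : c.toFun p x q ≠ 1) (hx' : c'.toFun p x q ≠ 1)
    (hy : c.toFun p y q ≠ 1) (hy' : c'.toFun p y q ≠ 1) (hxy : c.toFun x y p = c'.toFun x y p) :
    c.toFun x y g = c'.toFun x y g := by
  -- Seen from p, the element g comes before every z ≠ p that is not strictly inside the arc.
  have key : ∀ (C : GroupCircularOrder Γ) (z : Γ), C.toFun p g q = 1 → C.toFun p z q ≠ 1 → z ≠ p →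
      (C.toFun p g z : ℤ) = 1 := by
    intro C z h hz hzp
    rw [intCast_eq_one_iff]
    rcases eq_or_ne z q with rfl | hzq
    · exact h
    · refine C.trans_from h ?_
      rw [ne_eq, ← intCast_eq_one_iff] at hz
      rw [← intCast_eq_one_iff]
      have := C.intCast_swap_right p z q
      have := C.bounds p z q
      have := C.intCast_ne_zero hzp.symm hzq (C.ne_of_eq_one h).2.2
      omega
  apply SignType.intCast_injective
  rcases eq_or_ne x p with rfl | hxp
  · rcases eq_or_ne y x with rfl | hyp
    · rw [c.intCast_eq_zero (by simp), c'.intCast_eq_zero (by simp)]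
    · rw [c.intCast_swap_right, c'.intCast_swap_right, key c y h hy hyp, key c' y h' hy' hyp]
  · rcases eq_or_ne y p with rfl | hyp
    · rw [← c.intCast_rotate, ← c'.intCast_rotate, key c x h hx hxp, key c' x h' hx' hxp]
    · have e : ∀ (C : GroupCircularOrder Γ), C.toFun p g q = 1 → C.toFun p x q ≠ 1 →
          C.toFun p y q ≠ 1 → (C.toFun x y g : ℤ) = C.toFun x y p := by
        intro C h hx hy
        have := C.cocycle p g x y
        rw [key C y h hy hyp, key C x h hx hxp] at this
        have := C.intCast_rotate g x y
        have := C.intCast_rotate p x y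
        omega
      rw [e c' h' hx' hy', e c h hx hy, hxy]

/-- A circular order is determined by the triples `(1, s, g)` with `s` in a generating set. -/
theorem eq_of_forall_generator {c' : GroupCircularOrder Γ} {L : Type*} (val : L → Γ)
    (hgen : ∀ g, ∃ w : List L, (w.map val).prod = g)
    (h : ∀ s g, c.toFun 1 (val s) g = c'.toFun 1 (val s) g) : c = c' := by
  have key : ∀ (w : List L) (g : Γ),
      (c.toFun 1 (w.map val).prod g : ℤ) = c'.toFun 1 (w.map val).prod g := by
    intro w
    induction w with
    | nil =>
      intro g
      rw [c.intCast_eq_zero (by simp), c'.intCast_eq_zero (by simp)]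
    | cons s w ih =>
      intro g
      rw [List.map_cons, List.prod_cons]
      -- The cocycle on 1, s, s·w, g reduces the triple (1, s·w, g) to triples starting with (1, s)
      -- and, after left translation by s⁻¹, to (1, w, s⁻¹g).
      have h1 := c.cocycle 1 (val s) (val s * (w.map val).prod) g
      have h2 := c'.cocycle 1 (val s) (val s * (w.map val).prod) g
      have e : ∀ C : GroupCircularOrder Γ, C.toFun (val s) (val s * (w.map val).prod) g =
          C.toFun 1 (w.map val).prod ((val s)⁻¹ * g) := by
        intro C
        rw [← C.left_inv (val s) 1]
        simp
      rw [e, h, h, ih] at h1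
      rw [e] at h2
      omega
  ext a b x : 4
  obtain ⟨w, hw⟩ := hgen (a⁻¹ * b)
  have e : ∀ C : GroupCircularOrder Γ, C.toFun a b x = C.toFun 1 (a⁻¹ * b) (a⁻¹ * x) := by
    intro C
    rw [← C.left_inv a 1]
    simp
  rw [e, e c', ← hw]
  exact SignType.intCast_injective (key w _)

/-- A circular order that is determined by its values on finitely many triples is isolated. -/
theorem isIsolated_of_finite {B : Set Γ} (hB : B.Finite)
    (h : ∀ c' : GroupCircularOrder Γ,
      (∀ a ∈ B, ∀ b ∈ B, ∀ x ∈ B, c.toFun a b x = c'.toFun a b x) → c = c') :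
    c.IsIsolated := by
  have e : ({c} : Set (GroupCircularOrder Γ)) = ⋂ a ∈ B, ⋂ b ∈ B, ⋂ x ∈ B,
      {c' | c'.toFun a b x = c.toFun a b x} := by
    ext c'
    simp only [Set.mem_singleton_iff, Set.mem_iInter, Set.mem_ofPred_eq]
    constructor
    · rintro rfl
      intros
      rfl
    · intro h'
      exact (h c' fun a ha b hb x hx => (h' a ha b hb x hx).symm).symm
  unfold IsIsolated
  rw [e]
  refine hB.isOpen_biInter fun a _ => hB.isOpen_biInter fun b _ => hB.isOpen_biInter fun x _ => ?_
  have hc : Continuous fun c' : GroupCircularOrder Γ => c'.toFun a b x := by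
    have h0 : Continuous (GroupCircularOrder.toFun (Γ := Γ)) := continuous_induced_dom
    exact (continuous_apply x).comp ((continuous_apply b).comp ((continuous_apply a).comp h0))
  exact (isOpen_discrete {c.toFun a b x}).preimage hc

end GroupCircularOrder

/-! ### Ping-pong systems on the line -/

open LineLift in
/-- A ping-pong system for a group acting on the circle of circumference `κ * d`, described on the
line. The arcs are `[j + 1/4, j + 3/4]` for `j : ℤ`, labelled by `j` modulo `κ`. A letter `s` maps
the complement of the arcs labelled `source s` into the arcs labelled `target s`. The letter
`edge j` maps the right endpoint of the arc before `next j` to the left endpoint of the arc after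
`j`; going round along `next` reads off the word `bdry` that represents the boundary component. -/
structure PingPongSystem (G : Type*) [Group G] (κ d : ℕ) [NeZero κ] [NeZero d] (L : Type*) where
  σ : G →* HomeoPlus
  val : L → G
  lift : L → LineLift κ
  toCircle_lift : ∀ s, toCircle d (lift s) = σ (val s)
  target : L → ZMod κ
  source : L → ZMod κ
  ping : ∀ s (i : ℤ), (i : ZMod κ) ≠ source s → ∃ j : ℤ, (j : ZMod κ) = target s ∧
    (j : ℝ) + 1 / 4 < (lift s).1 i ∧ (lift s).1 (i + 1) < j + 3 / 4
  mul_cases : ∀ s s', target s' = source s →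
    val s * val s' = 1 ∨ ∃ s'', val s * val s' = val s''
  -- Letters with the same target are separated by pulling back: t⁻¹s is trivial or a letter landing
  -- in the arc that t does not contract.
  sep : ∀ s t, target s = target t → val s = val t ∨ ∃ u, val s = val t * val u ∧
    target u = source t
  generate : ∀ g, ∃ w : List L, (w.map val).prod = g
  two_le : 2 ≤ κ
  edge : ℤ → L
  next : ℤ → ℤ
  lift_edge : ∀ j, (lift (edge j)).1 (next j - 1 / 4) = j + 1 / 4
  lift_edge_lt : ∀ j, (lift (edge j)).1 (next j + 1) < j + 3 / 4
  edge_add : ∀ j, edge (j + κ) = edge j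
  next_add : ∀ j, next (j + κ) = next j + κ
  -- The rank counts steps along the boundary word. With the next two fields it forces `next` to
  -- permute the residues modulo κ in a single cycle, so there is only one boundary component.
  rank : ℤ → ZMod κ
  rank_next : ∀ j, rank (next j) = rank j + 1
  rank_eq_zero : ∀ j, rank j = 0 ↔ (κ : ℤ) ∣ j
  bdry : G
  bdry_eq : bdry = ((List.range κ).map fun l => val (edge (next^[l] 0))).prod
  shift : ℤ
  next_iterate : next^[κ] 0 = -(κ * shift)
  -- One turn along the boundary changes the sheet of the cover by `shift`; coprimality links all d
  -- sheets in one cycle.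
  coprime : IsCoprime shift (d : ℤ)
  -- This rigidity is the only trace of the Möbius property that the abstract argument needs.
  lift_eq_one_of_fixed : ∀ (g : G) (f : LineLift κ), toCircle d f = σ g → ∀ p q r : ℝ,
    p < q → q < r → r < p + κ → f.1 p = p → f.1 q = q → f.1 r = r → f = 1

noncomputable section

namespace PingPongSystem

open LineLift GroupCircularOrder

variable {G : Type*} [Group G] {κ d : ℕ} [NeZero κ] [NeZero d] {L : Type*}
  (S : PingPongSystem G κ d L)

include S in
theorem intCast_add_one_ne (a : ZMod κ) : a + 1 ≠ a := by
  have : Fact (1 < κ) := ⟨S.two_le⟩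
  simp

/-- `f` is a lift to the line of the action of `g`. -/
def IsLift (g : G) (f : LineLift κ) : Prop := toCircle d f = S.σ g

variable {S}

theorem IsLift.mul {g g' : G} {f f' : LineLift κ} (h : S.IsLift g f) (h' : S.IsLift g' f') :
    S.IsLift (g * g') (f * f') := by
  unfold IsLift at *
  rw [map_mul, map_mul, h, h']

theorem IsLift.inv {g : G} {f : LineLift κ} (h : S.IsLift g f) : S.IsLift g⁻¹ f⁻¹ := by
  unfold IsLift at *
  rw [map_inv, map_inv, h]

theorem IsLift.pow {g : G} {f : LineLift κ} (h : S.IsLift g f) (n : ℕ) :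
    S.IsLift (g ^ n) (f ^ n) := by
  unfold IsLift at *
  rw [map_pow, map_pow, h]

theorem IsLift.zpow {g : G} {f : LineLift κ} (h : S.IsLift g f) (n : ℤ) :
    S.IsLift (g ^ n) (f ^ n) := by
  unfold IsLift at *
  rw [map_zpow, map_zpow, h]

variable (S)

theorem isLift_one : S.IsLift 1 1 := by simp [IsLift]

theorem isLift_val (s : L) : S.IsLift (S.val s) (S.lift s) := S.toCircle_lift s

theorem isLift_translate (z : ℤ) : S.IsLift 1 (translate κ (z * (κ * d))) := by
  unfold IsLift
  rw [toCircle_translate, map_one]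

variable {S}

theorem IsLift.mul_translate {g : G} {f : LineLift κ} (h : S.IsLift g f) (z : ℤ) :
    S.IsLift g (f * translate κ (z * (κ * d))) := by
  simpa using h.mul (S.isLift_translate z)

theorem isLift_one_iff {f : LineLift κ} :
    S.IsLift 1 f ↔ ∃ z : ℤ, f = translate κ (z * (κ * d)) := by
  constructor
  · intro h
    exact eq_translate_of_toCircle_eq_one d (by rw [h, map_one])
  · rintro ⟨z, rfl⟩
    exact S.isLift_translate z

theorem IsLift.apply_add_period {g : G} {f : LineLift κ} (_ : S.IsLift g f) (x : ℝ) (z : ℤ) :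
    f.1 (x + z * (κ * d)) = f.1 x + z * (κ * d) := by
  have := f.apply_add_int x (z * d)
  push_cast at this
  rw [show (z : ℝ) * (κ * d) = z * d * κ by ring, this]

/-! ### Reduced words and the ping-pong lemma -/

variable (S)

theorem exists_isLift (g : G) : ∃ f, S.IsLift g f := by
  obtain ⟨w, rfl⟩ := S.generate g
  refine ⟨(w.map S.lift).prod, ?_⟩
  induction w with
  | nil => simpa using S.isLift_one
  | cons s w ih => simpa using (S.isLift_val s).mul ih

/-- A word is reduced if no letter is followed by one that lands where it does not contract. -/
def Reduced (w : List L) : Prop := w.IsChain fun s s' => S.target s' ≠ S.source s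

/-- If the new letter meets the target it cannot contract, the two letters cancel or merge into one,
and the word to which a letter is prepended gets shorter. -/
theorem exists_reduced_cons (s : L) (w : List L) (hw : S.Reduced w) :
    ∃ w', S.Reduced w' ∧ (w'.map S.val).prod = S.val s * (w.map S.val).prod := by
  induction w generalizing s with
  | nil => exact ⟨[s], List.isChain_singleton _, by simp⟩
  | cons s' v ih =>
    have hv : S.Reduced v := List.IsChain.tail hw
    by_cases h : S.target s' = S.source s
    · rw [List.map_cons, List.prod_cons, ← mul_assoc]
      rcases S.mul_cases s s' h with h1 | ⟨s'', h1⟩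
      · exact ⟨v, hv, by rw [h1, one_mul]⟩
      · rw [h1]
        exact ih s'' hv
    · exact ⟨s :: s' :: v, List.isChain_cons_cons.2 ⟨h, hw⟩, by simp⟩

theorem exists_reduced (g : G) : ∃ w, S.Reduced w ∧ (w.map S.val).prod = g := by
  obtain ⟨w, rfl⟩ := S.generate g
  induction w with
  | nil => exact ⟨[], List.isChain_nil, rfl⟩
  | cons s w ih =>
    obtain ⟨w', h1, h2⟩ := ih
    obtain ⟨w'', h3, h4⟩ := S.exists_reduced_cons s w' h1
    exact ⟨w'', h3, by rw [h4, h2, List.map_cons, List.prod_cons]⟩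

variable {S}

theorem IsLift.of_cons {s : L} {v : List L} {f : LineLift κ}
    (h : S.IsLift ((s :: v).map S.val).prod f) :
    S.IsLift (v.map S.val).prod ((S.lift s)⁻¹ * f) := by
  have := (S.isLift_val s).inv.mul h
  simpa using this

/-- The image of an integer point lies in an arc of the first letter. -/
theorem IsLift.apply_int_mem_arc {s : L} {v : List L} {f : LineLift κ}
    (hw : S.Reduced (s :: v)) (h : S.IsLift ((s :: v).map S.val).prod f) (i : ℤ) :
    ∃ j : ℤ, (j : ZMod κ) = S.target s ∧ (j : ℝ) + 1 / 4 < f.1 i ∧ f.1 i < j + 3 / 4 := by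
  induction v generalizing s f with
  | nil =>
    have h1 := h.of_cons
    rw [List.map_nil, List.prod_nil, isLift_one_iff] at h1
    obtain ⟨z, hz⟩ := h1
    have h2 : f.1 i = (S.lift s).1 ((i + z * (κ * d) : ℤ) : ℝ) := by
      have : f = S.lift s * ((S.lift s)⁻¹ * f) := by simp
      rw [this, hz]
      simp
    rw [h2]
    generalize i + z * (κ * d) = i'
    -- An integer borders two cells. If the cell on its right carries the source label, the one on
    -- its left does not, since κ ≥ 2.
    by_cases hi : (i' : ZMod κ) = S.source s
    · have hi2 : ((i' - 1 : ℤ) : ZMod κ) ≠ S.source s := by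
        rw [← hi]
        intro h3
        push_cast at h3
        exact S.intCast_add_one_ne ((i' : ZMod κ) - 1) (by rw [sub_add_cancel]; exact h3.symm)
      obtain ⟨j, h4, h5, h6⟩ := S.ping s (i' - 1) hi2
      push_cast at h5 h6
      rw [sub_add_cancel] at h6
      refine ⟨j, h4, h5.trans ?_, h6⟩
      rw [(S.lift s).lt_iff]
      linarith
    · obtain ⟨j, h4, h5, h6⟩ := S.ping s i' hi
      refine ⟨j, h4, h5, lt_trans ?_ h6⟩
      rw [(S.lift s).lt_iff]
      linarith
  | cons s' v ih =>
    have h1 := h.of_cons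
    obtain ⟨hne, hv⟩ := List.isChain_cons_cons.1 hw
    obtain ⟨j', h2, h3, h4⟩ := ih hv h1
    obtain ⟨j, h5, h6, h7⟩ := S.ping s j' (h2 ▸ hne)
    have e : f.1 i = (S.lift s).1 (((S.lift s)⁻¹ * f).1 i) := by simp
    rw [e]
    refine ⟨j, h5, h6.trans ?_, lt_trans ?_ h7⟩
    · rw [(S.lift s).lt_iff]
      linarith
    · rw [(S.lift s).lt_iff]
      linarith

/-- The ping-pong lemma, and the common source of the freeness of the orbit, the emptiness of the
gaps and discreteness. -/
theorem IsLift.eq_one_or_mem_arc {g : G} {f : LineLift κ} (h : S.IsLift g f) (i : ℤ) :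
    g = 1 ∨ ∃ j : ℤ, (j : ℝ) + 1 / 4 < f.1 i ∧ f.1 i < j + 3 / 4 := by
  obtain ⟨w, hw, rfl⟩ := S.exists_reduced g
  cases w with
  | nil => simp
  | cons s v =>
    obtain ⟨j, -, h1⟩ := h.apply_int_mem_arc hw i
    exact Or.inr ⟨j, h1⟩

theorem _root_.not_int_mem_Ioo (i j : ℤ) : ¬ ((j : ℝ) + 1 / 4 < i ∧ (i : ℝ) < j + 3 / 4) := by
  rintro ⟨h1, h2⟩
  have h3 : (j : ℝ) < i := by linarith
  have h4 : (i : ℝ) < (j + 1 : ℤ) := by push_cast; linarith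
  have h5 : j < i := by exact_mod_cast h3
  have h6 : i < j + 1 := by exact_mod_cast h4
  omega

theorem IsLift.eq_one_of_apply_int {g : G} {f : LineLift κ} (h : S.IsLift g f) {i j : ℤ}
    (hf : f.1 i = j) : g = 1 := by
  rcases h.eq_one_or_mem_arc i with h1 | ⟨l, h1⟩
  · exact h1
  · rw [hf] at h1
    exact absurd h1 (not_int_mem_Ioo j l)

/-- An orbit point of `0` that lies outside the open arcs is a deck translate of `0`. -/
theorem IsLift.eq_of_mem_gap {g : G} {f : LineLift κ} (h : S.IsLift g f) {j : ℤ}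
    (h1 : (j : ℝ) - 1 / 4 ≤ f.1 0) (h2 : f.1 0 ≤ j + 1 / 4) :
    f.1 0 = j ∧ (κ * d : ℤ) ∣ j := by
  have h3 := h.eq_one_or_mem_arc 0
  rw [Int.cast_zero] at h3
  rcases h3 with rfl | ⟨l, h4, h5⟩
  · obtain ⟨z, rfl⟩ := isLift_one_iff.1 h
    simp only [translate_apply, zero_add] at *
    have h6 : ((j - 1 : ℤ) : ℝ) < ((z * (κ * d) : ℤ) : ℝ) := by push_cast; linarith
    have h7 : ((z * (κ * d) : ℤ) : ℝ) < ((j + 1 : ℤ) : ℝ) := by push_cast; linarith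
    have h8 := Int.cast_lt.1 h6
    have h9 := Int.cast_lt.1 h7
    have h10 : j = z * (κ * d) := by omega
    refine ⟨by rw [h10]; push_cast; ring, ?_⟩
    rw [h10]
    exact dvd_mul_left _ _
  · have h6 : ((j - 1 : ℤ) : ℝ) < l := by push_cast; linarith
    have h7 : (l : ℝ) < j := by linarith
    have h8 := Int.cast_lt.1 h6
    have h9 := Int.cast_lt.1 h7
    omega

theorem IsLift.eq_of_apply_zero {g g' : G} {f f' : LineLift κ} (h : S.IsLift g f)
    (h' : S.IsLift g' f') (e : f.1 0 = f'.1 0) : g = g' ∧ f = f' := by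
  have h1 := h.inv.mul h'
  have h2 : (f⁻¹ * f').1 ((0 : ℤ) : ℝ) = (0 : ℤ) := by simp [← e]
  have h3 := h1.eq_one_of_apply_int h2
  rw [h3] at h1
  obtain ⟨z, hz⟩ := isLift_one_iff.1 h1
  rw [hz] at h2
  refine ⟨inv_mul_eq_one.1 h3, inv_mul_eq_one.1 ?_⟩
  rw [hz]
  simp only [translate_apply, Int.cast_zero, zero_add] at h2
  rw [h2]
  exact LineLift.ext fun x => by simp

/-! ### The order defined by the orbit of 0, in line coordinates -/

variable (S)

theorem circlePt_zero (N : ℝ) : circlePt N 0 = 0 := by simp [circlePt]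

theorem σ_apply_zero {g : G} {f : LineLift κ} (h : S.IsLift g f) :
    (S.σ g).1 0 = circlePt (κ * d) (f.1 0) := by
  rw [← h, ← circlePt_zero (κ * d), toCircle_circlePt]

theorem free (g : G) (hg : (S.σ g).1 0 = 0) : g = 1 := by
  obtain ⟨f, hf⟩ := S.exists_isLift g
  rw [S.σ_apply_zero hf, ← circlePt_zero (κ * d), circlePt_eq_iff (period_pos κ d)] at hg
  obtain ⟨z, hz⟩ := hg
  refine hf.eq_one_of_apply_int (i := 0) (j := -(z * (κ * d))) ?_
  push_cast
  linarith

/-- A nontrivial element has at most two fixed points up to translation. -/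
theorem eq_one_of_fixed (g : G) (f : LineLift κ) (hf : S.IsLift g f) (p q r : ℝ) (hpq : p < q)
    (hqr : q < r) (hrp : r < p + κ) (hp : f.1 p = p) (hq : f.1 q = q) (hr : f.1 r = r) : g = 1 := by
  have h := S.lift_eq_one_of_fixed g f hf p q r hpq hqr hrp hp hq hr
  refine S.free g ?_
  rw [← hf, h, map_one]
  rfl

/-- The circular order defined by the orbit of `0`. -/
def order : GroupCircularOrder G := GroupCircularOrder.ofOrbit S.σ 0 S.free

theorem order_toFun (a b x : G) :
    S.order.toFun a b x = circleOrd ((S.σ a).1 0) ((S.σ b).1 0) ((S.σ x).1 0) := rfl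

variable {S}

theorem order_eq_one_of_lt {a b x : G} {fa fb fx : LineLift κ} (ha : S.IsLift a fa)
    (hb : S.IsLift b fb) (hx : S.IsLift x fx) (h1 : fa.1 0 < fb.1 0) (h2 : fb.1 0 < fx.1 0)
    (h3 : fx.1 0 < fa.1 0 + κ * d) : S.order.toFun a b x = 1 := by
  rw [order_toFun, S.σ_apply_zero ha, S.σ_apply_zero hb, S.σ_apply_zero hx]
  exact circleOrd_circlePt_of_lt (period_pos κ d) h1 h2 h3

theorem exists_isLift_apply_zero {g : G} {y : ℝ} (h : circlePt (κ * d) y = (S.σ g).1 0) :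
    ∃ f, S.IsLift g f ∧ f.1 0 = y := by
  obtain ⟨f, hf⟩ := S.exists_isLift g
  rw [S.σ_apply_zero hf, eq_comm, circlePt_eq_iff (period_pos κ d)] at h
  obtain ⟨z, hz⟩ := h
  refine ⟨f * translate κ (z * (κ * d)), hf.mul_translate z, ?_⟩
  rw [mul_apply, translate_apply, hf.apply_add_period, hz]

theorem exists_isLift_mem_Ico (S : PingPongSystem G κ d L) (g : G) (x : ℝ) :
    ∃ f, S.IsLift g f ∧ x ≤ f.1 0 ∧ f.1 0 < x + κ * d := by
  obtain ⟨y, h1, h2⟩ := exists_circlePt_mem_Ico (period_pos κ d) x ((S.σ g).1 0)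
  obtain ⟨f, h3, rfl⟩ := exists_isLift_apply_zero h1
  exact ⟨f, h3, h2⟩

theorem IsLift.exists_int {g : G} {f f' : LineLift κ} (h : S.IsLift g f) (h' : S.IsLift g f') :
    ∃ z : ℤ, f' = f * translate κ (z * (κ * d)) := by
  have h1 := h.inv.mul h'
  rw [inv_mul_cancel] at h1
  obtain ⟨z, hz⟩ := isLift_one_iff.1 h1
  exact ⟨z, by rw [← hz]; simp⟩

/-- Two lifts of the same element whose values at `0` are less than a period apart agree. -/
theorem IsLift.eq_of_lt {g : G} {f f' : LineLift κ} (h : S.IsLift g f) (h' : S.IsLift g f')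
    (h1 : f.1 0 < f'.1 0 + κ * d) (h2 : f'.1 0 < f.1 0 + κ * d) : f = f' := by
  obtain ⟨z, rfl⟩ := h.exists_int h'
  have hN := period_pos κ d
  rw [mul_apply, translate_apply, h.apply_add_period] at h1 h2
  have h3 : ((-1 : ℤ) : ℝ) * (κ * d) < z * (κ * d) := by push_cast; linarith
  have h4 : (z : ℝ) * (κ * d) < (1 : ℤ) * (κ * d) := by push_cast; linarith
  have h5 := Int.cast_lt.1 ((mul_lt_mul_iff_left₀ hN).1 h3)
  have h6 := Int.cast_lt.1 ((mul_lt_mul_iff_left₀ hN).1 h4)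
  have h7 : z = 0 := by omega
  subst h7
  exact LineLift.ext fun x => by simp

theorem exists_lt_of_order_eq_one {a b x : G} {fa : LineLift κ} (ha : S.IsLift a fa)
    (h : S.order.toFun a b x = 1) : ∃ fb fx, S.IsLift b fb ∧ S.IsLift x fx ∧
      fa.1 0 < fb.1 0 ∧ fb.1 0 < fx.1 0 ∧ fx.1 0 < fa.1 0 + κ * d := by
  rw [order_toFun, S.σ_apply_zero ha, circleOrd_circlePt_eq_one_iff (period_pos κ d)] at h
  obtain ⟨y, z, hy, hz, h1, h2, h3⟩ := h
  obtain ⟨fb, hb, rfl⟩ := exists_isLift_apply_zero hy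
  obtain ⟨fx, hx, rfl⟩ := exists_isLift_apply_zero hz
  exact ⟨fb, fx, hb, hx, h1, h2, h3⟩

theorem closedArc_of_le {a b x : G} {fa fb fx : LineLift κ} (ha : S.IsLift a fa)
    (hb : S.IsLift b fb) (hx : S.IsLift x fx) (h1 : fa.1 0 ≤ fb.1 0) (h2 : fb.1 0 ≤ fx.1 0)
    (h3 : fx.1 0 < fa.1 0 + κ * d) : S.order.ClosedArc a b x := by
  rcases h1.eq_or_lt with h1 | h1
  · exact Or.inr (Or.inl (hb.eq_of_apply_zero ha h1.symm).1)
  rcases h2.eq_or_lt with h2 | h2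
  · exact Or.inr (Or.inr (hb.eq_of_apply_zero hx h2).1)
  exact Or.inl (order_eq_one_of_lt ha hb hx h1 h2 h3)

/-! ### The first orbit point after an integer point -/

variable (S)

/-- The word read along `i` steps of `next` from `j`. -/
def edgeWord (j : ℤ) (i : ℕ) : G := ((List.range i).map fun l => S.val (S.edge (S.next^[l] j))).prod

/-- The lift of `edgeWord`. -/
def edgeLift (j : ℤ) (i : ℕ) : LineLift κ :=
  ((List.range i).map fun l => S.lift (S.edge (S.next^[l] j))).prod

theorem edgeWord_succ (j : ℤ) (i : ℕ) :
    S.edgeWord j (i + 1) = S.val (S.edge j) * S.edgeWord (S.next j) i := by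
  simp [edgeWord, List.range_succ_eq_map, Function.comp_def]

theorem edgeLift_succ (j : ℤ) (i : ℕ) :
    S.edgeLift j (i + 1) = S.lift (S.edge j) * S.edgeLift (S.next j) i := by
  simp [edgeLift, List.range_succ_eq_map, Function.comp_def]

theorem isLift_edgeLift (j : ℤ) (i : ℕ) : S.IsLift (S.edgeWord j i) (S.edgeLift j i) := by
  induction i generalizing j with
  | zero => simpa [edgeWord, edgeLift] using S.isLift_one
  | succ i ih =>
    rw [edgeWord_succ, edgeLift_succ]
    exact (S.isLift_val _).mul (ih _)

theorem lt_lift_edge (j : ℤ) : (j : ℝ) + 1 / 4 < (S.lift (S.edge j)).1 (S.next j) := by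
  rw [← S.lift_edge j, (S.lift _).lt_iff]
  linarith

/-- The lift of a boundary word maps the unit interval at its end into the one at its start. -/
theorem edgeLift_mem_Icc (j : ℤ) (i : ℕ) {x : ℝ} (h1 : (S.next^[i] j : ℤ) ≤ x)
    (h2 : x ≤ (S.next^[i] j : ℤ) + 1) :
    (j : ℝ) ≤ (S.edgeLift j i).1 x ∧ (S.edgeLift j i).1 x ≤ j + 1 := by
  induction i generalizing j with
  | zero => simpa [edgeLift] using ⟨h1, h2⟩
  | succ i ih =>
    obtain ⟨h3, h4⟩ := ih (S.next j) h1 h2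
    rw [edgeLift_succ, mul_apply]
    have h5 := (S.lift (S.edge j)).le_iff.2 h3
    have h6 := (S.lift (S.edge j)).le_iff.2 h4
    have h7 := S.lt_lift_edge j
    have h8 := S.lift_edge_lt j
    constructor <;> linarith

theorem edgeLift_lt (j : ℤ) (i : ℕ) :
    (j : ℝ) ≤ (S.edgeLift j i).1 (S.next^[i] j : ℤ) ∧
      (S.edgeLift j i).1 (S.next^[i] j : ℤ) < j + 1 := by
  refine ⟨(S.edgeLift_mem_Icc j i le_rfl (by linarith)).1, lt_of_lt_of_le ?_
    (S.edgeLift_mem_Icc j i (by linarith) le_rfl).2⟩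
  rw [(S.edgeLift j i).lt_iff]
  linarith

/-- An orbit point after `j` that is not `j` itself comes after the image under `edge j` of the
integer point `next j`. -/
theorem le_of_lt_apply_zero {g : G} {f : LineLift κ} (h : S.IsLift g f) {j : ℤ}
    (hj : (j : ℝ) < f.1 0) :
    (S.next j : ℝ) ≤ ((S.lift (S.edge j))⁻¹ * f).1 0 := by
  by_contra! h1
  -- The gap around j holds no orbit point besides possibly j. So the point lies past j + 1/4, and
  -- its pullback lies past the left end of the gap around `next j`, which is empty in the same way.
  have h2 : (j : ℝ) + 1 / 4 < f.1 0 := by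
    by_contra! h3
    exact hj.ne' (h.eq_of_mem_gap (by linarith) h3).1
  have h4 : (S.next j : ℝ) - 1 / 4 < ((S.lift (S.edge j))⁻¹ * f).1 0 := by
    rw [← (S.lift (S.edge j)).lt_iff, S.lift_edge]
    simpa using h2
  have h5 := ((S.isLift_val (S.edge j)).inv.mul h).eq_of_mem_gap h4.le (by linarith)
  exact h1.ne h5.1

/-- As long as the chain of integers along `next` avoids the lifts of 0, each edge letter carries
the lower bound for orbit points one gap further. -/
theorem edgeLift_first (i : ℕ) (j : ℤ) (h : ∀ l < i, ¬ (κ * d : ℤ) ∣ S.next^[l] j)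
    {g : G} {f : LineLift κ} (hf : S.IsLift g f) (hj : (j : ℝ) ≤ f.1 0) :
    (S.edgeLift j i).1 (S.next^[i] j : ℤ) ≤ f.1 0 := by
  induction i generalizing j g f with
  | zero => simpa [edgeLift] using hj
  | succ i ih =>
    have h1 : (j : ℝ) < f.1 0 := by
      refine lt_of_le_of_ne hj fun h1 => ?_
      exact h 0 (by omega) (hf.eq_of_mem_gap (j := j) (by linarith) (by linarith)).2
    have h2 := S.le_of_lt_apply_zero hf h1
    have h3 := ih (S.next j) (fun l hl => h (l + 1) (by omega))
      ((S.isLift_val (S.edge j)).inv.mul hf) h2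
    rw [edgeLift_succ, mul_apply, Function.iterate_succ_apply]
    rw [← (S.lift (S.edge j)).le_iff] at h3
    simpa using h3

theorem next_add_mul (j z : ℤ) : S.next (j + z * κ) = S.next j + z * κ := by
  induction z using Int.induction_on with
  | zero => simp
  | succ i ih => rw [add_mul, one_mul, ← add_assoc, S.next_add, ih]; ring
  | pred i ih =>
    have := S.next_add (j + (-i - 1) * κ)
    rw [show j + (-(i : ℤ) - 1) * κ + κ = j + -i * κ by ring, ih] at this
    linarith

theorem next_iterate_add_mul (i : ℕ) (j z : ℤ) :
    S.next^[i] (j + z * κ) = S.next^[i] j + z * κ := by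
  induction i generalizing j with
  | zero => rfl
  | succ i ih => rw [Function.iterate_succ_apply, Function.iterate_succ_apply, next_add_mul, ih]

theorem edge_add_mul (j z : ℤ) : S.edge (j + z * κ) = S.edge j := by
  induction z using Int.induction_on with
  | zero => simp
  | succ i ih => rw [add_mul, one_mul, ← add_assoc, S.edge_add, ih]
  | pred i ih =>
    have := S.edge_add (j + (-i - 1) * κ)
    rw [show j + (-(i : ℤ) - 1) * κ + κ = j + -i * κ by ring, ih] at this
    exact this.symm

theorem rank_iterate (i : ℕ) (j : ℤ) : S.rank (S.next^[i] j) = S.rank j + i := by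
  induction i generalizing j with
  | zero => simp
  | succ i ih => rw [Function.iterate_succ_apply, ih, S.rank_next]; push_cast; ring

theorem next_iterate_mul (u : ℕ) : S.next^[κ * u] 0 = -(κ * (S.shift * u)) := by
  induction u with
  | zero => simp
  | succ u ih =>
    rw [Nat.mul_succ, Nat.add_comm, Function.iterate_add_apply, ih]
    have := S.next_iterate_add_mul κ 0 (-(S.shift * u))
    rw [show (0 : ℤ) + -(S.shift * u) * κ = -(κ * (S.shift * u)) by ring] at this
    rw [this, S.next_iterate]
    push_cast
    ring

/-- By rank, the chain from 0 meets multiples of κ only after whole turns. After u turns it stands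
at -κ·shift·u, and coprimality reduces divisibility by κd to d ∣ u. -/
theorem dvd_next_iterate_iff (i : ℕ) : (κ * d : ℤ) ∣ S.next^[i] 0 ↔ κ * d ∣ i := by
  have hκ : (κ : ℤ) ≠ 0 := by exact_mod_cast NeZero.ne κ
  have key : ∀ u : ℕ, (κ * d : ℤ) ∣ -(κ * (S.shift * u)) ↔ d ∣ u := by
    intro u
    rw [dvd_neg, mul_dvd_mul_iff_left hκ, ← Int.natCast_dvd_natCast]
    exact ⟨fun h => IsCoprime.dvd_of_dvd_mul_left (IsCoprime.symm S.coprime) h,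
      fun h => dvd_mul_of_dvd_right h _⟩
  constructor
  · intro h
    have h1 : (κ : ℤ) ∣ S.next^[i] 0 := dvd_trans (dvd_mul_right _ _) h
    rw [← S.rank_eq_zero, S.rank_iterate, (S.rank_eq_zero 0).2 (dvd_zero _), zero_add,
      ZMod.natCast_eq_zero_iff] at h1
    obtain ⟨u, rfl⟩ := h1
    rw [S.next_iterate_mul, key] at h
    exact Nat.mul_dvd_mul_left _ h
  · rintro ⟨u, rfl⟩
    rw [mul_assoc, S.next_iterate_mul, key]
    exact dvd_mul_right _ _

theorem exists_dvd_next_iterate (j : ℤ) : ∃ i, (κ * d : ℤ) ∣ S.next^[i] j := by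
  have hκ : (κ : ℤ) ≠ 0 := by exact_mod_cast NeZero.ne κ
  obtain ⟨i, hi⟩ : ∃ i, (κ : ℤ) ∣ S.next^[i] j := by
    refine ⟨(-S.rank j).val, ?_⟩
    rw [← S.rank_eq_zero, S.rank_iterate, ZMod.natCast_val, ZMod.cast_id]
    ring
  obtain ⟨z, hz⟩ := hi
  obtain ⟨a, b, hab⟩ := S.coprime
  have hd : (d : ℤ) ≠ 0 := by exact_mod_cast NeZero.ne d
  obtain ⟨u, hu⟩ : ∃ u : ℕ, (d : ℤ) ∣ z - S.shift * u := by
    -- By Bézout a is an inverse of shift modulo d, so a·z whole turns lead to the right sheet; the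
    -- remainder makes the number natural.
    refine ⟨((a * z) % d).toNat, ?_⟩
    rw [Int.toNat_of_nonneg (Int.emod_nonneg _ hd), Int.emod_def]
    exact ⟨b * z + S.shift * (a * z / d), by linear_combination (-z) * hab⟩
  refine ⟨κ * u + i, ?_⟩
  rw [Function.iterate_add_apply, hz]
  have := S.next_iterate_add_mul (κ * u) 0 z
  rw [zero_add] at this
  rw [mul_comm (κ : ℤ) z, this, S.next_iterate_mul, show -((κ : ℤ) * (S.shift * u)) + z * κ = κ * (z - S.shift * u) by
    ring]
  exact mul_dvd_mul_left _ hu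

/-- There is a first orbit point at or after each integer point. -/
theorem exists_first (j : ℤ) : ∃ (y : G) (f : LineLift κ), S.IsLift y f ∧ (j : ℝ) ≤ f.1 0 ∧
    f.1 0 < j + 1 ∧ ∀ g f', S.IsLift g f' → (j : ℝ) ≤ f'.1 0 → f.1 0 ≤ f'.1 0 := by
  classical
  have hex := S.exists_dvd_next_iterate j
  -- The first visit of the chain to a lift of 0 produces an orbit point, and `edgeLift_first` shows
  -- that none comes earlier.
  obtain ⟨z, hz⟩ := Nat.find_spec hex
  have hmin : ∀ l < Nat.find hex, ¬ (κ * d : ℤ) ∣ S.next^[l] j := fun l hl => Nat.find_min hex hl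
  have e : (S.edgeLift j (Nat.find hex) * translate κ (z * (κ * d))).1 0 =
      (S.edgeLift j (Nat.find hex)).1 (S.next^[Nat.find hex] j : ℤ) := by
    rw [mul_apply, translate_apply, hz]
    congr 1
    push_cast
    ring
  refine ⟨_, S.edgeLift j (Nat.find hex) * translate κ (z * (κ * d)),
    (S.isLift_edgeLift _ _).mul_translate z, ?_⟩
  rw [e]
  exact ⟨(S.edgeLift_lt j _).1, (S.edgeLift_lt j _).2,
    fun g f' hf hj => S.edgeLift_first _ j hmin hf hj⟩

/-! ### The boundary element -/

theorem edgeWord_add (j : ℤ) (i i' : ℕ) :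
    S.edgeWord j (i + i') = S.edgeWord j i * S.edgeWord (S.next^[i] j) i' := by
  induction i generalizing j with
  | zero => simp [edgeWord]
  | succ i ih =>
    rw [Nat.succ_add, edgeWord_succ, ih, edgeWord_succ, mul_assoc, Function.iterate_succ_apply]

theorem edgeLift_add (j : ℤ) (i i' : ℕ) :
    S.edgeLift j (i + i') = S.edgeLift j i * S.edgeLift (S.next^[i] j) i' := by
  induction i generalizing j with
  | zero => simp [edgeLift]
  | succ i ih =>
    rw [Nat.succ_add, edgeLift_succ, ih, edgeLift_succ, mul_assoc, Function.iterate_succ_apply]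

theorem edgeWord_add_mul (j z : ℤ) (i : ℕ) : S.edgeWord (j + z * κ) i = S.edgeWord j i := by
  simp only [edgeWord, next_iterate_add_mul, edge_add_mul]

theorem edgeLift_add_mul (j z : ℤ) (i : ℕ) : S.edgeLift (j + z * κ) i = S.edgeLift j i := by
  simp only [edgeLift, next_iterate_add_mul, edge_add_mul]

theorem edgeWord_mul (u : ℕ) : S.edgeWord 0 (κ * u) = S.bdry ^ u := by
  induction u with
  | zero => simp [edgeWord]
  | succ u ih =>
    rw [Nat.mul_succ, edgeWord_add, ih, next_iterate_mul, pow_succ]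
    congr 1
    have := S.edgeWord_add_mul 0 (-(S.shift * u)) κ
    rw [show (0 : ℤ) + -(S.shift * u) * κ = -(κ * (S.shift * u)) by ring] at this
    rw [this, S.bdry_eq]
    rfl

theorem edgeLift_mul (u : ℕ) : S.edgeLift 0 (κ * u) = S.edgeLift 0 κ ^ u := by
  induction u with
  | zero => simp [edgeLift]
  | succ u ih =>
    rw [Nat.mul_succ, edgeLift_add, ih, next_iterate_mul, pow_succ]
    congr 1
    have := S.edgeLift_add_mul 0 (-(S.shift * u)) κ
    rw [show (0 : ℤ) + -(S.shift * u) * κ = -(κ * (S.shift * u)) by ring] at this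
    exact this

/-- The lift of the boundary element that moves `0` to the right by less than `1`, up to a
translation. -/
def bdryLift : LineLift κ := S.edgeLift 0 κ * translate κ ((-S.shift : ℤ) * κ)

theorem isLift_bdry : S.IsLift S.bdry (S.bdryLift * translate κ (S.shift * κ)) := by
  have h1 := S.isLift_edgeLift 0 κ
  have h2 := S.edgeWord_mul 1
  rw [mul_one, pow_one] at h2
  rw [h2] at h1
  have : S.bdryLift * translate κ (S.shift * κ) = S.edgeLift 0 κ := by
    rw [bdryLift, mul_assoc, translate_mul]
    exact LineLift.ext fun x => by simp
  rwa [this]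

theorem bdryLift_pow (u : ℕ) :
    S.bdryLift ^ u = S.edgeLift 0 (κ * u) * translate κ ((-(S.shift * u) : ℤ) * κ) := by
  have hc : Commute (S.edgeLift 0 κ) (translate κ ((-S.shift : ℤ) * κ)) :=
    translate_period_commute _ _
  rw [bdryLift, hc.mul_pow, edgeLift_mul, translate_pow]
  congr 2
  push_cast
  ring

/-- The sheet change of α^d is d·shift, a multiple of d, so the small displacement `bdryLift ^ d` is
itself a lift without correction. -/
theorem isLift_bdry_pow : S.IsLift (S.bdry ^ d) (S.bdryLift ^ d) := by
  rw [bdryLift_pow, ← S.edgeWord_mul]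
  have := (S.isLift_edgeLift 0 (κ * d)).mul_translate (-S.shift)
  convert this using 3
  push_cast
  ring

theorem bdryLift_pow_mem_Icc (u : ℕ) {x : ℝ} (h0 : 0 ≤ x) (h1 : x ≤ 1) :
    0 ≤ (S.bdryLift ^ u).1 x ∧ (S.bdryLift ^ u).1 x ≤ 1 := by
  have h2 : ((S.next^[κ * u] 0 : ℤ) : ℝ) = (-(S.shift * u) : ℤ) * κ := by
    rw [S.next_iterate_mul]
    push_cast
    ring
  have := S.edgeLift_mem_Icc 0 (κ * u) (x := x + (-(S.shift * u) : ℤ) * κ) (by rw [h2]; linarith)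
    (by rw [h2]; linarith)
  rw [bdryLift_pow, mul_apply, translate_apply]
  simpa using this

/-- The `d`-th power of the boundary element moves `0` to the next orbit point. -/
theorem bdryLift_pow_first {g : G} {f : LineLift κ} (hf : S.IsLift g f) (h : 0 < f.1 0) :
    (S.bdryLift ^ d).1 0 ≤ f.1 0 := by
  have hpos : 0 < κ * d := Nat.mul_pos (Nat.pos_of_ne_zero (NeZero.ne κ))
    (Nat.pos_of_ne_zero (NeZero.ne d))
  obtain ⟨i, hi⟩ : ∃ i, κ * d = i + 1 := ⟨κ * d - 1, by omega⟩
  have h1 := S.le_of_lt_apply_zero hf (j := 0) (by simpa using h)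
  -- After leaving 0 the chain first returns to a multiple of κd at step κd, so the κd - 1 steps
  -- from `next 0` meet none.
  have h2 := S.edgeLift_first i (S.next 0) (fun l hl h3 => by
    rw [← Function.iterate_succ_apply, S.dvd_next_iterate_iff] at h3
    have := Nat.le_of_dvd (by omega) h3
    omega) ((S.isLift_val (S.edge 0)).inv.mul hf) h1
  rw [← Function.iterate_succ_apply, ← (S.lift (S.edge 0)).le_iff, ← mul_apply (S.lift (S.edge 0))
    (S.edgeLift _ _), ← edgeLift_succ, Nat.succ_eq_add_one, ← hi, S.next_iterate_mul] at h2
  rw [bdryLift_pow, mul_apply, translate_apply]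
  have e : (0 : ℝ) + (-(S.shift * d) : ℤ) * κ = (-(κ * (S.shift * d)) : ℤ) := by push_cast; ring
  rw [e]
  simpa using h2

theorem zero_lt_bdryLift : 0 < S.bdryLift.1 0 := by
  obtain ⟨i, hi⟩ : ∃ i, κ = i + 1 := ⟨κ - 1, by have := S.two_le; omega⟩
  have h1 := (S.edgeLift_lt (S.next 0) i).1
  rw [← Function.iterate_succ_apply, ← (S.lift (S.edge 0)).le_iff, ← mul_apply (S.lift (S.edge 0))
    (S.edgeLift _ _), ← edgeLift_succ, Nat.succ_eq_add_one, ← hi, S.next_iterate] at h1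
  have h2 := S.lt_lift_edge 0
  have e : (0 : ℝ) + (-S.shift : ℤ) * κ = (-(κ * S.shift) : ℤ) := by push_cast; ring
  rw [bdryLift, mul_apply, translate_apply, e]
  push_cast at *
  linarith

theorem strictMono_bdryLift_pow {i j : ℤ} (h : i < j) :
    (S.bdryLift ^ i).1 0 < (S.bdryLift ^ j).1 0 := by
  have key : ∀ n : ℕ, 0 < (S.bdryLift ^ (n + 1)).1 0 := by
    intro n
    induction n with
    | zero => simpa using S.zero_lt_bdryLift
    | succ n ih =>
      rw [pow_succ', mul_apply]
      exact S.zero_lt_bdryLift.trans (S.bdryLift.lt_iff.2 ih)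
  obtain ⟨n, rfl⟩ : ∃ n : ℕ, j = i + (n + 1 : ℕ) := ⟨(j - i - 1).toNat, by omega⟩
  rw [_root_.zpow_add, mul_apply, (S.bdryLift ^ i).lt_iff, zpow_natCast]
  exact key n

end PingPongSystem

end

/-! ### The circular order of a ping-pong system is isolated -/

noncomputable section

theorem Int.eq_of_lt_add_of_lt_add {i j : ℤ} {x : ℝ} (h1 : (i : ℝ) < x) (h2 : x < i + 1)
    (h3 : (j : ℝ) ≤ x) (h4 : x ≤ j + 1) : i = j := by
  have h5 : (i : ℝ) < (j + 1 : ℤ) := by push_cast; linarith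
  have h6 : (j : ℝ) < (i + 1 : ℤ) := by push_cast; linarith
  have h7 := Int.cast_lt.1 h5
  have h8 := Int.cast_lt.1 h6
  omega

namespace PingPongSystem

open LineLift GroupCircularOrder

variable {G : Type*} [Group G] {κ d : ℕ} [NeZero κ] [NeZero d] {L : Type*}
  (S : PingPongSystem G κ d L)

/-- The first orbit point at or after `j`, as a group element. -/
def firstPt (j : ℤ) : G := (S.exists_first j).choose

/-- The lift of `firstPt j` that maps `0` to the first orbit point at or after `j`. -/
def firstLift (j : ℤ) : LineLift κ := (S.exists_first j).choose_spec.choose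

theorem isLift_firstLift (j : ℤ) : S.IsLift (S.firstPt j) (S.firstLift j) :=
  (S.exists_first j).choose_spec.choose_spec.1

theorem le_firstLift (j : ℤ) : (j : ℝ) ≤ (S.firstLift j).1 0 :=
  (S.exists_first j).choose_spec.choose_spec.2.1

theorem firstLift_lt (j : ℤ) : (S.firstLift j).1 0 < j + 1 :=
  (S.exists_first j).choose_spec.choose_spec.2.2.1

variable {S} in
theorem IsLift.firstLift_le {g : G} {f : LineLift κ} (h : S.IsLift g f) {j : ℤ}
    (hj : (j : ℝ) ≤ f.1 0) : (S.firstLift j).1 0 ≤ f.1 0 :=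
  (S.exists_first j).choose_spec.choose_spec.2.2.2 g f h hj

theorem firstPt_add_period (j z : ℤ) : S.firstPt (j + z * (κ * d)) = S.firstPt j := by
  have h1 := (S.isLift_firstLift j).mul_translate z
  have h2 := (S.isLift_firstLift (j + z * (κ * d))).mul_translate (-z)
  have e1 : (S.firstLift j * translate κ (z * (κ * d))).1 0 =
      (S.firstLift j).1 0 + z * (κ * d) := by
    rw [mul_apply, translate_apply, (S.isLift_firstLift j).apply_add_period]
  have e2 : (S.firstLift (j + z * (κ * d)) * translate κ ((-z : ℤ) * (κ * d))).1 0 =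
      (S.firstLift (j + z * (κ * d))).1 0 + (-z : ℤ) * (κ * d) := by
    rw [mul_apply, translate_apply, (S.isLift_firstLift _).apply_add_period]
  have h3 := S.le_firstLift j
  have h4 := S.le_firstLift (j + z * (κ * d))
  have h5 := h1.firstLift_le (j := j + z * (κ * d)) (by rw [e1]; push_cast; linarith)
  have h6 := h2.firstLift_le (j := j) (by rw [e2]; push_cast at *; linarith)
  rw [e1] at h5
  rw [e2] at h6
  refine ((S.isLift_firstLift _).eq_of_apply_zero h1 ?_).1
  rw [e1]
  push_cast at h6
  linarith

theorem finite_range_firstPt : (Set.range S.firstPt).Finite := by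
  have hpos : (0 : ℤ) < κ * d := by
    have h1 : 0 < κ := Nat.pos_of_ne_zero (NeZero.ne κ)
    have h2 : 0 < d := Nat.pos_of_ne_zero (NeZero.ne d)
    positivity
  refine ((Set.finite_Ico (0 : ℤ) (κ * d)).image S.firstPt).subset ?_
  rintro _ ⟨j, rfl⟩
  refine ⟨j % (κ * d), ⟨Int.emod_nonneg _ hpos.ne', Int.emod_lt_of_pos _ hpos⟩, ?_⟩
  rw [← S.firstPt_add_period _ (j / (κ * d)), mul_comm (j / _), Int.emod_add_mul_ediv]

theorem firstLift_succ_lt (j : ℤ) :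
    (S.firstLift (j + 1)).1 0 < (S.firstLift j).1 0 + κ * d := by
  have h1 := S.firstLift_lt (j + 1)
  have h2 := S.le_firstLift j
  have h3 : (2 : ℝ) ≤ κ := by exact_mod_cast S.two_le
  have h4 : (1 : ℝ) ≤ d := by exact_mod_cast Nat.pos_of_ne_zero (NeZero.ne d)
  push_cast at h1
  nlinarith

theorem firstLift_le_succ (j : ℤ) : (S.firstLift j).1 0 ≤ (S.firstLift (j + 1)).1 0 := by
  apply (S.isLift_firstLift (j + 1)).firstLift_le
  have := S.le_firstLift (j + 1)
  push_cast at this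
  linarith

variable {S}

/-- Removing the first letter `s` of a reduced word leads to a cell on which `s` contracts. -/
theorem IsLift.exists_cell {s : L} {v : List L} {f : LineLift κ}
    (hw : S.Reduced (s :: v)) (h : S.IsLift ((s :: v).map S.val).prod f) :
    ∃ i : ℤ, (i : ZMod κ) ≠ S.source s ∧ (i : ℝ) ≤ ((S.lift s)⁻¹ * f).1 0 ∧
      ((S.lift s)⁻¹ * f).1 0 ≤ i + 1 := by
  have h1 := h.of_cons
  cases v with
  | nil =>
    rw [List.map_nil, List.prod_nil, isLift_one_iff] at h1
    obtain ⟨z, hz⟩ := h1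
    rw [hz, translate_apply, zero_add]
    have e : (z : ℝ) * (κ * d) = ((z * (κ * d) : ℤ) : ℝ) := by push_cast; ring
    rw [e]
    generalize z * (κ * d) = i
    by_cases hi : (i : ZMod κ) = S.source s
    · refine ⟨i - 1, ?_, ?_, ?_⟩
      · rw [← hi]
        intro h3
        push_cast at h3
        exact S.intCast_add_one_ne ((i : ZMod κ) - 1) (by rw [sub_add_cancel]; exact h3.symm)
      · push_cast
        linarith
      · push_cast
        linarith
    · exact ⟨i, hi, le_rfl, by linarith⟩
  | cons s' v =>
    obtain ⟨hne, hv⟩ := List.isChain_cons_cons.1 hw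
    obtain ⟨j, h2, h3, h4⟩ := h1.apply_int_mem_arc hv 0
    rw [Int.cast_zero] at h3 h4
    exact ⟨j, h2 ▸ hne, by linarith, by linarith⟩

theorem _root_.GroupCircularOrder.ClosedArc.mul_left {c : GroupCircularOrder G} {a b x : G}
    (h : c.ClosedArc a b x) (g : G) : c.ClosedArc (g * a) (g * b) (g * x) := by
  unfold GroupCircularOrder.ClosedArc at *
  rw [c.left_inv]
  simpa using h

theorem closedArc_firstPt {g : G} {f : LineLift κ} (h : S.IsLift g f) {i : ℤ}
    (h1 : (i : ℝ) ≤ f.1 0) (h2 : f.1 0 ≤ i + 1) :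
    S.order.ClosedArc (S.firstPt i) g (S.firstPt (i + 1)) := by
  refine closedArc_of_le (S.isLift_firstLift i) h (S.isLift_firstLift (i + 1)) (h.firstLift_le h1)
    ?_ (S.firstLift_succ_lt i)
  have := S.le_firstLift (i + 1)
  push_cast at this
  linarith

variable (S) in
/-- Finitely many elements on which the order determines everything. -/
def testSet : Set G :=
  ({1} ∪ Set.range S.val ∪ Set.range S.firstPt) ∪
    Set.image2 (fun s y => S.val s * y) Set.univ (Set.range S.firstPt)

theorem finite_testSet [Finite L] : S.testSet.Finite :=
  (((Set.finite_singleton _).union (Set.finite_range _)).union S.finite_range_firstPt).union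
    (Set.finite_univ.image2 _ S.finite_range_firstPt)

theorem one_mem_testSet : (1 : G) ∈ S.testSet := by simp [testSet]

theorem val_mem_testSet (s : L) : S.val s ∈ S.testSet := by simp [testSet]

theorem firstPt_mem_testSet (j : ℤ) : S.firstPt j ∈ S.testSet := by simp [testSet]

theorem val_mul_mem_testSet (s : L) (j : ℤ) : S.val s * S.firstPt j ∈ S.testSet :=
  Or.inr ⟨s, Set.mem_univ _, _, ⟨j, rfl⟩, rfl⟩

/-- The order agrees with `c'` on the test set. -/
def AgreesOnTestSet (S : PingPongSystem G κ d L) (c' : GroupCircularOrder G) : Prop :=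
  ∀ a ∈ S.testSet, ∀ b ∈ S.testSet, ∀ x ∈ S.testSet, S.order.toFun a b x = c'.toFun a b x

theorem AgreesOnTestSet.closedArc {c' : GroupCircularOrder G} (hc : S.AgreesOnTestSet c')
    {a b x : G} (ha : a ∈ S.testSet) (hb : b ∈ S.testSet) (hx : x ∈ S.testSet)
    (h : S.order.ClosedArc a b x) : c'.ClosedArc a b x := by
  unfold GroupCircularOrder.ClosedArc at *
  rwa [← hc a ha b hb x hx]

/-- In every order that agrees on the test set, elements lie in the same cells. -/
theorem AgreesOnTestSet.closedArc_firstPt {c' : GroupCircularOrder G}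
    (hc : S.AgreesOnTestSet c') {w : List L} (hw : S.Reduced w) {f : LineLift κ}
    (h : S.IsLift (w.map S.val).prod f) {i : ℤ} (h1 : (i : ℝ) ≤ f.1 0) (h2 : f.1 0 ≤ i + 1) :
    c'.ClosedArc (S.firstPt i) (w.map S.val).prod (S.firstPt (i + 1)) := by
  induction w generalizing f i with
  | nil =>
    rw [List.map_nil, List.prod_nil] at *
    exact hc.closedArc (firstPt_mem_testSet _) one_mem_testSet (firstPt_mem_testSet _)
      (PingPongSystem.closedArc_firstPt h h1 h2)
  | cons s v ih =>
    -- Peel off the first letter s: the rest of the word lies in a cell i' that s contracts into an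
    -- arc, and that arc lies in cell i.
    obtain ⟨i', hi', h3, h4⟩ := h.exists_cell hw
    obtain ⟨j, hj, h5, h6⟩ := S.ping s i' hi'
    have hf : f.1 0 = (S.lift s).1 (((S.lift s)⁻¹ * f).1 0) := by simp
    have h7 := (S.lift s).le_iff.2 h3
    have h8 := (S.lift s).le_iff.2 h4
    rw [← hf] at h7 h8
    have hij : j = i := Int.eq_of_lt_add_of_lt_add (by linarith) (by linarith) h1 h2
    subst hij
    -- Left invariance of `c'` moves the inductive statement by s. It remains to nest the image of
    -- cell i' in cell j, a statement about four test elements.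
    have h9 := (ih (List.IsChain.tail hw) h.of_cons h3 h4).mul_left (S.val s)
    rw [List.map_cons, List.prod_cons]
    have k1 := S.isLift_firstLift j
    have k2 := (S.isLift_val s).mul (S.isLift_firstLift i')
    have k3 := (S.isLift_val s).mul (S.isLift_firstLift (i' + 1))
    have k4 := S.isLift_firstLift (j + 1)
    have l1 : (S.firstLift j).1 0 ≤ (S.lift s * S.firstLift i').1 0 := by
      apply k2.firstLift_le
      have := (S.lift s).le_iff.2 (S.le_firstLift i')
      rw [mul_apply]
      linarith
    have l2 : (S.lift s * S.firstLift i').1 0 ≤ (S.lift s * S.firstLift (i' + 1)).1 0 := by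
      rw [mul_apply, mul_apply, (S.lift s).le_iff]
      exact S.firstLift_le_succ i'
    have l3 : (S.lift s * S.firstLift (i' + 1)).1 0 ≤ (S.firstLift (j + 1)).1 0 := by
      have m1 := S.le_firstLift (j + 1)
      have m2 : ((i' + 1 : ℤ) : ℝ) ≤ ((S.lift s)⁻¹ * S.firstLift (j + 1)).1 0 := by
        rw [← (S.lift s).le_iff, mul_apply, apply_inv_self]
        push_cast at m1 ⊢
        linarith
      have m3 := ((S.isLift_val s).inv.mul k4).firstLift_le m2
      rw [← (S.lift s).le_iff] at m3
      simpa using m3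
    have l4 := S.firstLift_succ_lt j
    have b1 := firstPt_mem_testSet (S := S) j
    have b2 := val_mul_mem_testSet (S := S) s i'
    have b3 := val_mul_mem_testSet (S := S) s (i' + 1)
    have b4 := firstPt_mem_testSet (S := S) (j + 1)
    exact h9.mono (hc.closedArc b1 b2 b3 (closedArc_of_le k1 k2 k3 l1 l2 (by linarith)))
      (hc.closedArc b1 b2 b4 (closedArc_of_le k1 k2 k4 l1 (by linarith) (by linarith)))
      (hc.closedArc b1 b3 b4 (closedArc_of_le k1 k3 k4 (by linarith) l3 (by linarith)))
      (hc.closedArc b2 b3 b4 (closedArc_of_le k2 k3 k4 l2 l3 (by linarith)))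

/-- A letter, or the identity, does not lie strictly inside the image of a cell under a letter that
contracts on the cell. -/
theorem order_ne_one_of_cell (t : L) {i : ℤ} (hi : (i : ZMod κ) ≠ S.source t) {x : G}
    (hx : x = 1 ∨ ∃ s, x = S.val s) :
    S.order.toFun (S.val t * S.firstPt i) x (S.val t * S.firstPt (i + 1)) ≠ 1 := by
  intro h
  have kp := (S.isLift_val t).mul (S.isLift_firstLift i)
  have kq := (S.isLift_val t).mul (S.isLift_firstLift (i + 1))
  obtain ⟨fx, fq, hfx, hfq, h1, h2, h3⟩ := exists_lt_of_order_eq_one kp h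
  have l1 : (S.lift t * S.firstLift i).1 0 ≤ (S.lift t * S.firstLift (i + 1)).1 0 := by
    rw [mul_apply, mul_apply, (S.lift t).le_iff]
    exact S.firstLift_le_succ i
  have l2 : (S.lift t * S.firstLift (i + 1)).1 0 < (S.lift t * S.firstLift i).1 0 + κ * d := by
    have m1 := (S.isLift_val t).apply_add_period ((S.firstLift i).1 0) 1
    rw [Int.cast_one, one_mul] at m1
    rw [mul_apply, mul_apply, ← m1, (S.lift t).lt_iff]
    exact S.firstLift_succ_lt i
  have e : fq = S.lift t * S.firstLift (i + 1) := hfq.eq_of_lt kq (by linarith) (by linarith)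
  subst e
  have hu := (S.isLift_val t).inv.mul hfx
  have hfx' : fx.1 0 = (S.lift t).1 (((S.lift t)⁻¹ * fx).1 0) := by simp
  have u1 : (S.firstLift i).1 0 < ((S.lift t)⁻¹ * fx).1 0 := by
    rw [← (S.lift t).lt_iff, ← hfx']
    exact h1
  have u2 : ((S.lift t)⁻¹ * fx).1 0 < (S.firstLift (i + 1)).1 0 := by
    rw [← (S.lift t).lt_iff, ← hfx']
    exact h2
  have u3 : (i : ℝ) < ((S.lift t)⁻¹ * fx).1 0 := (S.le_firstLift i).trans_lt u1
  have u4 : ((S.lift t)⁻¹ * fx).1 0 < i + 1 := by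
    by_contra! u5
    have := hu.firstLift_le (j := i + 1) (by push_cast; exact u5)
    linarith
  obtain ⟨j, hj, p1, p2⟩ := S.ping t i hi
  have p3 : (j : ℝ) + 1 / 4 < fx.1 0 := by
    rw [hfx']
    exact p1.trans ((S.lift t).lt_iff.2 u3)
  have p4 : fx.1 0 < j + 3 / 4 := by
    rw [hfx']
    exact ((S.lift t).lt_iff.2 u4).trans p2
  have int_of_one : ∀ {f : LineLift κ}, S.IsLift 1 f → ∃ z : ℤ, f.1 0 = z := by
    intro f hf
    obtain ⟨z, rfl⟩ := isLift_one_iff.1 hf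
    exact ⟨z * (κ * d), by simp⟩
  rcases hx with rfl | ⟨s, rfl⟩
  · obtain ⟨z, hz⟩ := int_of_one hfx
    rw [hz] at p3 p4
    exact not_int_mem_Ioo z j ⟨p3, p4⟩
  · have hs : S.IsLift ([s].map S.val).prod fx := by simpa using hfx
    obtain ⟨j', hj', q1, q2⟩ := hs.apply_int_mem_arc (List.isChain_singleton _) 0
    rw [Int.cast_zero] at q1 q2
    have e : j' = j := Int.eq_of_lt_add_of_lt_add (x := fx.1 0) (by linarith) (by linarith)
      (by linarith) (by linarith)
    -- Pulling back by t puts either the identity or a letter landing in the source arc of t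
    -- strictly inside cell i. The first is at an integer, the second is excluded by `hi`.
    rcases S.sep s t (by rw [← hj, ← hj', e]) with h4 | ⟨r, h4, h5⟩
    · rw [h4, inv_mul_cancel] at hu
      obtain ⟨z, hz⟩ := int_of_one hu
      rw [hz] at u3 u4
      have v1 := Int.cast_lt.1 u3
      have u5 : (z : ℝ) < (i + 1 : ℤ) := by push_cast; exact u4
      have v2 := Int.cast_lt.1 u5
      omega
    · rw [h4, inv_mul_cancel_left] at hu
      have hr : S.IsLift ([r].map S.val).prod ((S.lift t)⁻¹ * fx) := by simpa using hu
      obtain ⟨j'', hj'', q3, q4⟩ := hr.apply_int_mem_arc (List.isChain_singleton _) 0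
      rw [Int.cast_zero] at q3 q4
      have e2 : i = j'' := Int.eq_of_lt_add_of_lt_add u3 u4 (by linarith) (by linarith)
      exact hi (by rw [e2, hj'', h5])

/-- Write g = t·v with v in a cell that t contracts. In both orders g lies in the image of that
cell, which has neither 1 nor s strictly inside, so the triple (1, s, g) can be read off at an
endpoint, where the orders agree. -/
theorem AgreesOnTestSet.toFun_val {c' : GroupCircularOrder G} (hc : S.AgreesOnTestSet c') (s : L)
    (g : G) : S.order.toFun 1 (S.val s) g = c'.toFun 1 (S.val s) g := by
  obtain ⟨w, hw, rfl⟩ := S.exists_reduced g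
  obtain ⟨f, hf⟩ := S.exists_isLift (w.map S.val).prod
  have b1 := one_mem_testSet (S := S)
  have b2 := val_mem_testSet (S := S) s
  cases w with
  | nil => exact hc _ b1 _ b2 _ b1
  | cons t v =>
    obtain ⟨i, hi, h1, h2⟩ := hf.exists_cell hw
    have k1 := (PingPongSystem.closedArc_firstPt hf.of_cons h1 h2).mul_left (S.val t)
    have k2 := (hc.closedArc_firstPt (w := v) (List.IsChain.tail hw) hf.of_cons h1 h2).mul_left (S.val t)
    rw [List.map_cons, List.prod_cons]
    have b3 := val_mul_mem_testSet (S := S) t i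
    have b4 := val_mul_mem_testSet (S := S) t (i + 1)
    rcases k1 with k1 | k1 | k1
    · have k3 := GroupCircularOrder.ne_of_eq_one _ k1
      have k2' : c'.toFun (S.val t * S.firstPt i) (S.val t * (v.map S.val).prod)
          (S.val t * S.firstPt (i + 1)) = 1 := by
        rcases k2 with k2 | k2 | k2
        · exact k2
        · exact absurd k2.symm k3.1
        · exact absurd k2 k3.2.1
      have n1 := order_ne_one_of_cell (S := S) t hi (x := 1) (Or.inl rfl)
      have n2 := order_ne_one_of_cell (S := S) t hi (x := S.val s) (Or.inr ⟨s, rfl⟩)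
      exact toFun_eq_of_mem_arc k1 k2' n1 (hc _ b3 _ b1 _ b4 ▸ n1) n2 (hc _ b3 _ b2 _ b4 ▸ n2)
        (hc _ b1 _ b2 _ b3)
    · rw [k1]
      exact hc _ b1 _ b2 _ b3
    · rw [k1]
      exact hc _ b1 _ b2 _ b4

variable (S)

theorem isIsolated_order [Finite L] : S.order.IsIsolated :=
  isIsolated_of_finite (finite_testSet (S := S)) fun _ hc =>
    eq_of_forall_generator S.val S.generate (AgreesOnTestSet.toFun_val hc)

end PingPongSystem

end

/-! ### The linear part -/

noncomputable section

namespace LineLift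

variable {N : ℕ}

theorem pow_lt_of_lt (f : LineLift N) {x : ℝ} (h : f.1 x < x) (n : ℕ) :
    (f ^ (n + 1)).1 x < x := by
  induction n with
  | zero => simpa using h
  | succ n ih =>
    rw [pow_succ', mul_apply]
    exact (f.lt_iff.2 ih).trans h

theorem lt_pow_of_lt (f : LineLift N) {x : ℝ} (h : x < f.1 x) (n : ℕ) :
    x < (f ^ (n + 1)).1 x := by
  induction n with
  | zero => simpa using h
  | succ n ih =>
    rw [pow_succ', mul_apply]
    exact h.trans (f.lt_iff.2 ih)

theorem apply_eq_of_pow_apply_eq (f : LineLift N) {x : ℝ} {n : ℕ} (hn : n ≠ 0)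
    (h : (f ^ n).1 x = x) : f.1 x = x := by
  obtain ⟨n, rfl⟩ := Nat.exists_eq_succ_of_ne_zero hn
  rcases lt_trichotomy (f.1 x) x with h1 | h1 | h1
  · exact absurd h (f.pow_lt_of_lt h1 n).ne
  · exact h1
  · exact absurd h (f.lt_pow_of_lt h1 n).ne'

theorem pow_apply_eq_of_apply_eq (f : LineLift N) {x : ℝ} (h : f.1 x = x) (n : ℕ) :
    (f ^ n).1 x = x := by
  induction n with
  | zero => simp
  | succ n ih => rw [pow_succ, mul_apply, h, ih]

theorem inv_apply_eq_of_apply_eq (f : LineLift N) {x : ℝ} (h : f.1 x = x) : (f⁻¹).1 x = x := by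
  nth_rewrite 1 [← h]
  simp

/-- A bounded increasing orbit converges to a fixed point. -/
theorem exists_fixed_above (f : LineLift N) {x M : ℝ} (hx : x < f.1 x)
    (hM : ∀ n : ℕ, (f ^ n).1 x ≤ M) :
    ∃ A, f.1 A = A ∧ A ≤ M ∧ (∀ n : ℕ, (f ^ n).1 x < A) ∧ ∀ y < A, ∃ n : ℕ, y < (f ^ n).1 x := by
  set A := sSup (Set.range fun n : ℕ => (f ^ n).1 x) with hA
  have hbdd : BddAbove (Set.range fun n : ℕ => (f ^ n).1 x) := ⟨M, by rintro _ ⟨n, rfl⟩; exact hM n⟩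
  have hne : (Set.range fun n : ℕ => (f ^ n).1 x).Nonempty := Set.range_nonempty _
  have hle : ∀ n : ℕ, (f ^ n).1 x ≤ A := fun n => le_csSup hbdd ⟨n, rfl⟩
  have hstep : ∀ n : ℕ, (f ^ n).1 x < (f ^ (n + 1)).1 x := fun n => by
    rw [pow_succ, mul_apply]
    exact (f ^ n).lt_iff.2 hx
  have happ : ∀ y < A, ∃ n : ℕ, y < (f ^ n).1 x := fun y hy => by
    obtain ⟨_, ⟨n, rfl⟩, hn⟩ := exists_lt_of_lt_csSup hne hy
    exact ⟨n, hn⟩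
  refine ⟨A, le_antisymm ?_ ?_, csSup_le hne (by rintro _ ⟨n, rfl⟩; exact hM n),
    fun n => (hstep n).trans_le (hle _), happ⟩
  · by_contra! h
    have h1 : (f⁻¹).1 A < A := by
      rw [← f.lt_iff]
      simpa using h
    obtain ⟨n, hn⟩ := happ _ h1
    rw [← f.lt_iff, apply_inv_self, ← mul_apply, ← pow_succ'] at hn
    exact absurd (hle (n + 1)) (not_le.2 hn)
  · refine csSup_le hne ?_
    rintro _ ⟨n, rfl⟩
    have h1 := hstep n
    rw [pow_succ', mul_apply] at h1
    exact h1.le.trans (f.le_iff.2 (hle n))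

/-- A bounded decreasing orbit converges to a fixed point. -/
theorem exists_fixed_below (f : LineLift N) {x M : ℝ} (hx : f.1 x < x)
    (hM : ∀ n : ℕ, M ≤ (f ^ n).1 x) :
    ∃ A, f.1 A = A ∧ M ≤ A ∧ (∀ n : ℕ, A < (f ^ n).1 x) ∧ ∀ y, A < y → ∃ n : ℕ, (f ^ n).1 x < y := by
  set A := sInf (Set.range fun n : ℕ => (f ^ n).1 x) with hA
  have hbdd : BddBelow (Set.range fun n : ℕ => (f ^ n).1 x) := ⟨M, by rintro _ ⟨n, rfl⟩; exact hM n⟩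
  have hne : (Set.range fun n : ℕ => (f ^ n).1 x).Nonempty := Set.range_nonempty _
  have hle : ∀ n : ℕ, A ≤ (f ^ n).1 x := fun n => csInf_le hbdd ⟨n, rfl⟩
  have hstep : ∀ n : ℕ, (f ^ (n + 1)).1 x < (f ^ n).1 x := fun n => by
    rw [pow_succ, mul_apply]
    exact (f ^ n).lt_iff.2 hx
  have happ : ∀ y, A < y → ∃ n : ℕ, (f ^ n).1 x < y := fun y hy => by
    obtain ⟨_, ⟨n, rfl⟩, hn⟩ := exists_lt_of_csInf_lt hne hy
    exact ⟨n, hn⟩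
  refine ⟨A, le_antisymm ?_ ?_, le_csInf hne (by rintro _ ⟨n, rfl⟩; exact hM n),
    fun n => (hle _).trans_lt (hstep n), happ⟩
  · refine le_csInf hne ?_
    rintro _ ⟨n, rfl⟩
    have h1 := hstep n
    rw [pow_succ', mul_apply] at h1
    exact (f.le_iff.2 (hle n)).trans h1.le
  · by_contra! h
    have h1 : A < (f⁻¹).1 A := by
      rw [← f.lt_iff]
      simpa using h
    obtain ⟨n, hn⟩ := happ _ h1
    rw [← f.lt_iff, apply_inv_self, ← mul_apply, ← pow_succ'] at hn
    exact absurd (hle (n + 1)) (not_le.2 hn)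

end LineLift

namespace GroupCircularOrder

theorem orderSign_of_lt {H : Type*} [Group H] {lt : H → H → Prop} {a b : H} (h : lt a b) :
    orderSign lt a b = 1 := by
  simp [orderSign, h]

theorem orderSign_of_gt {H : Type*} [Group H] {lt : H → H → Prop} (hlt : IsLeftOrder lt) {a b : H}
    (h : lt b a) : orderSign lt a b = -1 := by
  have : ¬ lt a b := fun h' => hlt.irrefl a (hlt.trans _ _ _ h' h)
  simp [orderSign, h, this]

theorem orderSign_self {H : Type*} [Group H] {lt : H → H → Prop} (hlt : IsLeftOrder lt) (a : H) :
    orderSign lt a a = 0 := by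
  simp [orderSign, hlt.irrefl a]

/-- A circular order that is positive on increasing triples is the coboundary of the order. -/
theorem eq_coboundary_of_increasing {Γ : Type*} [Group Γ] (c : GroupCircularOrder Γ)
    {H : Subgroup Γ} {lt : H → H → Prop} (hlt : IsLeftOrder lt)
    (h : ∀ x y z : H, lt x y → lt y z → c.toFun x y z = 1) (x y z : H) :
    (c.toFun x y z : ℤ) = orderSign lt y z - orderSign lt x z + orderSign lt x y := by
  have h' : ∀ x y z : H, lt x y → lt y z → (c.toFun x y z : ℤ) = 1 := fun x y z h1 h2 => by
    rw [h x y z h1 h2]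
    rfl
  rcases hlt.total x y with h1 | rfl | h1
  · rcases hlt.total y z with h2 | rfl | h2
    · rw [h' x y z h1 h2, orderSign_of_lt h1, orderSign_of_lt h2,
        orderSign_of_lt (hlt.trans _ _ _ h1 h2)]
      ring
    · rw [c.intCast_eq_zero (by simp), orderSign_self hlt]
      ring
    · rcases hlt.total x z with h3 | rfl | h3
      · rw [← neg_neg (c.toFun x y z : ℤ), ← c.intCast_swap_right, h' x z y h3 h2,
          orderSign_of_lt h1, orderSign_of_gt hlt h2, orderSign_of_lt h3]
        ring
      · rw [c.intCast_eq_zero (by simp), orderSign_self hlt, orderSign_of_lt h1,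
          orderSign_of_gt hlt h1]
        ring
      · rw [c.intCast_rotate z x y, h' z x y h3 h1, orderSign_of_lt h1, orderSign_of_gt hlt h2,
          orderSign_of_gt hlt h3]
        ring
  · rw [c.intCast_eq_zero (by simp), orderSign_self hlt]
    ring
  · rcases hlt.total y z with h2 | rfl | h2
    · rcases hlt.total x z with h3 | rfl | h3
      · rw [c.intCast_swap, h' y x z h1 h3, orderSign_of_gt hlt h1, orderSign_of_lt h2,
          orderSign_of_lt h3]
        ring
      · rw [c.intCast_eq_zero (by simp), orderSign_self hlt, orderSign_of_lt h1,
          orderSign_of_gt hlt h1]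
        ring
      · rw [← c.intCast_rotate x y z, h' y z x h2 h3, orderSign_of_gt hlt h1, orderSign_of_lt h2,
          orderSign_of_gt hlt h3]
        ring
    · rw [c.intCast_eq_zero (by simp), orderSign_self hlt]
      ring
    · rw [c.intCast_swap, c.intCast_rotate z y x, h' z y x h2 h1, orderSign_of_gt hlt h1, orderSign_of_gt hlt h2,
        orderSign_of_gt hlt (hlt.trans _ _ _ h2 h1)]
      ring

end GroupCircularOrder

namespace PingPongSystem

open LineLift GroupCircularOrder

variable {G : Type*} [Group G] {κ d : ℕ} [NeZero κ] [NeZero d] {L : Type*}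
  (S : PingPongSystem G κ d L)

theorem period_le : (κ : ℝ) ≤ κ * d := by
  have h1 : (0 : ℝ) < κ := by exact_mod_cast Nat.pos_of_ne_zero (NeZero.ne κ)
  have h4 : (1 : ℝ) ≤ d := by exact_mod_cast Nat.pos_of_ne_zero (NeZero.ne d)
  nlinarith

/-- The orbit of `0` under the boundary element stays within one period. -/
theorem bdryLift_lt_add {i j : ℤ} (h : i < j) :
    (S.bdryLift ^ j).1 0 < (S.bdryLift ^ i).1 0 + κ := by
  obtain ⟨n, rfl⟩ : ∃ n : ℕ, j = i + n := ⟨(j - i).toNat, by omega⟩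
  have h1 := (S.bdryLift ^ i).apply_add_int 0 1
  rw [Int.cast_one, one_mul] at h1
  rw [← h1, _root_.zpow_add, mul_apply, (S.bdryLift ^ i).lt_iff, zpow_natCast]
  have h2 : (2 : ℝ) ≤ κ := by exact_mod_cast S.two_le
  linarith [(S.bdryLift_pow_mem_Icc n le_rfl zero_le_one).2]

theorem strictMono_bdryPow {i j : ℤ} (h : i < j) :
    ((S.bdryLift ^ d) ^ i).1 0 < ((S.bdryLift ^ d) ^ j).1 0 := by
  have hd : (0 : ℤ) < d := by exact_mod_cast Nat.pos_of_ne_zero (NeZero.ne d)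
  rw [← zpow_natCast, ← _root_.zpow_mul, ← _root_.zpow_mul]
  exact S.strictMono_bdryLift_pow (mul_lt_mul_of_pos_left h hd)

theorem bdryPow_lt_add {i j : ℤ} (h : i < j) :
    ((S.bdryLift ^ d) ^ j).1 0 < ((S.bdryLift ^ d) ^ i).1 0 + κ := by
  have hd : (0 : ℤ) < d := by exact_mod_cast Nat.pos_of_ne_zero (NeZero.ne d)
  rw [← zpow_natCast, ← _root_.zpow_mul, ← _root_.zpow_mul]
  exact S.bdryLift_lt_add (mul_lt_mul_of_pos_left h hd)

theorem isLift_bdryPow (i : ℤ) : S.IsLift ((S.bdry ^ d) ^ i) ((S.bdryLift ^ d) ^ i) :=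
  S.isLift_bdry_pow.zpow i

theorem bdryPow_zpow_injective {i j : ℤ} (h : (S.bdry ^ d) ^ i = (S.bdry ^ d) ^ j) : i = j := by
  by_contra hne
  wlog hij : i < j generalizing i j
  · exact this h.symm (Ne.symm hne) (by omega)
  have h1 := S.isLift_bdryPow i
  have h2 := S.isLift_bdryPow j
  rw [← h] at h2
  have h3 := S.strictMono_bdryPow hij
  have h4 := S.bdryPow_lt_add hij
  have h5 := period_le (κ := κ) (d := d)
  have h6 := period_pos κ d
  have := h1.eq_of_lt h2 (by linarith) (by linarith)
  rw [this] at h3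
  exact lt_irrefl _ h3

variable {S} in
/-- An orbit point between two boundary translates of `0` is a boundary translate of `0`. -/
theorem IsLift.mem_zpowers_of_le {g : G} {f : LineLift κ} (h : S.IsLift g f) {i j : ℤ}
    (h1 : ((S.bdryLift ^ d) ^ i).1 0 ≤ f.1 0) (h2 : f.1 0 ≤ ((S.bdryLift ^ d) ^ j).1 0) :
    g ∈ Subgroup.zpowers (S.bdry ^ d) := by
  -- Take the last boundary translate not exceeding the point. If they differed, pulling back and
  -- using that α^d reaches the next orbit point would give a later one.
  obtain ⟨l, hl, hmax⟩ := Int.exists_greatest_of_bdd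
    (P := fun l => ((S.bdryLift ^ d) ^ l).1 0 ≤ f.1 0) ⟨j, fun z hz => by
      by_contra! hj
      have := S.strictMono_bdryPow hj
      linarith⟩ ⟨i, h1⟩
  have h3 := (S.isLift_bdryPow l).inv.mul h
  have e : f.1 0 = ((S.bdryLift ^ d) ^ l).1 ((((S.bdryLift ^ d) ^ l)⁻¹ * f).1 0) := by simp
  rcases hl.eq_or_lt with hl | hl
  · have := (S.isLift_bdryPow l).eq_of_apply_zero h hl
    exact ⟨l, this.1⟩
  · exfalso
    have h4 : 0 < (((S.bdryLift ^ d) ^ l)⁻¹ * f).1 0 := by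
      rw [← ((S.bdryLift ^ d) ^ l).lt_iff, ← e]
      exact hl
    have h5 := S.bdryLift_pow_first h3 h4
    rw [← ((S.bdryLift ^ d) ^ l).le_iff, ← e, ← mul_apply, ← _root_.zpow_add_one] at h5
    have := hmax _ h5
    omega

/-- Exponents give the order: all positions of these powers fit in one period, so circular and
linear order agree, and no foreign orbit point lies between two of them. -/
theorem isConvex_zpowers : S.order.IsConvex (Subgroup.zpowers (S.bdry ^ d)) := by
  set β := S.bdry ^ d with hβ
  let lt : Subgroup.zpowers β → Subgroup.zpowers β → Prop :=
    fun x y => ∃ i j : ℤ, i < j ∧ (x : G) = β ^ i ∧ (y : G) = β ^ j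
  have hlt : IsLeftOrder lt := by
    refine ⟨?_, ?_, ?_, ?_⟩
    · rintro a ⟨i, j, h, h1, h2⟩
      have := S.bdryPow_zpow_injective (h1.symm.trans h2)
      omega
    · rintro a b c ⟨i, j, h, h1, h2⟩ ⟨i', j', h', h1', h2'⟩
      have := S.bdryPow_zpow_injective (h2.symm.trans h1')
      exact ⟨i, j', by omega, h1, h2'⟩
    · rintro ⟨a, i, rfl⟩ ⟨b, j, rfl⟩
      rcases lt_trichotomy i j with h | rfl | h
      · exact Or.inl ⟨i, j, h, rfl, rfl⟩
      · exact Or.inr (Or.inl rfl)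
      · exact Or.inr (Or.inr ⟨j, i, h, rfl, rfl⟩)
    · rintro ⟨g, l, rfl⟩ a b ⟨i, j, h, h1, h2⟩
      refine ⟨l + i, l + j, by omega, ?_, ?_⟩
      · rw [_root_.zpow_add, ← h1]
        rfl
      · rw [_root_.zpow_add, ← h2]
        rfl
  have hN := period_le (κ := κ) (d := d)
  refine ⟨lt, hlt, S.order.eq_coboundary_of_increasing hlt ?_, ?_⟩
  · rintro x y z ⟨i, j, h, h1, h2⟩ ⟨i', j', h', h1', h2'⟩
    have := S.bdryPow_zpow_injective (h2.symm.trans h1')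
    subst this
    rw [h1, h2, h2']
    have h3 := S.bdryPow_lt_add (h.trans h')
    exact order_eq_one_of_lt (S.isLift_bdryPow _) (S.isLift_bdryPow _) (S.isLift_bdryPow _)
      (S.strictMono_bdryPow h) (S.strictMono_bdryPow h') (by linarith)
  · rintro h₁ h₂ g ⟨i, j, h, h1, h2⟩ ⟨i', j', h', h1', h2'⟩ hc
    rw [h1, h2'] at hc
    have e : j = i' := S.bdryPow_zpow_injective (h2.symm.trans h1')
    obtain ⟨fg, fj, hfg, hfj, k1, k2, k3⟩ := exists_lt_of_order_eq_one (S.isLift_bdryPow i) hc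
    have k4 := S.bdryPow_lt_add (show i < j' by omega)
    have k5 := S.strictMono_bdryPow (show i < j' by omega)
    have e2 : fj = (S.bdryLift ^ d) ^ j' := hfj.eq_of_lt (S.isLift_bdryPow j') (by linarith)
      (by linarith)
    rw [e2] at k2
    exact hfg.mem_zpowers_of_le k1.le k2.le

end PingPongSystem

end

/-! ### Convex subgroups larger than the boundary subgroup -/

noncomputable section

namespace PingPongSystem

open LineLift GroupCircularOrder

variable {G : Type*} [Group G] {κ d : ℕ} [NeZero κ] [NeZero d] {L : Type*}
  (S : PingPongSystem G κ d L)

/-- `f` lifts a positive element of the ordered subgroup `K`, and moves `0` by less than a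
period. -/
def IsPositiveLift {K : Subgroup G} (lt : K → K → Prop) (h : K) (f : LineLift κ) : Prop :=
  lt 1 h ∧ S.IsLift h f ∧ 0 < f.1 0 ∧ f.1 0 < κ * d

section Convex

variable {S} {K : Subgroup G} {lt : K → K → Prop} (hlt : IsLeftOrder lt)
  (hcob : ∀ x y z : K, (S.order.toFun x y z : ℤ) =
    orderSign lt y z - orderSign lt x z + orderSign lt x y)
  (hconv : ∀ (h₁ h₂ : K) (g : G), lt h₁ 1 → lt 1 h₂ → S.order.toFun h₁ g h₂ = 1 → g ∈ K)

include hlt hcob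

theorem order_eq_one_of_increasing {x y z : K} (h1 : lt x y) (h2 : lt y z) :
    S.order.toFun x y z = 1 := by
  rw [← S.order.intCast_eq_one_iff, hcob, orderSign_of_lt h1, orderSign_of_lt h2,
    orderSign_of_lt (hlt.trans _ _ _ h1 h2)]
  ring

omit hcob in
theorem exists_isPositiveLift {h : K} (hh : lt 1 h) : ∃ f, S.IsPositiveLift lt h f := by
  obtain ⟨f, hf, h1, h2⟩ := S.exists_isLift_mem_Ico h 0
  refine ⟨f, hh, hf, lt_of_le_of_ne h1 fun h3 => ?_, by simpa using h2⟩
  have := (hf.eq_of_apply_zero S.isLift_one (by simp [← h3])).1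
  have : h = 1 := Subtype.ext this
  exact hlt.irrefl 1 (this ▸ hh)

theorem IsPositiveLift.apply_lt {h h' : K} {f f' : LineLift κ} (hf : S.IsPositiveLift lt h f)
    (hf' : S.IsPositiveLift lt h' f') (hh : lt h h') : f.1 0 < f'.1 0 := by
  have h1 := order_eq_one_of_increasing hlt hcob hf.1 hh
  obtain ⟨fb, fx, hb, hx, h2, h3, h4⟩ := exists_lt_of_order_eq_one S.isLift_one h1
  simp only [one_apply, zero_add] at h2 h4
  obtain ⟨-, k1, k2, k3⟩ := hf
  obtain ⟨-, k1', k2', k3'⟩ := hf'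
  rwa [k1.eq_of_lt hb (by linarith) (by linarith), k1'.eq_of_lt hx (by linarith) (by linarith)]

theorem IsPositiveLift.lt_of_apply_lt {h h' : K} {f f' : LineLift κ}
    (hf : S.IsPositiveLift lt h f) (hf' : S.IsPositiveLift lt h' f') (hff : f.1 0 < f'.1 0) :
    lt h h' := by
  rcases hlt.total h h' with h1 | rfl | h1
  · exact h1
  · have := hf.2.1.eq_of_lt hf'.2.1 (by linarith [hf.2.2.2, hf'.2.2.1])
      (by linarith [hf'.2.2.2, hf.2.2.1])
    rw [this] at hff
    exact absurd hff (lt_irrefl _)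
  · exact absurd (hf'.apply_lt hlt hcob hf h1) hff.not_gt

/-- The product never wraps around: from 1 < h < hh' its position in (0, κd) is beyond that of h,
and the composite of the lifts is less than a period beyond it, so the two lifts coincide. -/
theorem IsPositiveLift.mul {h h' : K} {f f' : LineLift κ} (hf : S.IsPositiveLift lt h f)
    (hf' : S.IsPositiveLift lt h' f') : S.IsPositiveLift lt (h * h') (f * f') := by
  have h1 : lt h (h * h') := by simpa using hlt.left_inv h _ _ hf'.1
  have h2 := hlt.trans _ _ _ hf.1 h1
  obtain ⟨f'', hprod⟩ := exists_isPositiveLift (S := S) hlt h2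
  have h3 := hf.apply_lt hlt hcob hprod h1
  have h4 : f.1 0 < f.1 (f'.1 0) := f.lt_iff.2 hf'.2.2.1
  have h5 : f.1 (f'.1 0) < f.1 0 + κ * d := by
    have := hf.2.1.apply_add_period 0 1
    rw [Int.cast_one, one_mul] at this
    rw [← this, f.lt_iff, zero_add]
    exact hf'.2.2.2
  have h6 : f * f' = f'' := by
    refine (hf.2.1.mul hf'.2.1).eq_of_lt hprod.2.1 ?_ ?_
    · rw [mul_apply]
      linarith
    · rw [mul_apply]
      linarith [hprod.2.2.2, hf.2.2.1]
  rw [h6]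
  exact hprod

/-- The supremum of the positions of the positive elements of a convex subgroup is fixed by each of
them. -/
theorem exists_fixed_of_isPositiveLift {h₀ : K} (hh₀ : lt 1 h₀) :
    ∃ s : ℝ, (∀ (h : K) f, S.IsPositiveLift lt h f → f.1 0 < s ∧ f.1 s = s) ∧
      ∀ y < s, ∃ (h : K) (f : LineLift κ), S.IsPositiveLift lt h f ∧ y < f.1 0 := by
  set X : Set ℝ := {y | ∃ (h : K) (f : LineLift κ), S.IsPositiveLift lt h f ∧ f.1 0 = y} with hX
  have hne : X.Nonempty := by
    obtain ⟨f, hf⟩ := exists_isPositiveLift (S := S) hlt hh₀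
    exact ⟨_, h₀, f, hf, rfl⟩
  have hbdd : BddAbove X := by
    refine ⟨κ * d, ?_⟩
    rintro _ ⟨h, f, hf, rfl⟩
    exact hf.2.2.2.le
  have hle : ∀ (h : K) f, S.IsPositiveLift lt h f → f.1 0 ≤ sSup X :=
    fun h f hf => le_csSup hbdd ⟨h, f, hf, rfl⟩
  have happ : ∀ y < sSup X, ∃ (h : K) (f : LineLift κ), S.IsPositiveLift lt h f ∧ y < f.1 0 := by
    intro y hy
    obtain ⟨_, ⟨h, f, hf, rfl⟩, h1⟩ := exists_lt_of_lt_csSup hne hy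
    exact ⟨h, f, hf, h1⟩
  refine ⟨sSup X, fun h f hf => ⟨?_, le_antisymm ?_ ?_⟩, happ⟩
  · refine lt_of_lt_of_le ?_ (hle _ _ (hf.mul hlt hcob hf))
    rw [mul_apply, f.lt_iff]
    exact hf.2.2.1
  · by_contra! h1
    have h2 : (f⁻¹).1 (sSup X) < sSup X := by
      rw [← f.lt_iff]
      simpa using h1
    obtain ⟨h', f', hf', h3⟩ := happ _ h2
    rw [← f.lt_iff, apply_inv_self] at h3
    exact absurd (hle _ _ (hf.mul hlt hcob hf')) (not_le.2 h3)
  · refine csSup_le hne ?_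
    rintro _ ⟨h', f', hf', rfl⟩
    -- A position beyond that of h belongs to h·(h⁻¹h') with a positive second factor, hence is the
    -- image under f of another position.
    rcases le_or_gt (f'.1 0) (f.1 0) with h1 | h1
    · refine h1.trans (f.le_iff.2 ?_)
      exact hf.2.2.1.le.trans (hle _ _ hf)
    · have h2 := hf.lt_of_apply_lt hlt hcob hf' h1
      have h3 : lt 1 (h⁻¹ * h') := by simpa using hlt.left_inv h⁻¹ _ _ h2
      obtain ⟨f'', hf''⟩ := exists_isPositiveLift (S := S) hlt h3
      have h4 := hf.mul hlt hcob hf''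
      rw [mul_inv_cancel_left] at h4
      have h5 : f' = f * f'' := hf'.2.1.eq_of_lt h4.2.1 (by linarith [hf'.2.2.2, h4.2.2.1])
        (by linarith [hf'.2.2.1, h4.2.2.2])
      rw [h5, mul_apply, f.le_iff]
      exact hle _ _ hf''

include hconv

/-- Orbit points between `0` and the position of a positive element belong to positive elements. -/
theorem IsPositiveLift.of_lt {h : K} {f : LineLift κ} (hf : S.IsPositiveLift lt h f) {g : G}
    {f' : LineLift κ} (hg : S.IsLift g f') (h0 : 0 < f'.1 0) (h1 : f'.1 0 < f.1 0) :
    ∃ hgK : g ∈ K, S.IsPositiveLift lt ⟨g, hgK⟩ f' := by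
  have e1 : lt h⁻¹ 1 := by simpa using hlt.left_inv h⁻¹ _ _ hf.1
  have e2 : S.order.toFun ((1 : K) : G) h (h⁻¹ : K) = 1 :=
    S.order.rotate_eq_one (order_eq_one_of_increasing hlt hcob e1 hf.1)
  obtain ⟨fb, fx, hb, hx, h2, h3, h4⟩ := exists_lt_of_order_eq_one S.isLift_one e2
  simp only [one_apply, zero_add] at h2 h4
  obtain ⟨k0, k1, k2, k3⟩ := hf
  have e0 := k1.eq_of_lt hb (by linarith) (by linarith)
  rw [← e0] at h2 h3
  -- From the position 0 of the identity one meets g, h, h⁻¹ in this order, so g lies on the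
  -- positive arc from h⁻¹ to h and convexity applies.
  have e3 : S.order.toFun g h (h⁻¹ : K) = 1 :=
    order_eq_one_of_lt hg k1 hx h1 h3 (by linarith)
  have e4 := S.order.rotate_eq_one (S.order.rotate_eq_one e3)
  have hgK := hconv h⁻¹ h g e1 k0 e4
  refine ⟨hgK, ?_, hg, h0, h1.trans k3⟩
  have e5 : S.order.toFun ((1 : K) : G) g h = 1 :=
    order_eq_one_of_lt S.isLift_one hg k1 (by simpa using h0) h1 (by simpa using k3)
  rcases hlt.total 1 ⟨g, hgK⟩ with h5 | h5 | h5
  · exact h5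
  · exact absurd (congrArg Subtype.val h5) (S.order.ne_of_eq_one e5).1
  · have e6 := order_eq_one_of_increasing hlt hcob h5 k0
    have e7 := S.order.intCast_swap ((1 : K) : G) g h
    rw [e5, e6] at e7
    simp at e7

end Convex

theorem bdry_pow_ne_one : S.bdry ^ d ≠ 1 := by
  intro h
  have := S.bdryPow_zpow_injective (i := 1) (j := 0) (by simpa using h)
  omega

/-- Every integer translate of a power of `bdryLift` lifts a power of the boundary element. -/
theorem exists_isLift_bdry_zpow (t : ℤ) :
    ∃ l : ℤ, S.IsLift (S.bdry ^ l) (S.bdryLift ^ l * translate κ (t * κ)) := by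
  obtain ⟨a, b, hab⟩ := S.coprime
  -- Here a is the inverse of shift modulo d, so α^(ta) changes sheets by t modulo d; the rest is a
  -- deck translation.
  refine ⟨t * a, ?_⟩
  have h1 := (S.isLift_bdry.zpow (t * a)).mul_translate (t * b)
  have hc : Commute S.bdryLift (translate κ (S.shift * κ)) := translate_period_commute _ _
  have h2 : translate κ (S.shift * κ) ^ (t * a) = translate κ ((t * a * S.shift : ℤ) * κ) := by
    generalize t * a = l
    induction l using Int.induction_on with
    | zero => exact LineLift.ext fun x => by simp
    | succ i ih =>
      rw [_root_.zpow_add_one, ih, translate_mul]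
      congr 1
      push_cast
      ring
    | pred i ih =>
      rw [_root_.zpow_sub_one, ih, translate_inv, translate_mul]
      congr 1
      push_cast
      ring
  rw [hc.mul_zpow, h2, mul_assoc, translate_mul] at h1
  convert h1 using 3
  have hab' : (a : ℝ) * S.shift + b * d = 1 := by exact_mod_cast hab
  push_cast
  linear_combination (-(t : ℝ) * κ) * hab'

theorem _root_.LineLift.zpow_apply_eq_of_apply_eq {N : ℕ} (f : LineLift N) {x : ℝ}
    (h : f.1 x = x) (l : ℤ) : (f ^ l).1 x = x := by
  obtain ⟨n, rfl | rfl⟩ := l.eq_nat_or_neg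
  · simpa using f.pow_apply_eq_of_apply_eq h n
  · simpa using (f ^ n).inv_apply_eq_of_apply_eq (f.pow_apply_eq_of_apply_eq h n)

/-- A boundary fixed point is not an orbit point of `0`, even up to translation. -/
theorem IsLift.apply_zero_ne_of_fixed {S : PingPongSystem G κ d L} {g : G} {f : LineLift κ}
    (hf : S.IsLift g f) {s : ℝ} (hs : (S.bdryLift ^ d).1 s = s) (t : ℤ) :
    f.1 0 ≠ s + t * κ := by
  intro h
  -- Otherwise the conjugate g⁻¹α^d g would fix 0, against freeness.
  have h1 := (hf.inv.mul S.isLift_bdry_pow).mul hf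
  have h2 : (f⁻¹ * S.bdryLift ^ d * f).1 ((0 : ℤ) : ℝ) = (0 : ℤ) := by
    rw [mul_apply, mul_apply, Int.cast_zero, h, apply_add_int, hs, ← h]
    simp
  have h3 := h1.eq_one_of_apply_int h2
  apply S.bdry_pow_ne_one
  calc S.bdry ^ d = g * (g⁻¹ * S.bdry ^ d * g) * g⁻¹ := by group
    _ = 1 := by rw [h3]; group

/-- A convex subgroup that is not contained in the boundary subgroup has a lift of every element
fixing a point of the line up to translation. -/
theorem exists_fixed_of_isConvex {K : Subgroup G} (hK : S.order.IsConvex K)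
    (hne : ¬ K ≤ Subgroup.zpowers (S.bdry ^ d)) :
    ∃ s : ℝ, ∀ x f, S.IsLift x f → ∃ z : ℤ, f.1 s = s + z * κ := by
  obtain ⟨lt, hlt, hcob, hconv⟩ := hK
  obtain ⟨g, hgpos, hgn⟩ : ∃ g : K, lt 1 g ∧ (g : G) ∉ Subgroup.zpowers (S.bdry ^ d) := by
    obtain ⟨g, hg, hgn⟩ := SetLike.not_le_iff_exists.1 hne
    rcases hlt.total 1 ⟨g, hg⟩ with h | h | h
    · exact ⟨_, h, hgn⟩
    · exact absurd (by rw [show g = 1 from (congrArg Subtype.val h).symm]; exact one_mem _) hgn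
    · exact ⟨⟨g, hg⟩⁻¹, by simpa using hlt.left_inv ⟨g, hg⟩⁻¹ _ _ h, fun h' => hgn (by simpa using h')⟩
  obtain ⟨s, hs, happ⟩ := exists_fixed_of_isPositiveLift hlt hcob hgpos
  obtain ⟨fg, hfg⟩ := exists_isPositiveLift (S := S) hlt hgpos
  set b := S.bdryLift ^ d with hb
  have hβ : S.IsLift (S.bdry ^ d) b := S.isLift_bdry_pow
  -- If the forward orbit of 0 under b overtook g, then g would lie between two boundary translates
  -- and be a power of α^d.
  have hlt_g : ∀ n : ℕ, (b ^ n).1 0 < fg.1 0 := fun n => by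
    by_contra! h
    refine hgn (hfg.2.1.mem_zpowers_of_le (i := 0) (j := n) ?_ ?_)
    · simpa using hfg.2.2.1.le
    · rw [zpow_natCast]
      exact h
  have hb0 : 0 < b.1 0 := by
    have := S.strictMono_bdryPow (show (0 : ℤ) < 1 by omega)
    rw [← hb, zpow_one, zpow_zero] at this
    simpa using this
  have hsg := (hs g fg hfg).1
  have hbs : b.1 s = s := by
    obtain ⟨h1, h2⟩ := hfg.of_lt hlt hcob hconv hβ hb0 (by simpa using hlt_g 1)
    exact (hs _ _ h2).2
  obtain ⟨A, hA, hA1, hA2, -⟩ := b.exists_fixed_above hb0 fun n => (hlt_g n).le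
  have hA0 : 0 < A := by simpa using hA2 0
  have hbinv : (b⁻¹).1 0 < 0 := by
    rw [← b.lt_iff]
    simpa using hb0
  obtain ⟨B, hB, -, hB2, hB3⟩ := (b⁻¹).exists_fixed_below (M := -κ) hbinv fun n => by
    have h1 : (b⁻¹ ^ n).1 0 = (b ^ (-(n : ℤ))).1 0 := by simp
    have h2 := S.bdryPow_lt_add (show (-(n : ℤ) : ℤ) < 1 by omega)
    rw [h1]
    simp only [zpow_one] at h2
    linarith
  have hB0 : B < 0 := by simpa using hB2 0
  replace hB : b.1 B = B := by
    nth_rewrite 1 [← hB]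
    simp
  -- Every orbit point within one period below s belongs to K: positive positions by convexity,
  -- those in (B, 0) after multiplication by a power of α^d.
  have memK : ∀ x f, S.IsLift x f → s - κ < f.1 0 → f.1 0 < s → x ∈ K := by
    have mem_pos : ∀ x f, S.IsLift x f → 0 < f.1 0 → f.1 0 < s → x ∈ K := fun x f hf h1 h2 => by
      obtain ⟨h, f', hf', h3⟩ := happ _ h2
      exact (hf'.of_lt hlt hcob hconv hf h1 h3).1
    have hβK : S.bdry ^ d ∈ K :=
      mem_pos _ b hβ hb0 (by simpa using (hlt_g 1).trans hsg)
    intro x f hf h1 h2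
    rcases lt_trichotomy (f.1 0) 0 with h3 | h3 | h3
    · by_cases h4 : B < f.1 0
      · obtain ⟨n, hn⟩ := hB3 _ h4
        have h5 : S.IsLift ((S.bdry ^ d) ^ n * x) (b ^ n * f) := (hβ.pow n).mul hf
        have h6 := mem_pos _ _ h5 (by
          rw [LineLift.mul_apply, ← ((b ^ n)⁻¹).lt_iff]
          simpa using hn) (by
          rw [LineLift.mul_apply]
          exact ((b ^ n).lt_iff.2 h3).trans ((hlt_g n).trans hsg))
        exact (Subgroup.mul_mem_cancel_left _ (pow_mem hβK n)).1 h6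
      -- A position in (s - κ, B] would make B < A < s < B + κ three fixed points of b within one
      -- period.
      · exact absurd (S.eq_one_of_fixed _ b hβ B A s (by linarith) (by linarith) (by linarith)
          hB hA hbs) S.bdry_pow_ne_one
    · rw [(hf.eq_of_apply_zero S.isLift_one (by simpa using h3)).1]
      exact one_mem _
    · exact mem_pos x f hf h3 h2
  have lift_of_mem : ∀ x ∈ K, ∃ f, S.IsLift x f ∧ f.1 s = s := by
    intro x hx
    rcases hlt.total 1 ⟨x, hx⟩ with h | h | h
    · obtain ⟨f, hf⟩ := exists_isPositiveLift (S := S) hlt h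
      exact ⟨f, hf.2.1, (hs _ _ hf).2⟩
    · refine ⟨1, ?_, by simp⟩
      rw [show x = 1 from (congrArg Subtype.val h).symm]
      exact S.isLift_one
    · have h' : lt 1 ⟨x, hx⟩⁻¹ := by simpa using hlt.left_inv ⟨x, hx⟩⁻¹ _ _ h
      obtain ⟨f, hf⟩ := exists_isPositiveLift (S := S) hlt h'
      refine ⟨f⁻¹, by simpa using hf.2.1.inv, f.inv_apply_eq_of_apply_eq (hs _ _ hf).2⟩
  have has : S.bdryLift.1 s = s := S.bdryLift.apply_eq_of_pow_apply_eq (NeZero.ne d) hbs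
  have hκ : (0 : ℝ) < κ := by exact_mod_cast Nat.pos_of_ne_zero (NeZero.ne κ)
  refine ⟨s, fun x f hf => ?_⟩
  obtain ⟨t, ht1, ht2⟩ : ∃ t : ℤ, s - κ ≤ f.1 0 + t * κ ∧ f.1 0 + t * κ < s := by
    obtain ⟨t, ht, -⟩ := existsUnique_add_zsmul_mem_Ico hκ (f.1 0) (s - κ)
    refine ⟨t, ?_, ?_⟩
    · simpa using ht.1
    · simpa using ht.2
  replace ht1 : s - κ < f.1 0 + t * κ := by
    refine lt_of_le_of_ne ht1 fun h => hf.apply_zero_ne_of_fixed hbs (-1 - t) ?_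
    push_cast
    linarith
  -- Translation by tκ alone need not come from the group. Combined with `bdryLift ^ l` it lifts a
  -- power of α, and `bdryLift` fixes s, so the window (s - κ, s) is preserved.
  obtain ⟨l, hl⟩ := S.exists_isLift_bdry_zpow t
  have h1 := hl.mul hf
  have hls := S.bdryLift.zpow_apply_eq_of_apply_eq has l
  have hx := memK _ _ h1 (by
    have := (S.bdryLift ^ l).apply_add_int s (-1)
    rw [hls] at this
    simp only [LineLift.mul_apply, LineLift.translate_apply]
    have h2 := (S.bdryLift ^ l).lt_iff.2 (show s + (-1 : ℤ) * κ < f.1 0 + t * κ by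
      push_cast
      linarith)
    rw [this] at h2
    simp only [Int.cast_neg, Int.cast_one] at h2
    linarith) (by
    simp only [LineLift.mul_apply, LineLift.translate_apply]
    have h2 := (S.bdryLift ^ l).lt_iff.2 ht2
    rwa [hls] at h2)
  obtain ⟨f', hf', hf's⟩ := lift_of_mem _ hx
  obtain ⟨z, hz⟩ := h1.exists_int hf'
  refine ⟨-t - z * d, ?_⟩
  rw [hz, LineLift.mul_apply, LineLift.translate_apply, h1.apply_add_period, LineLift.mul_apply,
    LineLift.mul_apply, LineLift.translate_apply, apply_add_int] at hf's
  have h3 : (S.bdryLift ^ l).1 (f.1 s) = (S.bdryLift ^ l).1 (s + (-t - z * d : ℤ) * κ) := by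
    rw [apply_add_int, hls]
    simp only [Int.cast_sub, Int.cast_neg, Int.cast_mul, Int.cast_natCast]
    linarith
  exact (S.bdryLift ^ l).strictMono.injective h3

/-- The linear part of the order is generated by the `d`-th power of the boundary element. -/
theorem isLinearPart (hno : ∃ g f, S.IsLift g f ∧ ∀ x (z : ℤ), f.1 x ≠ x + z * κ) :
    S.order.IsLinearPart (Subgroup.zpowers (S.bdry ^ d)) := by
  refine ⟨S.isConvex_zpowers, fun K hK => ?_⟩
  by_contra hne
  obtain ⟨s, hs⟩ := S.exists_fixed_of_isConvex hK hne
  obtain ⟨g, f, hf, h⟩ := hno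
  obtain ⟨z, hz⟩ := hs g f hf
  exact h s z hz

end PingPongSystem

end

/-! ### Automorphic images -/

namespace GroupCircularOrder

variable {Γ : Type*} [Group Γ] (c : GroupCircularOrder Γ)

theorem autImage_symm_autImage (φ : Γ ≃* Γ) : (c.autImage φ).autImage φ.symm = c := by
  ext x y z
  simp [autImage]

variable {c}

theorem IsConvex.comap {K : Subgroup Γ} (h : c.IsConvex K) (φ : Γ ≃* Γ) :
    (c.autImage φ).IsConvex (K.comap φ.toMonoidHom) := by
  obtain ⟨lt, hlt, hcob, hconv⟩ := h
  let ψ : K.comap φ.toMonoidHom →* K :=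
    (φ.toMonoidHom.comp (Subgroup.subtype _)).codRestrict K fun x => x.2
  have hψ : ∀ x, (ψ x : Γ) = φ x := fun x => rfl
  have hinj : Function.Injective ψ := fun x y hxy => by
    have := congrArg (Subtype.val) hxy
    rw [hψ, hψ] at this
    exact Subtype.ext (φ.injective this)
  refine ⟨fun x y => lt (ψ x) (ψ y), ⟨fun a => hlt.irrefl _, fun a b c => hlt.trans _ _ _, ?_, ?_⟩,
    ?_, ?_⟩
  · intro a b
    rcases hlt.total (ψ a) (ψ b) with h | h | h
    · exact Or.inl h
    · exact Or.inr (Or.inl (hinj h))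
    · exact Or.inr (Or.inr h)
  · intro g a b h
    rw [map_mul, map_mul]
    exact hlt.left_inv _ _ _ h
  · intro x y z
    exact hcob (ψ x) (ψ y) (ψ z)
  · intro h₁ h₂ g h1 h2 h3
    rw [map_one] at h1 h2
    exact hconv (ψ h₁) (ψ h₂) (φ g) h1 h2 h3

/-- The pullback of K along φ⁻¹ is convex for c', hence contained in the largest such subgroup. -/
theorem IsLinearPart.map_mem {K K' : Subgroup Γ} {c' : GroupCircularOrder Γ} (φ : Γ ≃* Γ)
    (h : c.IsLinearPart K) (h' : c'.IsLinearPart K') (e : c = c'.autImage φ) {x : Γ}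
    (hx : x ∈ K) : φ x ∈ K' := by
  have h1 := h.1.comap φ.symm
  rw [e, autImage_symm_autImage] at h1
  refine h'.2 h1 ?_
  simpa using hx

/-- If the roots of odd degree of powers of `a` are powers of `a`, then the exponents of linear
parts generated by powers of `a` are preserved by automorphic images. -/
theorem IsLinearPart.dvd_of_eq_autImage {a : Γ} (hinj : Function.Injective fun i : ℤ => a ^ i)
    (hroot : ∀ (g : Γ) (d : ℕ) (i : ℤ), Odd d → i ≠ 0 → g ^ d = a ^ i → g ∈ Subgroup.zpowers a)
    {d d' : ℕ} (hd : Odd d) (hd' : d' ≠ 0) {c' : GroupCircularOrder Γ}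
    (h : c.IsLinearPart (Subgroup.zpowers (a ^ d)))
    (h' : c'.IsLinearPart (Subgroup.zpowers (a ^ d'))) {φ : Γ ≃* Γ} (e : c = c'.autImage φ) :
    d ∣ d' := by
  have e' : c' = c.autImage φ.symm := by rw [e, autImage_symm_autImage]
  obtain ⟨u, hu⟩ := h.map_mem φ h' e (Subgroup.mem_zpowers _)
  obtain ⟨v, hv⟩ := h'.map_mem φ.symm h e' (Subgroup.mem_zpowers _)
  simp only [← zpow_natCast, ← _root_.zpow_mul] at hu hv
  have h1 : a ^ (d' : ℤ) = a ^ (d' * (u * v)) := by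
    have := congrArg φ hv
    rw [φ.apply_symm_apply, _root_.zpow_mul, map_zpow, ← hu, ← _root_.zpow_mul, mul_assoc] at this
    exact this.symm
  have h2 : (d' : ℤ) = d' * (u * v) := hinj h1
  have h3 : u * v = 1 := by
    have : (d' : ℤ) ≠ 0 := by exact_mod_cast hd'
    exact mul_left_cancel₀ this (by rw [← h2, mul_one])
  have hd'' : (d' : ℤ) * u ≠ 0 := mul_ne_zero (by exact_mod_cast hd') (left_ne_zero_of_mul_eq_one h3)
  rw [map_zpow, zpow_natCast] at hu
  -- The power φ(a)^d is a nontrivial power of a, so φ(a) = a^s and s·d = d'·u; since u·v = 1, this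
  -- gives d ∣ d'.
  obtain ⟨s, hs⟩ := hroot (φ a) d _ hd hd'' hu.symm
  simp only at hs
  rw [← hs, ← zpow_natCast, ← _root_.zpow_mul] at hu
  have h4 : (d' : ℤ) * u = s * d := hinj hu
  rw [← Int.natCast_dvd_natCast]
  exact ⟨s * v, by linear_combination (-(d' : ℤ)) * h3 + v * h4⟩

end GroupCircularOrder

/-! ### Roots of powers of the boundary element, in the base action -/

noncomputable section

namespace PingPongSystem

open LineLift GroupCircularOrder

section Root

variable {G : Type*} [Group G] {κ : ℕ} [NeZero κ] {L : Type*} (S : PingPongSystem G κ 1 L)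

theorem isLift_bdryLift : S.IsLift S.bdry S.bdryLift := by
  simpa using S.isLift_bdry_pow

theorem bdry_zpow_injective : Function.Injective fun i : ℤ => S.bdry ^ i := by
  intro i j h
  refine S.bdryPow_zpow_injective ?_
  simpa using h

/-- The fixed points of the boundary element adjacent to `0`. -/
theorem exists_bdry_fixed : ∃ A B : ℝ, S.bdryLift.1 A = A ∧ S.bdryLift.1 B = B ∧ B < 0 ∧ 0 < A ∧
    A ≤ B + κ ∧ ∀ x, B < x → x < A → ∃ i j : ℤ, (S.bdryLift ^ i).1 0 < x ∧ x < (S.bdryLift ^ j).1 0 := by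
  set b := S.bdryLift
  have hinv : (b⁻¹).1 0 < 0 := by
    rw [← b.lt_iff]
    simpa using S.zero_lt_bdryLift
  obtain ⟨B, hB, -, hB2, hB3⟩ := (b⁻¹).exists_fixed_below (M := -κ) hinv fun n => by
    have h1 : (b⁻¹ ^ n).1 0 = (b ^ (-(n : ℤ))).1 0 := by simp
    have h2 := S.bdryLift_lt_add (show (-(n : ℤ) : ℤ) < 1 by omega)
    have h3 := S.zero_lt_bdryLift
    rw [h1]
    simp only [zpow_one] at h2
    linarith
  have hB' : b.1 B = B := by
    nth_rewrite 1 [← hB]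
    simp
  obtain ⟨A, hA, hA1, hA2, hA3⟩ := b.exists_fixed_above (M := B + κ) S.zero_lt_bdryLift fun n => by
    -- If the forward orbit passed B + κ, some backward translate would lie more than κ below it,
    -- while the orbit under α spans at most one period.
    by_contra! h
    obtain ⟨i, hi⟩ := hB3 ((b ^ n).1 0 - κ) (by linarith)
    have h2 := S.bdryLift_lt_add (show (-(i : ℤ) : ℤ) < n + 1 by omega)
    have h3 := S.strictMono_bdryLift_pow (show (n : ℤ) < n + 1 by omega)
    have h1 : (b⁻¹ ^ i).1 0 = (b ^ (-(i : ℤ))).1 0 := by simp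
    rw [zpow_natCast] at h3
    linarith
  refine ⟨A, B, hA, hB', by simpa using hB2 0, by simpa using hA2 0, hA1, fun x h1 h2 => ?_⟩
  obtain ⟨i, hi⟩ := hB3 x h1
  obtain ⟨j, hj⟩ := hA3 x h2
  refine ⟨-i, j, ?_, ?_⟩
  · simpa using hi
  · rw [zpow_natCast]
    exact hj

/-- The boundary element fixes no further points. -/
theorem eq_add_of_bdry_fixed {A B : ℝ} (hA : S.bdryLift.1 A = A) (hB : S.bdryLift.1 B = B)
    (hBA : B < A) (hdyn : ∀ x, B < x → x < A →
      ∃ i j : ℤ, (S.bdryLift ^ i).1 0 < x ∧ x < (S.bdryLift ^ j).1 0)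
    {x : ℝ} (hx : S.bdryLift.1 x = x) :
    (∃ z : ℤ, x = A + z * κ) ∨ ∃ z : ℤ, x = B + z * κ := by
  have hκ : (0 : ℝ) < κ := by exact_mod_cast Nat.pos_of_ne_zero (NeZero.ne κ)
  obtain ⟨t, ht, -⟩ := existsUnique_add_zsmul_mem_Ico hκ x B
  simp only [zsmul_eq_mul, Set.mem_Ico] at ht
  by_contra! h
  have h1 : B < x + t * κ := lt_of_le_of_ne ht.1 fun h1 => h.2 (-t) (by
    push_cast
    linarith)
  have h2 : x + t * κ ≠ A := fun h1 => h.1 (-t) (by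
    push_cast
    linarith)
  have h3 : S.bdryLift.1 (x + t * κ) = x + t * κ := by rw [apply_add_int, hx]
  have h5 : S.bdry ≠ 1 := by simpa using S.bdry_pow_ne_one
  rcases lt_or_gt_of_ne h2 with h2 | h2
  · obtain ⟨i, j, h6, h7⟩ := hdyn _ h1 h2
    rw [← S.bdryLift.zpow_apply_eq_of_apply_eq h3 i, LineLift.lt_iff] at h6
    rw [← S.bdryLift.zpow_apply_eq_of_apply_eq h3 j, LineLift.lt_iff] at h7
    linarith
  · exact h5 (S.eq_one_of_fixed _ _ S.isLift_bdryLift B A _ hBA h2 ht.2 hB hA h3)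

/-- Odd roots of powers of the boundary element are powers of the boundary element. -/
theorem mem_zpowers_bdry_of_pow_eq {g : G} {d : ℕ} {i : ℤ} (hd : Odd d) (hi : i ≠ 0)
    (h : g ^ d = S.bdry ^ i) : g ∈ Subgroup.zpowers S.bdry := by
  have hκ : (0 : ℝ) < κ := by exact_mod_cast Nat.pos_of_ne_zero (NeZero.ne κ)
  obtain ⟨A, B, hA, hB, hB0, hA0, hAB, hdyn⟩ := S.exists_bdry_fixed
  obtain ⟨f, hf⟩ := S.exists_isLift g
  have hcomm : Commute f (S.bdryLift ^ i) := by
    have h1 := S.isLift_bdryLift.zpow i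
    rw [← h] at h1
    obtain ⟨z, hz⟩ := (hf.pow d).exists_int h1
    rw [hz]
    refine (Commute.refl f).pow_right d |>.mul_right ?_
    have : f * translate κ (z * κ) = translate κ (z * κ) * f := translate_period_commute f z
    simpa [Commute, SemiconjBy] using this
  -- f commutes with a nontrivial power of the boundary lift, and a monotone map has the same fixed
  -- points as its nonzero powers, so f permutes the fixed points.
  have hfix : ∀ x, S.bdryLift.1 x = x → S.bdryLift.1 (f.1 x) = f.1 x := fun x hx => by
    have h1 : (S.bdryLift ^ i).1 (f.1 x) = f.1 x := by
      rw [← LineLift.mul_apply, ← hcomm.eq, LineLift.mul_apply,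
        S.bdryLift.zpow_apply_eq_of_apply_eq hx]
    obtain ⟨n, rfl | rfl⟩ := i.eq_nat_or_neg
    · rw [zpow_natCast] at h1
      exact S.bdryLift.apply_eq_of_pow_apply_eq (by simpa using hi) h1
    · rw [_root_.zpow_neg, zpow_natCast] at h1
      have h2 := LineLift.inv_apply_eq_of_apply_eq _ h1
      rw [inv_inv] at h2
      exact S.bdryLift.apply_eq_of_pow_apply_eq (by simpa using hi) h2
  have hcases := fun {x} hx => S.eq_add_of_bdry_fixed hA hB (hB0.trans hA0) hdyn (x := x) hx
  have hinj := f.strictMono.injective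
  -- There are at most two classes of fixed points modulo κ, the classes of A and B; even if f
  -- exchanges them, its square preserves each.
  have sqA : ∃ z : ℤ, f.1 (f.1 A) = A + z * κ := by
    rcases hcases (hfix A hA) with ⟨z, hz⟩ | ⟨z, hz⟩
    · exact ⟨z + z, by rw [hz, apply_add_int, hz]; push_cast; ring⟩
    · rcases hcases (hfix B hB) with ⟨y, hy⟩ | ⟨y, hy⟩
      · exact ⟨y + z, by rw [hz, apply_add_int, hy]; push_cast; ring⟩
      · have h1 : A = B + (z - y : ℤ) * κ := hinj (by
          rw [apply_add_int, hz, hy]; push_cast; ring)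
        have h2 : f.1 A = A + y * κ := by
          rw [hz]
          push_cast at h1
          linarith
        exact ⟨y + y, by rw [h2, apply_add_int, h2]; push_cast; ring⟩
  have sqB : ∃ z : ℤ, f.1 (f.1 B) = B + z * κ := by
    rcases hcases (hfix B hB) with ⟨z, hz⟩ | ⟨z, hz⟩
    · rcases hcases (hfix A hA) with ⟨y, hy⟩ | ⟨y, hy⟩
      · have h1 : B = A + (z - y : ℤ) * κ := hinj (by
          rw [apply_add_int, hz, hy]; push_cast; ring)
        have h2 : f.1 B = B + y * κ := by
          rw [hz]
          push_cast at h1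
          linarith
        exact ⟨y + y, by rw [h2, apply_add_int, h2]; push_cast; ring⟩
      · exact ⟨y + z, by rw [hz, apply_add_int, hy]; push_cast; ring⟩
    · exact ⟨z + z, by rw [hz, apply_add_int, hz]; push_cast; ring⟩
  obtain ⟨z, hz⟩ := sqA
  obtain ⟨z', hz'⟩ := sqB
  -- f ∘ f preserves B < A ≤ B + κ, so it moves A and B by the same multiple of κ.
  have hzz : z' = z := by
    have h1 : f.1 (f.1 B) < f.1 (f.1 A) := f.lt_iff.2 (f.lt_iff.2 (hB0.trans hA0))
    have h2 : f.1 (f.1 A) ≤ f.1 (f.1 B) + κ := by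
      have := f.le_iff.2 (f.le_iff.2 hAB)
      have e := fun x => f.apply_add_int x 1
      simp only [Int.cast_one, one_mul] at e
      rwa [e, e] at this
    rw [hz, hz'] at h1 h2
    have h3 : ((z' - z : ℤ) : ℝ) * κ < (1 : ℤ) * κ := by push_cast; linarith
    have h4 : ((z - z' : ℤ) : ℝ) * κ < (1 : ℤ) * κ := by push_cast; linarith
    have h5 := Int.cast_lt.1 ((mul_lt_mul_iff_left₀ hκ).1 h3)
    have h6 := Int.cast_lt.1 ((mul_lt_mul_iff_left₀ hκ).1 h4)
    omega
  subst hzz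
  -- With this multiple removed, the lift of g² fixes A and B, so it keeps 0 in (B, A), where all
  -- orbit points are boundary translates.
  have hsq : S.IsLift (g * g) (translate κ ((-z' : ℤ) * κ) * (f * f)) := by
    have := (S.isLift_translate (-z')).mul (hf.mul hf)
    simpa using this
  have e : ∀ x, (translate κ ((-z' : ℤ) * κ) * (f * f)).1 x = f.1 (f.1 x) - z' * κ := fun x => by
    simp only [LineLift.mul_apply, LineLift.translate_apply]
    push_cast
    ring
  have h1 : B < (translate κ ((-z' : ℤ) * κ) * (f * f)).1 0 := by
    have : f.1 (f.1 B) < f.1 (f.1 0) := f.lt_iff.2 (f.lt_iff.2 hB0)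
    rw [e]
    linarith
  have h2 : (translate κ ((-z' : ℤ) * κ) * (f * f)).1 0 < A := by
    have : f.1 (f.1 0) < f.1 (f.1 A) := f.lt_iff.2 (f.lt_iff.2 hA0)
    rw [e]
    linarith
  obtain ⟨a, b, h3, h4⟩ := hdyn _ h1 h2
  have hmem := hsq.mem_zpowers_of_le (i := a) (j := b) (by simpa using h3.le) (by simpa using h4.le)
  rw [pow_one] at hmem
  obtain ⟨j, rfl⟩ := hd
  have h5 : g = S.bdry ^ i * ((g * g) ^ j)⁻¹ := by
    rw [← h, ← pow_two, ← pow_mul]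
    group
  rw [h5]
  exact mul_mem (Subgroup.zpow_mem_zpowers _ _) (inv_mem (pow_mem hmem j))

end Root

end PingPongSystem

end

/-! ### Möbius transformations of the circle -/

noncomputable section

theorem boundaryPoint_coe (t : ℝ) : boundaryPoint (t : UnitAddCircle) =
    Projectivization.mk ℝ ![Real.sin (Real.pi * t), Real.cos (Real.pi * t)]
      (sin_cos_ne_zero _) :=
  boundary_periodic.lift_coe t

/-- Two points of the line with proportional boundary vectors differ by an integer. -/
theorem exists_int_of_proportional {x y r : ℝ}
    (h0 : r * Real.sin (Real.pi * y) = Real.sin (Real.pi * x))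
    (h1 : r * Real.cos (Real.pi * y) = Real.cos (Real.pi * x)) : ∃ z : ℤ, y = x + z := by
  have h2 : Real.sin (Real.pi * y - Real.pi * x) = 0 := by
    rw [Real.sin_sub, ← h0, ← h1]
    ring
  obtain ⟨z, hz⟩ := Real.sin_eq_zero_iff.1 h2
  refine ⟨z, ?_⟩
  have := Real.pi_ne_zero
  field_simp at hz
  linarith

theorem boundaryPoint_injective : Function.Injective boundaryPoint := by
  intro x y h
  induction x using QuotientAddGroup.induction_on with
  | H x =>
  induction y using QuotientAddGroup.induction_on with
  | H y =>
  change boundaryPoint (x : UnitAddCircle) = boundaryPoint (y : UnitAddCircle) at h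
  rw [boundaryPoint_coe, boundaryPoint_coe, Projectivization.mk_eq_mk_iff'] at h
  obtain ⟨r, hr⟩ := h
  have h0 : r * Real.sin (Real.pi * y) = Real.sin (Real.pi * x) := by simpa using congrFun hr 0
  have h1 : r * Real.cos (Real.pi * y) = Real.cos (Real.pi * x) := by simpa using congrFun hr 1
  obtain ⟨z, h3⟩ := exists_int_of_proportional h0 h1
  change (x : UnitAddCircle) = (y : UnitAddCircle)
  rw [h3]
  have h4 : ((z : ℝ) : UnitAddCircle) = 0 := (AddCircle.coe_eq_zero_iff 1).2 ⟨z, by simp⟩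
  rw [AddCircle.coe_add, h4, add_zero]

theorem boundaryPoint_surjective : Function.Surjective boundaryPoint := by
  intro p
  induction p using Projectivization.ind with
  | h v hv =>
  -- Boundary coordinates are (sin, cos), so the second coordinate is the real part.
  set w : ℂ := ⟨v 1, v 0⟩ with hw
  refine ⟨((w.arg / Real.pi : ℝ) : UnitAddCircle), ?_⟩
  have e : Real.pi * (w.arg / Real.pi) = w.arg := mul_div_cancel₀ _ Real.pi_ne_zero
  rw [boundaryPoint_coe, eq_comm, Projectivization.mk_eq_mk_iff']
  refine ⟨‖w‖, ?_⟩
  rw [e]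
  ext i
  fin_cases i
  · simp [hw]
  · simp [hw]

theorem psl_smul_mk (B : SL(2, ℝ)) {v w : Fin 2 → ℝ} (hv : v ≠ 0) (hw : w ≠ 0) {r : ℝ}
    (h : r • w = B.1 *ᵥ v) :
    (B : Matrix.ProjectiveSpecialLinearGroup (Fin 2) ℝ) • Projectivization.mk ℝ v hv =
      Projectivization.mk ℝ w hw := by
  rw [Matrix.ProjectiveSpecialLinearGroup.smul_proj_mk, Projectivization.smul_mk,
    Projectivization.mk_eq_mk_iff']
  exact ⟨r, h⟩

theorem psl_smul_mk_eq_iff (B : SL(2, ℝ)) {v w : Fin 2 → ℝ} (hv : v ≠ 0) (hw : w ≠ 0) :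
    (B : Matrix.ProjectiveSpecialLinearGroup (Fin 2) ℝ) • Projectivization.mk ℝ v hv =
      Projectivization.mk ℝ w hw ↔ ∃ r : ℝ, r • w = B.1 *ᵥ v := by
  rw [Matrix.ProjectiveSpecialLinearGroup.smul_proj_mk, Projectivization.smul_mk,
    Projectivization.mk_eq_mk_iff']
  rfl

/-- An element of `PSL(2, ℝ)` that fixes three boundary points is trivial. -/
theorem psl_eq_one_of_fixed {A : Matrix.ProjectiveSpecialLinearGroup (Fin 2) ℝ}
    {p q r : ℙ ℝ (Fin 2 → ℝ)} (hpq : p ≠ q) (hqr : q ≠ r) (hpr : p ≠ r) (hp : A • p = p)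
    (hq : A • q = q) (hr : A • r = r) : A = 1 := by
  obtain ⟨B, rfl⟩ := QuotientGroup.mk_surjective A
  induction p using Projectivization.ind with
  | h u hu =>
  induction q using Projectivization.ind with
  | h v hv =>
  induction r using Projectivization.ind with
  | h w hw =>
  have ndet : ∀ {u v : Fin 2 → ℝ} (hu : u ≠ 0) (hv : v ≠ 0),
      Projectivization.mk ℝ u hu ≠ Projectivization.mk ℝ v hv → u 0 * v 1 - u 1 * v 0 ≠ 0 := by
    intro u v hu hv h h0
    apply h
    rw [Projectivization.mk_eq_mk_iff']
    by_cases hv0 : v 0 = 0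
    · have hv1 : v 1 ≠ 0 := fun h1 => hv (by ext i; fin_cases i <;> assumption)
      refine ⟨u 1 / v 1, ?_⟩
      ext i
      fin_cases i
      · have : u 0 = 0 := by
          have : u 0 * v 1 = 0 := by rw [hv0] at h0; linarith
          simpa [hv1] using this
        simp [hv0, this]
      · simp [hv1]
    · refine ⟨u 0 / v 0, ?_⟩
      ext i
      fin_cases i
      · simp [hv0]
      · simp only [Fin.mk_one, Pi.smul_apply, smul_eq_mul]
        field_simp
        linarith
  have d1 := ndet hu hv hpq
  have d2 := ndet hv hw hqr
  have d3 := ndet hu hw hpr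
  obtain ⟨a, ha⟩ := (psl_smul_mk_eq_iff B hu hu).1 hp
  obtain ⟨b, hb⟩ := (psl_smul_mk_eq_iff B hv hv).1 hq
  obtain ⟨c, hc⟩ := (psl_smul_mk_eq_iff B hw hw).1 hr
  have ex : ∀ {u : Fin 2 → ℝ} {a : ℝ}, a • u = B.1 *ᵥ u →
      a * u 0 = B.1 0 0 * u 0 + B.1 0 1 * u 1 ∧ a * u 1 = B.1 1 0 * u 0 + B.1 1 1 * u 1 := by
    intro u a h
    have h0 := congrFun h 0
    have h1 := congrFun h 1
    simp only [Pi.smul_apply, smul_eq_mul, Matrix.mulVec, dotProduct, Fin.sum_univ_two] at h0 h1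
    exact ⟨h0, h1⟩
  obtain ⟨a0, a1⟩ := ex ha
  obtain ⟨b0, b1⟩ := ex hb
  obtain ⟨c0, c1⟩ := ex hc
  -- Apply B to the linear relation among the eigenvectors u, v, w. All its coefficients are
  -- nonzero, so the three eigenvalues agree and B is scalar.
  have x0 : (u 0 * v 1 - u 1 * v 0) * (c * w 0) - (w 0 * v 1 - w 1 * v 0) * (a * u 0) -
      (u 0 * w 1 - u 1 * w 0) * (b * v 0) = 0 := by
    linear_combination (u 0 * v 1 - u 1 * v 0) * c0 - (w 0 * v 1 - w 1 * v 0) * a0 -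
      (u 0 * w 1 - u 1 * w 0) * b0
  have x1 : (u 0 * v 1 - u 1 * v 0) * (c * w 1) - (w 0 * v 1 - w 1 * v 0) * (a * u 1) -
      (u 0 * w 1 - u 1 * w 0) * (b * v 1) = 0 := by
    linear_combination (u 0 * v 1 - u 1 * v 0) * c1 - (w 0 * v 1 - w 1 * v 0) * a1 -
      (u 0 * w 1 - u 1 * w 0) * b1
  have hac : c = a := by
    have : (c - a) * ((v 0 * w 1 - v 1 * w 0) * (u 0 * v 1 - u 1 * v 0)) = 0 := by
      linear_combination v 0 * x1 - v 1 * x0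
    simpa [sub_eq_zero, d1, d2] using this
  have hbc : c = b := by
    have : (c - b) * ((u 0 * w 1 - u 1 * w 0) * (u 0 * v 1 - u 1 * v 0)) = 0 := by
      linear_combination u 0 * x1 - u 1 * x0
    simpa [sub_eq_zero, d1, d3] using this
  subst hac hbc
  refine eq_of_smul_eq_smul fun p : ℙ ℝ (Fin 2 → ℝ) => ?_
  rw [one_smul]
  induction p using Projectivization.ind with
  | h x hx =>
  refine psl_smul_mk B hx hx (r := c) ?_
  ext i
  refine mul_left_cancel₀ d1 ?_
  fin_cases i
  · simp only [Pi.smul_apply, smul_eq_mul, Matrix.mulVec, dotProduct, Fin.sum_univ_two, Fin.zero_eta]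
    linear_combination (x 0 * v 1 - x 1 * v 0) * a0 + (u 0 * x 1 - u 1 * x 0) * b0
  · simp only [Pi.smul_apply, smul_eq_mul, Matrix.mulVec, dotProduct, Fin.sum_univ_two, Fin.mk_one]
    linear_combination (x 0 * v 1 - x 1 * v 0) * a1 + (u 0 * x 1 - u 1 * x 0) * b1

/-- The group of circle homeomorphisms that are induced by elements of `PSL(2, ℝ)`. -/
def mobius : Subgroup HomeoPlus where
  carrier := {h | ∃ A : Matrix.ProjectiveSpecialLinearGroup (Fin 2) ℝ,
    ∀ x, boundaryPoint (h.1 x) = A • boundaryPoint x}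
  mul_mem' := by
    rintro f g ⟨A, hA⟩ ⟨B, hB⟩
    exact ⟨A * B, fun x => by rw [mul_smul, ← hB, ← hA]; rfl⟩
  one_mem' := ⟨1, fun x => by rw [one_smul]; rfl⟩
  inv_mem' := by
    rintro f ⟨A, hA⟩
    refine ⟨A⁻¹, fun x => ?_⟩
    rw [eq_inv_smul_iff, ← hA]
    exact congrArg _ (f.1.apply_symm_apply x)

theorem mobius_eq_one_of_fixed {h : HomeoPlus} (hh : h ∈ mobius) {p q r : UnitAddCircle}
    (hpq : p ≠ q) (hqr : q ≠ r) (hpr : p ≠ r) (hp : h.1 p = p) (hq : h.1 q = q) (hr : h.1 r = r) :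
    h = 1 := by
  obtain ⟨A, hA⟩ := hh
  have := psl_eq_one_of_fixed (boundaryPoint_injective.ne hpq) (boundaryPoint_injective.ne hqr)
    (boundaryPoint_injective.ne hpr) (by rw [← hA, hp]) (by rw [← hA, hq]) (by rw [← hA, hr])
  refine Subtype.ext (Homeomorph.ext fun x => boundaryPoint_injective ?_)
  rw [hA, this, one_smul]
  rfl

/-- A homomorphism to the Möbius group lifts to `PSL(2, ℝ)`. -/
theorem exists_psl_hom {G : Type*} [Group G] (ρ : G →* HomeoPlus) (h : ∀ g, ρ g ∈ mobius) :
    ∃ A : G →* Matrix.ProjectiveSpecialLinearGroup (Fin 2) ℝ,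
      ∀ g x, boundaryPoint ((ρ g).1 x) = A g • boundaryPoint x := by
  choose A hA using h
  -- `PSL(2, ℝ)` acts faithfully on the boundary, so the chosen elements are unique and hence
  -- multiplicative.
  have hext : ∀ B C : Matrix.ProjectiveSpecialLinearGroup (Fin 2) ℝ,
      (∀ x, B • boundaryPoint x = C • boundaryPoint x) → B = C := fun B C hBC =>
    eq_of_smul_eq_smul fun p : ℙ ℝ (Fin 2 → ℝ) => by
      obtain ⟨x, rfl⟩ := boundaryPoint_surjective p
      exact hBC x
  refine ⟨⟨⟨A, hext _ _ fun x => ?_⟩, fun g g' => hext _ _ fun x => ?_⟩, hA⟩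
  · rw [← hA, map_one, one_smul]
    rfl
  · rw [← hA, mul_smul, ← hA, ← hA, map_mul]
    rfl

/-! ### Hyperbolic and elliptic lifts -/

/-- The lift of the action of `diag(√l, 1/√l)` that fixes `0`, on the line of period one. -/
def stretch (l t : ℝ) : ℝ :=
  t + Real.arctan ((l - 1) * Real.sin (Real.pi * t) * Real.cos (Real.pi * t) /
    (Real.cos (Real.pi * t) ^ 2 + l * Real.sin (Real.pi * t) ^ 2)) / Real.pi

theorem stretch_denom_pos {l : ℝ} (hl : 0 < l) (x : ℝ) :
    0 < Real.cos x ^ 2 + l * Real.sin x ^ 2 := by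
  have := Real.sin_sq_add_cos_sq x
  rcases (sq_nonneg (Real.cos x)).eq_or_lt with h | h
  · rw [← h] at this ⊢
    nlinarith
  · have := sq_nonneg (Real.sin x)
    positivity

/-- The arctangent in `stretch` is the angle from (sin, cos) to (l·sin, cos), so the addition
formulas give the direction of the second vector exactly. -/
theorem exists_stretch {l : ℝ} (hl : 0 < l) (t : ℝ) : ∃ r : ℝ, 0 < r ∧
    r * Real.sin (Real.pi * stretch l t) = l * Real.sin (Real.pi * t) ∧
      r * Real.cos (Real.pi * stretch l t) = Real.cos (Real.pi * t) := by
  have hq := stretch_denom_pos hl (Real.pi * t)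
  have hs := Real.sin_sq_add_cos_sq (Real.pi * t)
  rw [stretch, mul_add, mul_div_cancel₀ _ Real.pi_ne_zero, Real.sin_add, Real.cos_add]
  generalize Real.sin (Real.pi * t) = s at *
  generalize Real.cos (Real.pi * t) = c at *
  set g := (l - 1) * s * c / (c ^ 2 + l * s ^ 2) with hg
  have h1 := Real.cos_arctan_pos g
  have h2 : Real.sin (Real.arctan g) = g * Real.cos (Real.arctan g) := by
    rw [← Real.tan_mul_cos h1.ne', Real.tan_arctan]
  rw [h2]
  refine ⟨(c ^ 2 + l * s ^ 2) / Real.cos (Real.arctan g), by positivity, ?_, ?_⟩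
  · rw [hg]
    field_simp
    linear_combination l * s * hs
  · rw [hg]
    field_simp
    linear_combination c * hs

theorem stretch_add_one (l t : ℝ) : stretch l (t + 1) = stretch l t + 1 := by
  have : Real.pi * (t + 1) = Real.pi * t + Real.pi := by ring
  simp only [stretch, this, Real.sin_add_pi, Real.cos_add_pi]
  ring_nf

theorem stretch_zero (l : ℝ) : stretch l 0 = 0 := by simp [stretch]

theorem stretch_neg (l t : ℝ) : stretch l (-t) = -stretch l t := by
  simp only [stretch, mul_neg, Real.sin_neg, Real.cos_neg, neg_sq, neg_mul, neg_div, Real.arctan_neg]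
  ring

theorem stretch_continuous {l : ℝ} (hl : 0 < l) : Continuous (stretch l) := by
  unfold stretch
  refine continuous_id.add (Continuous.div_const (Real.continuous_arctan.comp ?_) _)
  exact Continuous.div (by fun_prop) (by fun_prop) fun t => (stretch_denom_pos hl _).ne'

theorem stretch_add_int (l t : ℝ) (z : ℤ) : stretch l (t + z) = stretch l t + z := by
  induction z using Int.induction_on with
  | zero => simp
  | succ i ih =>
    push_cast at ih ⊢
    rw [← add_assoc, stretch_add_one, ih]
    ring
  | pred i ih =>
    push_cast at ih ⊢
    have := stretch_add_one l (t + (-i - 1))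
    rw [show t + (-(i : ℝ) - 1) + 1 = t + -i by ring, ih] at this
    linarith

theorem stretch_injective {l : ℝ} (hl : 0 < l) : Function.Injective (stretch l) := by
  intro t t' h
  obtain ⟨r, hr, h1, h2⟩ := exists_stretch hl t
  obtain ⟨r', hr', h1', h2'⟩ := exists_stretch hl t'
  rw [h] at h1 h2
  obtain ⟨z, hz⟩ := exists_int_of_proportional (x := t) (y := t') (r := r / r') (by
    field_simp
    refine mul_left_cancel₀ hl.ne' ?_
    linear_combination r' * h1 - r * h1') (by
    field_simp
    linear_combination r' * h2 - r * h2')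
  rw [hz, stretch_add_int] at h
  rw [hz]
  linarith

theorem stretch_strictMono {l : ℝ} (hl : 0 < l) : StrictMono (stretch l) := by
  rcases (stretch_continuous hl).strictMono_of_inj (stretch_injective hl) with h | h
  · exact h
  · have h1 := h (show (0 : ℝ) < 0 + 1 by norm_num)
    rw [stretch_add_one] at h1
    linarith

theorem stretch_surjective {l : ℝ} (hl : 0 < l) : Function.Surjective (stretch l) := by
  have hb : ∀ t, t - 1 ≤ stretch l t ∧ stretch l t ≤ t + 1 := by
    intro t
    have h1 := (stretch_strictMono hl).monotone (Int.floor_le t)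
    have h2 := (stretch_strictMono hl).monotone (Int.lt_floor_add_one t).le
    have h3 := stretch_add_int l 0 ⌊t⌋
    rw [zero_add, stretch_zero, zero_add] at h3
    rw [stretch_add_one, h3] at h2
    rw [h3] at h1
    have := Int.floor_le t
    have := Int.lt_floor_add_one t
    constructor <;> linarith
  refine (stretch_continuous hl).surjective ?_ ?_
  · exact Filter.tendsto_atTop_mono (fun t => (hb t).1) (Filter.tendsto_atTop_add_const_right _ (-1) Filter.tendsto_id)
  · exact Filter.tendsto_atBot_mono (fun t => (hb t).2) (Filter.tendsto_atBot_add_const_right _ 1 Filter.tendsto_id)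

namespace LineLift

variable {N : ℕ} [NeZero N]

/-- A lift acts by a Möbius transformation as soon as it does so on boundary vectors. -/
theorem toCircle_mem_mobius {f : LineLift N} (B : SL(2, ℝ))
    (h : ∀ x, ∃ r : ℝ, r • ![Real.sin (Real.pi * (f.1 x / N)), Real.cos (Real.pi * (f.1 x / N))] =
      B.1 *ᵥ ![Real.sin (Real.pi * (x / N)), Real.cos (Real.pi * (x / N))]) :
    toCircle 1 f ∈ mobius := by
  refine ⟨(B : Matrix.ProjectiveSpecialLinearGroup (Fin 2) ℝ), fun p => ?_⟩
  obtain ⟨x, rfl⟩ := circlePt_surjective (period_pos N 1) p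
  rw [toCircle_circlePt]
  simp only [circlePt, Nat.cast_one, mul_one]
  rw [boundaryPoint_coe, boundaryPoint_coe]
  obtain ⟨r, hr⟩ := h x
  exact (psl_smul_mk B _ _ hr).symm

theorem toCircle_translate_mem_mobius (a : ℝ) : toCircle 1 (translate N a) ∈ mobius := by
  refine toCircle_mem_mobius ⟨!![Real.cos (Real.pi * (a / N)), Real.sin (Real.pi * (a / N));
    -Real.sin (Real.pi * (a / N)), Real.cos (Real.pi * (a / N))], ?_⟩ fun x => ⟨1, ?_⟩
  · rw [Matrix.det_fin_two_of]
    linear_combination Real.sin_sq_add_cos_sq (Real.pi * (a / N))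
  · have : Real.pi * ((translate N a).1 x / N) = Real.pi * (x / N) + Real.pi * (a / N) := by
      rw [translate_apply]
      ring
    rw [this, Real.sin_add, Real.cos_add]
    ext i
    fin_cases i
    · simp only [Fin.zero_eta, Pi.smul_apply, smul_eq_mul, Matrix.mulVec, dotProduct,
        Fin.sum_univ_two, Matrix.cons_val_zero, Matrix.cons_val_one, Matrix.of_apply]
      ring
    · simp only [Fin.mk_one, Pi.smul_apply, smul_eq_mul, Matrix.mulVec, dotProduct,
        Fin.sum_univ_two, Matrix.cons_val_zero, Matrix.cons_val_one, Matrix.of_apply]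
      ring

/-- The stretch as a lift of period `N`. -/
def stretchLift (N : ℕ) [NeZero N] {l : ℝ} (hl : 0 < l) : LineLift N :=
  have hN : (0 : ℝ) < N := by exact_mod_cast Nat.pos_of_ne_zero (NeZero.ne N)
  ⟨Equiv.ofBijective (fun x => N * stretch l (x / N))
    ⟨fun x y h => by
      have := stretch_injective hl (mul_left_cancel₀ hN.ne' h)
      field_simp at this
      exact this,
    fun y => by
      obtain ⟨t, ht⟩ := stretch_surjective hl (y / N)
      refine ⟨N * t, ?_⟩
      beta_reduce
      rw [mul_div_cancel_left₀ _ hN.ne', ht]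
      field_simp⟩,
    fun x y h => by
      have := stretch_strictMono hl (div_lt_div_of_pos_right h hN)
      exact mul_lt_mul_of_pos_left this hN,
    fun x => by
      change N * stretch l ((x + N) / N) = N * stretch l (x / N) + N
      rw [add_div, div_self hN.ne', stretch_add_one]
      ring⟩

theorem stretchLift_apply {l : ℝ} (hl : 0 < l) (x : ℝ) :
    (stretchLift N hl).1 x = N * stretch l (x / N) := rfl

theorem toCircle_stretchLift_mem_mobius {l : ℝ} (hl : 0 < l) :
    toCircle 1 (stretchLift N hl) ∈ mobius := by
  have hN : (N : ℝ) ≠ 0 := by exact_mod_cast NeZero.ne N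
  have h1 : 0 < √l := Real.sqrt_pos.2 hl
  refine toCircle_mem_mobius ⟨!![√l, 0; 0, (√l)⁻¹], ?_⟩ fun x => ?_
  · rw [Matrix.det_fin_two_of]
    field_simp
    simp
  · obtain ⟨r, -, h2, h3⟩ := exists_stretch hl (x / N)
    refine ⟨r / √l, ?_⟩
    rw [stretchLift_apply, mul_div_cancel_left₀ _ hN]
    ext i
    fin_cases i
    · simp
      field_simp
      rw [h2, Real.sq_sqrt hl.le, mul_div_assoc]
    · simp
      field_simp
      rw [h3, mul_div_assoc]

/-- Möbius transformations act transitively on pairs of points of the circle. -/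
theorem exists_mobius_apply_eq {p q p' q' : ℝ} (h1 : p < q) (h2 : q < p + N) (h1' : p' < q')
    (h2' : q' < p' + N) :
    ∃ F : LineLift N, toCircle 1 F ∈ mobius ∧ F.1 p = p' ∧ F.1 q = q' := by
  have hN : (0 : ℝ) < N := by exact_mod_cast Nat.pos_of_ne_zero (NeZero.ne N)
  set w := (q - p) / 2 / N with hw
  set w' := (q' - p') / 2 / N with hw'
  have b1 : 0 < w := by
    have : 0 < q - p := by linarith
    positivity
  have b2 : w < 1 / 2 := by
    rw [hw, div_div, div_lt_div_iff₀ (by positivity) (by positivity)]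
    linarith
  have b1' : 0 < w' := by
    have : 0 < q' - p' := by linarith
    positivity
  have b2' : w' < 1 / 2 := by
    rw [hw', div_div, div_lt_div_iff₀ (by positivity) (by positivity)]
    linarith
  have hpi := Real.pi_pos
  have hs : 0 < Real.sin (Real.pi * w) := Real.sin_pos_of_pos_of_lt_pi (by positivity) (by nlinarith)
  have hs' : 0 < Real.sin (Real.pi * w') := Real.sin_pos_of_pos_of_lt_pi (by positivity) (by nlinarith)
  have hc : 0 < Real.cos (Real.pi * w) :=
    Real.cos_pos_of_mem_Ioo ⟨by nlinarith, by nlinarith⟩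
  have hc' : 0 < Real.cos (Real.pi * w') :=
    Real.cos_pos_of_mem_Ioo ⟨by nlinarith, by nlinarith⟩
  -- This is tan(πw') / tan(πw): with both intervals centred at 0, it stretches the half-width w to
  -- w'.
  set l := Real.sin (Real.pi * w') * Real.cos (Real.pi * w) /
    (Real.cos (Real.pi * w') * Real.sin (Real.pi * w)) with hl
  have hl0 : 0 < l := by positivity
  have key : stretch l w = w' := by
    obtain ⟨r, hr, e1, e2⟩ := exists_stretch hl0 w
    obtain ⟨z, hz⟩ := exists_int_of_proportional (x := w') (y := stretch l w)
      (r := r * Real.cos (Real.pi * w') / Real.cos (Real.pi * w)) (by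
        rw [hl] at e1
        field_simp at e1 ⊢
        linear_combination e1) (by
        field_simp
        linear_combination e2)
    have m1 := stretch_strictMono hl0 b1
    have m2 := stretch_strictMono hl0 (show w < 0 + 1 by linarith)
    rw [stretch_add_one, stretch_zero] at m2
    rw [stretch_zero] at m1
    have z1 : (z : ℝ) < (1 : ℤ) := by push_cast; linarith
    have z2 : ((-1 : ℤ) : ℝ) < z := by push_cast; linarith
    have := Int.cast_lt.1 z1
    have := Int.cast_lt.1 z2
    have : z = 0 := by omega
    rw [hz, this]
    simp
  refine ⟨translate N ((p' + q') / 2) * stretchLift N hl0 * translate N (-((p + q) / 2)), ?_, ?_, ?_⟩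
  · rw [map_mul, map_mul]
    exact mul_mem (mul_mem (toCircle_translate_mem_mobius _) (toCircle_stretchLift_mem_mobius hl0))
      (toCircle_translate_mem_mobius _)
  · rw [mul_apply, mul_apply, translate_apply, translate_apply, stretchLift_apply,
      show (p + -((p + q) / 2)) / N = -w by rw [hw]; ring, stretch_neg, key, hw']
    field_simp
    ring
  · rw [mul_apply, mul_apply, translate_apply, translate_apply, stretchLift_apply,
      show (q + -((p + q) / 2)) / N = w by rw [hw]; ring, key, hw']
    field_simp
    ring

/-- A Möbius lift of order `m` modulo the period that maps the complement of the arcs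
`[i + 1/4, i + 3/4]` into them. -/
theorem exists_elliptic {m : ℕ} (hm : 2 ≤ m) (i : ℤ) :
    ∃ f : LineLift N, toCircle 1 f ∈ mobius ∧ f ^ m = translate N N ∧
      f.1 (i - N + 3 / 4) = i + 1 / 4 ∧ ∀ j, 0 < j → j < m →
        i + 1 / 4 ≤ (f ^ j).1 (i - N + 3 / 4) ∧ (f ^ j).1 (i + 1 / 4) ≤ i + 3 / 4 := by
  have hN : (1 : ℝ) ≤ N := by exact_mod_cast Nat.pos_of_ne_zero (NeZero.ne N)
  have hm' : (2 : ℝ) ≤ m := by exact_mod_cast hm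
  -- F takes [0, N/m] to the complement of the arc. Conjugating translation by N/m with F gives a
  -- map whose first m powers tile one period with the images of that complement.
  obtain ⟨F, hF, h1, h2⟩ := exists_mobius_apply_eq (N := N) (p := 0) (q := N / m)
    (p' := i - N + 3 / 4) (q' := i + 1 / 4) (by positivity)
    (by rw [zero_add]; exact div_lt_self (by linarith) (by linarith)) (by linarith) (by linarith)
  have hpow : ∀ j : ℕ, (F * translate N (N / m) * F⁻¹) ^ j = F * translate N (j * (N / m)) * F⁻¹ :=
    fun j => by rw [conj_pow, translate_pow]
  have hmN : (m : ℝ) * (N / m) = N := by field_simp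
  have hap : ∀ a : ℝ, (F * translate N a * F⁻¹).1 (i - N + 3 / 4) = F.1 a := fun a => by
    rw [mul_apply, mul_apply, ← h1, inv_apply_self, translate_apply, zero_add]
  have hap' : ∀ a : ℝ, (F * translate N a * F⁻¹).1 (i + 1 / 4) = F.1 (N / m + a) := fun a => by
    rw [mul_apply, mul_apply, ← h2, inv_apply_self, translate_apply]
  refine ⟨F * translate N (N / m) * F⁻¹, ?_, ?_, ?_, fun j hj hjm => ?_⟩
  · rw [map_mul, map_mul, map_inv]
    exact mul_mem (mul_mem hF (toCircle_translate_mem_mobius _)) (inv_mem hF)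
  · have := translate_period_commute F 1
    rw [Int.cast_one, one_mul] at this
    rw [hpow, hmN, this]
    simp
  · rw [hap, h2]
  · rw [hpow, hap, hap']
    have hpos : (0 : ℝ) < N / m := by positivity
    constructor
    · rw [← h2, F.le_iff]
      have : (1 : ℝ) ≤ j := by exact_mod_cast hj
      nlinarith
    · have e := F.apply_add_int 0 1
      rw [Int.cast_one, one_mul, h1] at e
      rw [show (i : ℝ) + 3 / 4 = i - N + 3 / 4 + N by ring, ← e, F.le_iff, zero_add]
      have : (j : ℝ) + 1 ≤ m := by exact_mod_cast hjm
      nlinarith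

end LineLift

end

/-! ### Free products of cyclic groups -/

noncomputable section

/-- The homomorphism from the cyclic group of order `m` that sends the generator to `y`. -/
def zmodLift {X : Type*} [Group X] {m : ℕ} (y : X) (hy : y ^ m = 1) :
    Multiplicative (ZMod m) →* X :=
  AddMonoidHom.toMultiplicativeLeft (ZMod.lift m ⟨zmultiplesHom (Additive X) (Additive.ofMul y), by
    simp [← ofMul_pow, hy]⟩)

theorem zmodLift_ofAdd_one {X : Type*} [Group X] {m : ℕ} (y : X) (hy : y ^ m = 1) :
    zmodLift y hy (Multiplicative.ofAdd 1) = y := by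
  have := ZMod.lift_coe m (⟨zmultiplesHom (Additive X) (Additive.ofMul y), by
    simp [← ofMul_pow, hy]⟩ : { f : ℤ →+ Additive X // f m = 0 }) 1
  rw [Int.cast_one] at this
  simp [zmodLift, this]

namespace CyclicFreeProduct

open LineLift

variable {n k : ℕ} {m : Fin k → ℕ}

section Hom

variable {X : Type*} [Group X] (x : Fin (2 * n) → X) (y : Fin k → X) (hy : ∀ i, y i ^ m i = 1)

/-- The universal property of the free product. -/
def homOf : CyclicFreeProduct n m →* X :=
  Monoid.Coprod.lift (FreeGroup.lift x) (Monoid.CoprodI.lift fun i => zmodLift (y i) (hy i))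

theorem homOf_e (i : Fin k) : homOf x y hy (e n m i) = y i := by
  have : homOf x y hy (e n m i) = zmodLift (y i) (hy i) (Multiplicative.ofAdd 1) := by
    simp only [homOf, e]
    erw [Monoid.Coprod.lift_apply_inr]
  rw [this, zmodLift_ofAdd_one]

theorem homOf_h (j : Fin (2 * n)) : homOf x y hy (h n m j) = x j := by
  simp only [homOf, h]
  erw [Monoid.Coprod.lift_apply_inl]
  simp

end Hom

theorem e_pow (i : Fin k) : e n m i ^ m i = 1 := by
  simp only [e]
  erw [← map_pow, ← map_pow]
  rw [← ofAdd_nsmul]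
  simp only [nsmul_eq_mul, CharP.cast_eq_zero, mul_one, ofAdd_zero, map_one]
  exact map_one Monoid.Coprod.inr

/-- The nontrivial powers of the torsion generators, and the free generators and their inverses. -/
abbrev Letter (n : ℕ) {k : ℕ} (m : Fin k → ℕ) : Type :=
  (Σ i : Fin k, Fin (m i - 1)) ⊕ (Fin (2 * n) × Bool)

/-- The group element of a letter. -/
def letterVal : Letter n m → CyclicFreeProduct n m
  | .inl ⟨i, j⟩ => e n m i ^ (j.1 + 1)
  | .inr (j, true) => h n m j
  | .inr (j, false) => (h n m j)⁻¹

theorem e_pow_eq (hm : ∀ i, 2 ≤ m i) (i : Fin k) (a : ℕ) :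
    e n m i ^ a = 1 ∨ ∃ j : Fin (m i - 1), e n m i ^ a = letterVal (.inl ⟨i, j⟩) := by
  have h1 : e n m i ^ a = e n m i ^ (a % m i) := pow_eq_pow_mod a (e_pow i)
  have h2 := Nat.mod_lt a (show 0 < m i by have := hm i; omega)
  rw [h1]
  rcases Nat.eq_zero_or_pos (a % m i) with h3 | h3
  · left
    rw [h3, pow_zero]
  · right
    refine ⟨⟨a % m i - 1, by omega⟩, ?_⟩
    simp only [letterVal]
    congr 1
    omega

theorem exists_word (hm : ∀ i, 2 ≤ m i) (g : CyclicFreeProduct n m) :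
    ∃ w : List (Letter n m), (w.map letterVal).prod = g := by
  have hone : ∃ w : List (Letter n m), (w.map letterVal).prod = 1 := ⟨[], rfl⟩
  have hmul : ∀ a b : CyclicFreeProduct n m, (∃ w : List (Letter n m), (w.map letterVal).prod = a) →
      (∃ w : List (Letter n m), (w.map letterVal).prod = b) →
      ∃ w : List (Letter n m), (w.map letterVal).prod = a * b := by
    rintro _ _ ⟨w, rfl⟩ ⟨w', rfl⟩
    exact ⟨w ++ w', by simp⟩
  have hlet : ∀ s : Letter n m, ∃ w : List (Letter n m), (w.map letterVal).prod = letterVal s :=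
    fun s => ⟨[s], by simp⟩
  refine Monoid.Coprod.induction_on
    (motive := fun g => ∃ w : List (Letter n m), (w.map letterVal).prod = (g : CyclicFreeProduct n m))
    g (fun a => ?_) (fun b => ?_) hmul
  · induction a using FreeGroup.induction_on with
    | C1 =>
      rw [map_one]
      exact hone
    | of j => exact hlet (.inr (j, true))
    | inv_of j _ =>
      rw [map_inv]
      exact hlet (.inr (j, false))
    | mul a b ha hb =>
      rw [map_mul]
      exact hmul _ _ ha hb
  · induction b using Monoid.CoprodI.induction_on with
    | one =>
      rw [map_one]
      exact hone
    | of i a =>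
      have : NeZero (m i) := ⟨by have := hm i; omega⟩
      have h1 : a = Multiplicative.ofAdd (1 : ZMod (m i)) ^ (a.toAdd : ZMod (m i)).val := by
        rw [← ofAdd_nsmul]
        simp
      rw [h1, map_pow, map_pow]
      rcases e_pow_eq (n := n) hm i (a.toAdd : ZMod (m i)).val with h2 | ⟨j, h2⟩
      · exact h2 ▸ hone
      · exact h2 ▸ hlet _
    | mul a b ha hb =>
      rw [map_mul]
      exact hmul _ _ ha hb

end CyclicFreeProduct

end

/-! ### The ping-pong lifts of the generators -/

noncomputable section

namespace CyclicFreeProduct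

open LineLift

/-- The number of arcs. -/
def arcs (n k : ℕ) : ℕ := k + 4 * n

instance (n k : ℕ) [NeZero k] : NeZero (arcs n k) := ⟨by have := NeZero.ne k; unfold arcs; omega⟩

/-- The arc of `h_j`. -/
def posArc {n : ℕ} (k : ℕ) (j : Fin (2 * n)) : ℕ := k + 4 * (j.1 / 2) + 3 * (j.1 % 2)

/-- The arc of `h_j⁻¹`. -/
def negArc {n : ℕ} (k : ℕ) (j : Fin (2 * n)) : ℕ := k + 4 * (j.1 / 2) + 2 - j.1 % 2

/-- The translate of the arc of `h_j` that lies between two consecutive translates of the arc of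
`h_j⁻¹`. -/
def posArcLift {n : ℕ} (k : ℕ) (j : Fin (2 * n)) : ℤ :=
  posArc k j + (1 - (j.1 % 2 : ℕ)) * (arcs n k : ℕ)

theorem posArc_lt {n k : ℕ} (j : Fin (2 * n)) : posArc k j < arcs n k := by
  have := j.2
  unfold posArc arcs
  omega

theorem negArc_lt {n k : ℕ} (j : Fin (2 * n)) : negArc k j < arcs n k := by
  have := j.2
  unfold negArc arcs
  omega

theorem negArc_lt_posArcLift {n k : ℕ} (j : Fin (2 * n)) :
    (negArc k j : ℤ) < posArcLift k j ∧ posArcLift k j < negArc k j + (arcs n k : ℕ) := by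
  have := j.2
  unfold negArc posArcLift posArc
  rcases Nat.mod_two_eq_zero_or_one j.1 with h | h <;> rw [h] <;> unfold arcs <;> push_cast <;>
    constructor <;> omega

theorem posArc_ne_negArc {n k : ℕ} (j j' : Fin (2 * n)) : posArc k j ≠ negArc k j' := by
  unfold posArc negArc
  rcases Nat.mod_two_eq_zero_or_one j.1 with h | h <;>
    rcases Nat.mod_two_eq_zero_or_one j'.1 with h' | h' <;> rw [h, h'] <;> omega

theorem posArc_injective {n k : ℕ} : Function.Injective (posArc (n := n) k) := by
  intro j j' hj
  unfold posArc at hj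
  refine Fin.ext ?_
  rcases Nat.mod_two_eq_zero_or_one j.1 with h | h <;>
    rcases Nat.mod_two_eq_zero_or_one j'.1 with h' | h' <;> rw [h, h'] at hj <;> omega

theorem negArc_injective {n k : ℕ} : Function.Injective (negArc (n := n) k) := by
  intro j j' hj
  unfold negArc at hj
  refine Fin.ext ?_
  rcases Nat.mod_two_eq_zero_or_one j.1 with h | h <;>
    rcases Nat.mod_two_eq_zero_or_one j'.1 with h' | h' <;> rw [h, h'] at hj <;> omega

theorem le_posArc {n k : ℕ} (j : Fin (2 * n)) : k ≤ posArc k j := by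
  unfold posArc
  omega

theorem le_negArc {n k : ℕ} (j : Fin (2 * n)) : k ≤ negArc k j := by
  unfold negArc
  omega

/-- Möbius lifts of the generators that play ping-pong with the arcs `[j + 1/4, j + 3/4]`. -/
structure GeneratorLifts (n : ℕ) {k : ℕ} [NeZero k] (m : Fin k → ℕ) where
  E : Fin k → LineLift (arcs n k)
  H : Fin (2 * n) → LineLift (arcs n k)
  E_mem : ∀ i, toCircle 1 (E i) ∈ mobius
  H_mem : ∀ j, toCircle 1 (H j) ∈ mobius
  E_pow : ∀ i, E i ^ m i = translate _ (arcs n k)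
  E_apply : ∀ i : Fin k, (E i).1 ((i : ℕ) - (arcs n k : ℕ) + 3 / 4) = (i : ℕ) + 1 / 4
  le_E : ∀ (i : Fin k) (j : ℕ), 0 < j → j < m i →
    ((i : ℕ) : ℝ) + 1 / 4 ≤ (E i ^ j).1 ((i : ℕ) - (arcs n k : ℕ) + 3 / 4)
  E_le : ∀ (i : Fin k) (j : ℕ), 0 < j → j < m i →
    (E i ^ j).1 ((i : ℕ) + 1 / 4) ≤ ((i : ℕ) : ℝ) + 3 / 4
  H_left : ∀ j, (H j).1 (negArc k j + 3 / 4) = posArcLift k j + 1 / 4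
  H_right : ∀ j, (H j).1 (negArc k j + (arcs n k : ℕ) + 1 / 4) = posArcLift k j + 3 / 4

theorem nonempty_generatorLifts {n k : ℕ} [NeZero k] {m : Fin k → ℕ} (hm : ∀ i, 2 ≤ m i) :
    Nonempty (GeneratorLifts n m) := by
  have hN : (1 : ℝ) ≤ (arcs n k : ℕ) := by
    exact_mod_cast Nat.pos_of_ne_zero (NeZero.ne (arcs n k))
  choose E h1 h2 h3 h4 using fun i : Fin k => exists_elliptic (N := arcs n k) (hm i) ((i : ℕ) : ℤ)
  choose H h5 h6 h7 using fun j : Fin (2 * n) => exists_mobius_apply_eq (N := arcs n k)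
    (p := negArc k j + 3 / 4) (q := negArc k j + (arcs n k : ℕ) + 1 / 4)
    (p' := posArcLift k j + 1 / 4) (q' := posArcLift k j + 3 / 4) (by linarith) (by linarith)
    (by linarith) (by linarith)
  exact ⟨⟨E, H, h1, h5, h2, by simpa using h3, fun i j h h' => by simpa using (h4 i j h h').1,
    fun i j h h' => by simpa using (h4 i j h h').2, h6, h7⟩⟩

namespace GeneratorLifts

variable {n k : ℕ} [NeZero k] {m : Fin k → ℕ} (X : GeneratorLifts n m) {d : ℕ} [NeZero d]
  {r : Fin k → ℕ} (hr : ∀ i, m i * r i + 1 = d)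

/-- The lift of the torsion generator for the `d`-fold cover. -/
def coverE (r : Fin k → ℕ) (i : Fin k) : LineLift (arcs n k) :=
  X.E i * translate _ (r i * (arcs n k : ℕ))

theorem coverE_pow (i : Fin k) (j : ℕ) :
    X.coverE r i ^ j = X.E i ^ j * translate _ ((j * r i : ℕ) * (arcs n k : ℕ)) := by
  have h1 := translate_period_commute (X.E i) (r i)
  have hc : Commute (X.E i) (translate (arcs n k) (r i * (arcs n k : ℕ))) := by
    simpa [Commute, SemiconjBy] using h1
  rw [coverE, hc.mul_pow, translate_pow]
  congr 2
  push_cast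
  ring

theorem coverE_pow_apply (i : Fin k) (j : ℕ) (x : ℝ) :
    (X.coverE r i ^ j).1 x = (X.E i ^ j).1 x + (j * r i : ℕ) * (arcs n k : ℕ) := by
  rw [coverE_pow, LineLift.mul_apply, LineLift.translate_apply]
  have := (X.E i ^ j).apply_add_int x (j * r i : ℕ)
  rwa [Int.cast_natCast] at this

-- The m_i r_i extra turns and the one turn of E_i^(m_i) add up to d turns, so the lifted generator
-- has its order dividing m_i on the d-fold cover.
omit [NeZero d] in
include hr in
theorem coverE_pow_order (i : Fin k) :
    X.coverE r i ^ m i = translate _ ((1 : ℤ) * ((arcs n k : ℕ) * d)) := by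
  rw [coverE_pow, X.E_pow, translate_mul]
  congr 1
  rw [← hr i]
  push_cast
  ring

/-- The action on the `d`-fold cover. -/
def rep : CyclicFreeProduct n m →* HomeoPlus :=
  homOf (fun j => toCircle d (X.H j)) (fun i => toCircle d (X.coverE r i)) fun i => by
    rw [← map_pow, X.coverE_pow_order hr, toCircle_translate]

theorem rep_e (i : Fin k) : X.rep hr (e n m i) = toCircle d (X.coverE r i) := homOf_e _ _ _ i

theorem rep_h (j : Fin (2 * n)) : X.rep hr (h n m j) = toCircle d (X.H j) := homOf_h _ _ _ j

/-- The lift of a letter for the `d`-fold cover. -/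
def letterLift (r : Fin k → ℕ) : Letter n m → LineLift (arcs n k)
  | .inl ⟨i, j⟩ => X.coverE r i ^ (j.1 + 1)
  | .inr (j, true) => X.H j
  | .inr (j, false) => (X.H j)⁻¹

theorem toCircle_letterLift (s : Letter n m) :
    toCircle d (X.letterLift r s) = X.rep hr (letterVal s) := by
  match s with
  | .inl ⟨i, j⟩ => simp only [letterLift, letterVal, map_pow, rep_e]
  | .inr (j, true) => simp only [letterLift, letterVal, rep_h]
  | .inr (j, false) => simp only [letterLift, letterVal, map_inv, rep_h]

theorem toCircle_one_coverE (i : Fin k) : toCircle 1 (X.coverE r i) = toCircle 1 (X.E i) := by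
  rw [coverE, map_mul]
  have := toCircle_translate (N := arcs n k) 1 (r i)
  rw [Int.cast_natCast, Nat.cast_one, mul_one] at this
  rw [this, mul_one]

omit [NeZero k] in
theorem zero_order (m : Fin k → ℕ) : ∀ i, m i * (fun _ => 0 : Fin k → ℕ) i + 1 = 1 := fun i => by simp

/-- The action on the circle itself. -/
def baseRep : CyclicFreeProduct n m →* HomeoPlus := X.rep (zero_order m)

theorem toCircle_one_letterLift (s : Letter n m) :
    toCircle 1 (X.letterLift r s) = X.baseRep (letterVal s) := by
  rw [baseRep, ← toCircle_letterLift]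
  match s with
  | .inl ⟨i, j⟩ => simp only [letterLift, map_pow, toCircle_one_coverE]
  | .inr (j, true) => rfl
  | .inr (j, false) => rfl

/-- The extra turns of the torsion letters are multiples of κ, invisible on the base circle. One map
of the line therefore induces both actions. -/
theorem exists_common_lift (hm : ∀ i, 2 ≤ m i) (g : CyclicFreeProduct n m) :
    ∃ f : LineLift (arcs n k), toCircle d f = X.rep hr g ∧ toCircle 1 f = X.baseRep g := by
  obtain ⟨w, rfl⟩ := exists_word hm g
  refine ⟨(w.map (X.letterLift r)).prod, ?_, ?_⟩
  · simp only [map_list_prod, List.map_map]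
    congr 2
    funext s
    exact X.toCircle_letterLift hr s
  · simp only [map_list_prod, List.map_map]
    congr 2
    funext s
    exact X.toCircle_one_letterLift s

theorem toCircle_one_eq (hm : ∀ i, 2 ≤ m i) {g : CyclicFreeProduct n m} {f : LineLift (arcs n k)}
    (hf : toCircle d f = X.rep hr g) : toCircle 1 f = X.baseRep g := by
  obtain ⟨f', h1, h2⟩ := X.exists_common_lift hr hm g
  have h3 : toCircle d (f'⁻¹ * f) = 1 := by rw [map_mul, map_inv, h1, hf, inv_mul_cancel]
  obtain ⟨z, hz⟩ := eq_translate_of_toCircle_eq_one d h3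
  have h4 : f = f' * translate _ ((z * d : ℤ) * ((arcs n k : ℕ) * (1 : ℕ))) := by
    rw [inv_mul_eq_iff_eq_mul] at hz
    rw [hz]
    congr 2
    push_cast
    ring
  rw [h4, map_mul, toCircle_translate, h2, mul_one]

theorem baseRep_mem_mobius (hm : ∀ i, 2 ≤ m i) (g : CyclicFreeProduct n m) :
    X.baseRep g ∈ mobius := by
  obtain ⟨w, rfl⟩ := exists_word hm g
  rw [map_list_prod, List.map_map]
  refine Subgroup.list_prod_mem _ fun x hx => ?_
  obtain ⟨s, -, rfl⟩ := List.mem_map.1 hx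
  simp only [Function.comp_apply, ← X.toCircle_one_letterLift (r := fun _ => 0)]
  match s with
  | .inl ⟨i, j⟩ =>
    simp only [letterLift, map_pow, toCircle_one_coverE]
    exact pow_mem (X.E_mem i) _
  | .inr (j, true) => exact X.H_mem j
  | .inr (j, false) =>
    simp only [letterLift, map_inv]
    exact inv_mem (X.H_mem j)

/-- Three fixed points within one period stay distinct on the base circle, where the action is
Möbius. So f is a translation there, and it has a fixed point. -/
theorem eq_one_of_fixed (hm : ∀ i, 2 ≤ m i) (g : CyclicFreeProduct n m) (f : LineLift (arcs n k))
    (hf : toCircle d f = X.rep hr g) (p q s : ℝ) (hpq : p < q) (hqs : q < s)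
    (hsp : s < p + (arcs n k : ℕ)) (hp : f.1 p = p) (hq : f.1 q = q) (hs : f.1 s = s) : f = 1 := by
  have h1 := X.toCircle_one_eq hr hm hf
  have hN := period_pos (arcs n k) 1
  have hne : ∀ {x y : ℝ}, x < y → y < x + (arcs n k : ℕ) →
      circlePt ((arcs n k : ℕ) * (1 : ℕ)) x ≠ circlePt ((arcs n k : ℕ) * (1 : ℕ)) y := by
    intro x y h h' e
    obtain ⟨z, hz⟩ := (circlePt_eq_iff hN).1 e
    have a1 : ((0 : ℤ) : ℝ) * ((arcs n k : ℕ) * (1 : ℕ)) < z * ((arcs n k : ℕ) * (1 : ℕ)) := by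
      rw [Int.cast_zero, zero_mul]
      linarith
    have a2 : (z : ℝ) * ((arcs n k : ℕ) * (1 : ℕ)) < (1 : ℤ) * ((arcs n k : ℕ) * (1 : ℕ)) := by
      rw [Int.cast_one, one_mul]
      rw [Nat.cast_one, mul_one] at hz ⊢
      linarith
    have a3 := Int.cast_lt.1 ((mul_lt_mul_iff_left₀ hN).1 a1)
    have a4 := Int.cast_lt.1 ((mul_lt_mul_iff_left₀ hN).1 a2)
    omega
  have h2 : toCircle 1 f = 1 := by
    rw [h1]
    refine mobius_eq_one_of_fixed (X.baseRep_mem_mobius hm g)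
      (hne hpq (by linarith)) (hne hqs (by linarith)) (hne (hpq.trans hqs) hsp) ?_ ?_ ?_
    · rw [← h1, toCircle_circlePt, hp]
    · rw [← h1, toCircle_circlePt, hq]
    · rw [← h1, toCircle_circlePt, hs]
  obtain ⟨z, rfl⟩ := eq_translate_of_toCircle_eq_one 1 h2
  rw [LineLift.translate_apply] at hp
  rw [show (z : ℝ) * ((arcs n k : ℕ) * (1 : ℕ)) = 0 by linarith]
  exact LineLift.ext fun x => by simp

/-- The arc into which a letter maps. -/
def letterTarget : Letter n m → ℕ
  | .inl ⟨i, _⟩ => i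
  | .inr (j, true) => posArc k j
  | .inr (j, false) => negArc k j

/-- The arc whose complement is contracted by a letter. -/
def letterSource : Letter n m → ℕ
  | .inl ⟨i, _⟩ => i
  | .inr (j, true) => negArc k j
  | .inr (j, false) => posArc k j

end GeneratorLifts

/-- A lift that contracts the complement of the arcs labelled `b` into the arcs labelled `a`. -/
theorem _root_.LineLift.ping {N : ℕ} [NeZero N] {f : LineLift N} {a b : ℤ}
    (h1 : (a : ℝ) + 1 / 4 ≤ f.1 (b + 3 / 4)) (h2 : f.1 (b + N + 1 / 4) ≤ a + 3 / 4) (i : ℤ)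
    (hi : (i : ZMod N) ≠ b) :
    ∃ j : ℤ, (j : ZMod N) = a ∧ (j : ℝ) + 1 / 4 < f.1 i ∧ f.1 (i + 1) < j + 3 / 4 := by
  have hN : (0 : ℤ) < N := by exact_mod_cast Nat.pos_of_ne_zero (NeZero.ne N)
  set q := (i - b) / N with hq
  set t := (i - b) % N with ht
  have e : i = b + t + q * N := by
    have := Int.emod_add_mul_ediv (i - b) N
    rw [← ht, ← hq] at this
    linarith
  have t1 : 0 < t := by
    refine lt_of_le_of_ne (Int.emod_nonneg _ hN.ne') fun h0 => hi ?_
    rw [e, ← h0]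
    simp
  have t2 : t < N := Int.emod_lt_of_pos _ hN
  have t1' : (1 : ℝ) ≤ t := by exact_mod_cast t1
  have t2' : (t : ℝ) + 1 ≤ N := by exact_mod_cast t2
  refine ⟨a + q * N, by simp, ?_, ?_⟩
  · have h3 : f.1 (b + 3 / 4) < f.1 (b + t) := f.lt_iff.2 (by linarith)
    have h4 := f.apply_add_int (b + t) q
    rw [e]
    push_cast
    rw [h4]
    linarith
  · have h3 : f.1 (b + t + 1) < f.1 (b + N + 1 / 4) := f.lt_iff.2 (by linarith)
    have h4 := f.apply_add_int (b + t + 1) q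
    rw [e]
    push_cast
    rw [show (b : ℝ) + t + q * N + 1 = b + t + 1 + q * N by ring, h4]
    linarith

namespace GeneratorLifts

variable {n k : ℕ} [NeZero k] {m : Fin k → ℕ} (X : GeneratorLifts n m) {d : ℕ} [NeZero d]
  {r : Fin k → ℕ} (hr : ∀ i, m i * r i + 1 = d)

theorem H_inv_left (j : Fin (2 * n)) : ((X.H j)⁻¹).1 (posArcLift k j + 3 / 4) =
    negArc k j + (arcs n k : ℕ) + 1 / 4 := by
  rw [← X.H_right, inv_apply_self]

theorem H_inv_right (j : Fin (2 * n)) :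
    ((X.H j)⁻¹).1 (posArcLift k j + (arcs n k : ℕ) + 1 / 4) = negArc k j + (arcs n k : ℕ) + 3 / 4 := by
  have h1 := (X.H j).apply_add_int (negArc k j + 3 / 4) 1
  rw [Int.cast_one, one_mul, X.H_left] at h1
  rw [show (posArcLift k j : ℝ) + (arcs n k : ℕ) + 1 / 4 = posArcLift k j + 1 / 4 + (arcs n k : ℕ) by
    ring, ← h1, inv_apply_self]
  ring

theorem letterLift_ping (s : Letter n m) (i : ℤ)
    (hi : (i : ZMod (arcs n k)) ≠ (letterSource s : ℕ)) :
    ∃ j : ℤ, (j : ZMod (arcs n k)) = (letterTarget s : ℕ) ∧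
      (j : ℝ) + 1 / 4 < (X.letterLift r s).1 i ∧ (X.letterLift r s).1 (i + 1) < j + 3 / 4 := by
  match s with
  | .inl ⟨l, j⟩ =>
    have hj : j.1 + 1 < m l := by have := j.2; omega
    obtain ⟨j', h1, h2⟩ := LineLift.ping (f := X.coverE r l ^ (j.1 + 1))
      (a := (l : ℕ) + ((j.1 + 1) * r l : ℕ) * (arcs n k : ℕ))
      (b := (l : ℕ) - (arcs n k : ℕ)) (by
        rw [coverE_pow_apply]
        have := X.le_E l (j.1 + 1) (by omega) hj
        push_cast at this ⊢
        linarith) (by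
        rw [coverE_pow_apply]
        have := X.E_le l (j.1 + 1) (by omega) hj
        push_cast at this ⊢
        rw [sub_add_cancel]
        linarith) i (by simpa [letterSource] using hi)
    exact ⟨j', by simpa [letterTarget] using h1, h2⟩
  | .inr (j, true) =>
    obtain ⟨j', h1, h2⟩ := LineLift.ping (f := X.H j) (a := posArcLift k j) (b := negArc k j)
      (by simpa using (X.H_left j).ge) (by simpa using (X.H_right j).le) i
      (by simpa [letterSource] using hi)
    refine ⟨j', ?_, h2⟩
    rw [h1, posArcLift]
    simp [letterTarget]
  | .inr (j, false) =>
    obtain ⟨j', h1, h2⟩ := LineLift.ping (f := (X.H j)⁻¹) (a := negArc k j + (arcs n k : ℕ))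
      (b := posArcLift k j) (by simpa using (X.H_inv_left j).ge) (by simpa using (X.H_inv_right j).le)
      i (by simpa [letterSource, posArcLift] using hi)
    refine ⟨j', ?_, h2⟩
    rw [h1]
    simp [letterTarget]

omit [NeZero k] in
theorem letterTarget_lt (s : Letter n m) : letterTarget s < arcs n k := by
  match s with
  | .inl ⟨i, _⟩ => exact i.2.trans_le (Nat.le_add_right _ _)
  | .inr (j, true) => exact posArc_lt j
  | .inr (j, false) => exact negArc_lt j

omit [NeZero k] in
theorem letterSource_lt (s : Letter n m) : letterSource s < arcs n k := by
  match s with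
  | .inl ⟨i, _⟩ => exact i.2.trans_le (Nat.le_add_right _ _)
  | .inr (j, true) => exact negArc_lt j
  | .inr (j, false) => exact posArc_lt j

theorem natCast_inj {N a b : ℕ} (ha : a < N) (hb : b < N) : (a : ZMod N) = b ↔ a = b := by
  rw [ZMod.natCast_eq_natCast_iff', Nat.mod_eq_of_lt ha, Nat.mod_eq_of_lt hb]

omit [NeZero k] in
theorem letter_mul_cases (hm : ∀ i, 2 ≤ m i) (s s' : Letter n m)
    (hs : letterTarget s' = letterSource s) :
    letterVal s * letterVal s' = 1 ∨ ∃ s'', letterVal s * letterVal s' = letterVal s'' := by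
  match s, s', hs with
  | .inl ⟨i, j⟩, .inl ⟨i', j'⟩, hs =>
    obtain rfl : i' = i := Fin.ext hs
    have h1 : letterVal (.inl ⟨i', j⟩) * letterVal (.inl ⟨i', j'⟩) =
        e n m i' ^ (j.1 + 1 + (j'.1 + 1)) := (pow_add _ _ _).symm
    rw [h1]
    rcases e_pow_eq (n := n) hm i' (j.1 + 1 + (j'.1 + 1)) with h | ⟨l, h⟩
    · exact Or.inl h
    · exact Or.inr ⟨_, h⟩
  | .inl ⟨i, j⟩, .inr (j', true), hs => exact absurd hs (i.2.trans_le (le_posArc j')).ne'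
  | .inl ⟨i, j⟩, .inr (j', false), hs => exact absurd hs (i.2.trans_le (le_negArc j')).ne'
  | .inr (j, true), .inl ⟨i', j'⟩, hs => exact absurd hs (i'.2.trans_le (le_negArc j)).ne
  | .inr (j, false), .inl ⟨i', j'⟩, hs => exact absurd hs (i'.2.trans_le (le_posArc j)).ne
  | .inr (j, true), .inr (j', true), hs => exact absurd hs (posArc_ne_negArc j' j)
  | .inr (j, false), .inr (j', false), hs => exact absurd hs.symm (posArc_ne_negArc j j')
  | .inr (j, true), .inr (j', false), hs =>
    obtain rfl : j' = j := negArc_injective hs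
    exact Or.inl (mul_inv_cancel _)
  | .inr (j, false), .inr (j', true), hs =>
    obtain rfl : j' = j := posArc_injective hs
    exact Or.inl (inv_mul_cancel _)

omit [NeZero k] in
theorem letter_sep (hm : ∀ i, 2 ≤ m i) (s t : Letter n m) (hs : letterTarget s = letterTarget t) :
    letterVal s = letterVal t ∨
      ∃ u, letterVal s = letterVal t * letterVal u ∧ letterTarget u = letterSource t := by
  match s, t, hs with
  | .inl ⟨i, j⟩, .inl ⟨i', j'⟩, hs =>
    obtain rfl : i = i' := Fin.ext hs
    -- The exponent is the difference j - j' with m_i added, so that truncated subtraction does no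
    -- harm.
    have h1 : e n m i ^ (j.1 + 1) = e n m i ^ (j'.1 + 1) * e n m i ^ (m i + j.1 - j'.1) := by
      have := j'.2
      rw [← pow_add, show j'.1 + 1 + (m i + j.1 - j'.1) = m i + (j.1 + 1) by omega, pow_add _ (m i),
        e_pow, one_mul]
    rcases e_pow_eq (n := n) hm i (m i + j.1 - j'.1) with h | ⟨l, h⟩
    · left
      rw [h, mul_one] at h1
      exact h1
    · right
      rw [h] at h1
      exact ⟨_, h1, rfl⟩
  | .inl ⟨i, j⟩, .inr (j', true), hs => exact absurd hs (i.2.trans_le (le_posArc j')).ne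
  | .inl ⟨i, j⟩, .inr (j', false), hs => exact absurd hs (i.2.trans_le (le_negArc j')).ne
  | .inr (j, true), .inl ⟨i', j'⟩, hs => exact absurd hs (i'.2.trans_le (le_posArc j)).ne'
  | .inr (j, false), .inl ⟨i', j'⟩, hs => exact absurd hs (i'.2.trans_le (le_negArc j)).ne'
  | .inr (j, true), .inr (j', true), hs =>
    obtain rfl : j = j' := posArc_injective hs
    exact Or.inl rfl
  | .inr (j, false), .inr (j', false), hs =>
    obtain rfl : j = j' := negArc_injective hs
    exact Or.inl rfl
  | .inr (j, true), .inr (j', false), hs => exact absurd hs (posArc_ne_negArc j j')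
  | .inr (j, false), .inr (j', true), hs => exact absurd hs.symm (posArc_ne_negArc j' j)

end GeneratorLifts

end CyclicFreeProduct

end

/-! ### The boundary word -/

noncomputable section

namespace CyclicFreeProduct

open LineLift GeneratorLifts

variable {n k : ℕ} [NeZero k] {m : Fin k → ℕ}

/-- The arcs: one for each torsion generator and four for each handle. -/
abbrev Slot (n k : ℕ) : Type := Fin k ⊕ (Fin n × Fin 4)

/-- The position of an arc. -/
def slotPos : Slot n k → ℕ
  | .inl i => i
  | .inr (c, v) => k + 4 * c + v

/-- The position of an arc along the boundary word. -/
def slotRank : Slot n k → ℕ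
  | .inl i => i
  | .inr (c, 0) => k + 4 * c
  | .inr (c, 1) => k + 4 * c + 3
  | .inr (c, 2) => k + 4 * c + 2
  | .inr (c, 3) => k + 4 * c + 1

/-- The letter of the boundary word at an arc. -/
def slotLetter (hm : ∀ i, 2 ≤ m i) : Slot n k → Letter n m
  | .inl i => .inl ⟨i, ⟨0, by have := hm i; omega⟩⟩
  | .inr (c, 0) => .inr (⟨2 * c, by omega⟩, true)
  | .inr (c, 1) => .inr (⟨2 * c + 1, by omega⟩, false)
  | .inr (c, 2) => .inr (⟨2 * c, by omega⟩, false)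
  | .inr (c, 3) => .inr (⟨2 * c + 1, by omega⟩, true)

/-- The displacement from an arc to the next integer point along the boundary word. -/
def slotJump (r : Fin k → ℕ) : Slot n k → ℤ
  -- In each case the jump leads one past the arc not contracted by the letter, on the sheet from
  -- which its lift lands at the present arc.
  | .inl i => 1 - (arcs n k : ℕ) - (r i : ℕ) * (arcs n k : ℕ)
  | .inr (_, 0) => 3 - (arcs n k : ℕ)
  | .inr (_, 1) => 3 - (arcs n k : ℕ)
  | .inr (_, 2) => -1
  | .inr (_, 3) => -1

omit [NeZero k] in
theorem slotPos_inl (i : Fin k) : slotPos (n := n) (.inl i) = i := rfl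

omit [NeZero k] in
theorem slotPos_zero (c : Fin n) : slotPos (k := k) (.inr (c, 0)) = k + 4 * c := rfl

omit [NeZero k] in
theorem slotPos_one (c : Fin n) : slotPos (k := k) (.inr (c, 1)) = k + 4 * c + 1 := rfl

omit [NeZero k] in
theorem slotPos_two (c : Fin n) : slotPos (k := k) (.inr (c, 2)) = k + 4 * c + 2 := rfl

omit [NeZero k] in
theorem slotPos_three (c : Fin n) : slotPos (k := k) (.inr (c, 3)) = k + 4 * c + 3 := rfl

omit [NeZero k] in
theorem slotPos_lt (s : Slot n k) : slotPos s < arcs n k := by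
  unfold arcs
  match s with
  | .inl i => simp only [slotPos]; omega
  | .inr (c, v) => simp only [slotPos]; omega

omit [NeZero k] in
theorem slotPos_injective : Function.Injective (slotPos (n := n) (k := k)) := by
  intro s s' h
  match s, s', h with
  | .inl i, .inl i', h => exact congrArg _ (Fin.ext h)
  | .inl i, .inr (c, v), h => simp only [slotPos] at h; omega
  | .inr (c, v), .inl i, h => simp only [slotPos] at h; omega
  | .inr (c, v), .inr (c', v'), h =>
    simp only [slotPos] at h
    have h1 : c = c' := Fin.ext (by omega)
    have h2 : v = v' := Fin.ext (by omega)
    rw [h1, h2]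

omit [NeZero k] in
theorem exists_slotPos {p : ℕ} (hp : p < arcs n k) : ∃ s : Slot n k, slotPos s = p := by
  unfold arcs at hp
  by_cases h : p < k
  · exact ⟨.inl ⟨p, h⟩, rfl⟩
  · refine ⟨.inr (⟨(p - k) / 4, by omega⟩, ⟨(p - k) % 4, by omega⟩), ?_⟩
    simp only [slotPos]
    omega

theorem exists_slot (j : ℤ) : ∃ (s : Slot n k) (z : ℤ), j = slotPos s + z * (arcs n k : ℕ) := by
  have hN : (0 : ℤ) < (arcs n k : ℕ) := by exact_mod_cast Nat.pos_of_ne_zero (NeZero.ne (arcs n k))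
  have h1 := Int.emod_lt_of_pos j hN
  have h2 := Int.emod_nonneg j hN.ne'
  obtain ⟨s, hs⟩ := exists_slotPos (n := n) (k := k) (p := (j % (arcs n k : ℕ)).toNat) (by omega)
  refine ⟨s, j / (arcs n k : ℕ), ?_⟩
  rw [hs, Int.toNat_of_nonneg h2, mul_comm]
  exact (Int.emod_add_mul_ediv j _).symm

/-- The arc that follows an integer point. -/
def slotOf (j : ℤ) : Slot n k := (exists_slot j).choose

theorem exists_eq_slotOf (j : ℤ) :
    ∃ z : ℤ, j = slotPos (slotOf (n := n) (k := k) j) + z * (arcs n k : ℕ) :=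
  (exists_slot j).choose_spec

omit [NeZero k] in
theorem intCast_slotPos (s : Slot n k) (z : ℤ) :
    ((slotPos s + z * (arcs n k : ℕ) : ℤ) : ZMod (arcs n k)) = (slotPos s : ℕ) := by simp

theorem slotOf_eq {j : ℤ} {s : Slot n k} {z : ℤ} (h : j = slotPos s + z * (arcs n k : ℕ)) :
    slotOf j = s := by
  obtain ⟨y, hy⟩ := exists_eq_slotOf (n := n) (k := k) j
  have h1 := intCast_slotPos s z
  rw [← h, hy, intCast_slotPos, natCast_inj (slotPos_lt _) (slotPos_lt _)] at h1
  exact slotPos_injective h1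

theorem slotOf_add (j : ℤ) : slotOf (n := n) (k := k) (j + (arcs n k : ℕ)) = slotOf j := by
  obtain ⟨z, hz⟩ := exists_eq_slotOf (n := n) (k := k) j
  refine slotOf_eq (z := z + 1) ?_
  nth_rewrite 1 [hz]
  ring

omit [NeZero k] in
theorem slotRank_lt (s : Slot n k) : slotRank s < arcs n k := by
  unfold arcs
  match s with
  | .inl i => simp only [slotRank]; omega
  | .inr (c, 0) => simp only [slotRank]; omega
  | .inr (c, 1) => simp only [slotRank]; omega
  | .inr (c, 2) => simp only [slotRank]; omega
  | .inr (c, 3) => simp only [slotRank]; omega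

/-- The rank as a function of the position. -/
def posRank (k p : ℕ) : ℕ :=
  -- Inside a handle the offset 0 stays and v ≠ 0 becomes 4 - v; the closed form leaves everything
  -- to linear arithmetic.
  if p < k then p else p + (if (p - k) % 4 = 0 then 0 else 4) - 2 * ((p - k) % 4)

theorem posRank_of_lt {k p : ℕ} (h : p < k) : posRank k p = p := if_pos h

theorem posRank_handle (k c : ℕ) : posRank k (k + 4 * c) = k + 4 * c ∧
    posRank k (k + 4 * c + 1) = k + 4 * c + 3 ∧ posRank k (k + 4 * c + 2) = k + 4 * c + 2 ∧
      posRank k (k + 4 * c + 3) = k + 4 * c + 1 := by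
  unfold posRank
  refine ⟨?_, ?_, ?_, ?_⟩ <;> split_ifs <;> omega

omit [NeZero k] in
theorem slotRank_eq (s : Slot n k) : slotRank s = posRank k (slotPos s) := by
  match s with
  | .inl i => exact (posRank_of_lt i.2).symm
  | .inr (c, 0) => exact (posRank_handle k c).1.symm
  | .inr (c, 1) => exact (posRank_handle k c).2.1.symm
  | .inr (c, 2) => exact (posRank_handle k c).2.2.1.symm
  | .inr (c, 3) => exact (posRank_handle k c).2.2.2.symm

omit [NeZero k] in
theorem slotRank_injective : Function.Injective (slotRank (n := n) (k := k)) := by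
  intro s s' h
  rw [slotRank_eq, slotRank_eq] at h
  apply slotPos_injective
  generalize slotPos s = p at *
  generalize slotPos s' = p' at *
  unfold posRank at h
  split_ifs at h <;> omega

/-- The case p = `arcs n k` is allowed: one past the last arc is the first arc, of rank 0, which
agrees modulo the number of arcs. -/
theorem slotRank_slotOf {j z : ℤ} {p : ℕ} (hp : p ≤ arcs n k) (h : j = p + z * (arcs n k : ℕ)) :
    ((slotRank (slotOf (n := n) (k := k) j) : ℕ) : ZMod (arcs n k)) = posRank k p := by
  rcases hp.lt_or_eq with hp | rfl
  · obtain ⟨s, rfl⟩ := exists_slotPos hp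
    rw [slotOf_eq h, slotRank_eq]
  · have hk : 0 < k := Nat.pos_of_ne_zero (NeZero.ne k)
    rw [slotOf_eq (s := .inl ⟨0, hk⟩) (z := z + 1) (by simp [slotPos, h]; ring)]
    have : posRank k (arcs n k) = arcs n k := by
      unfold posRank arcs
      split_ifs <;> omega
    rw [this]
    simp [slotRank]

/-- The next integer point along the boundary word. -/
def nextPt (n : ℕ) (r : Fin k → ℕ) (j : ℤ) : ℤ := j + slotJump r (slotOf (n := n) (k := k) j)

/-- The jumps lead from i to i + 1 on torsion arcs and follow the offsets 0, 3, 2, 1, 4 through a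
handle: the order in which a commutator visits its four arcs. -/
theorem slotRank_nextPt (r : Fin k → ℕ) (j : ℤ) :
    ((slotRank (slotOf (n := n) (k := k) (nextPt n r j)) : ℕ) : ZMod (arcs n k)) =
      (slotRank (slotOf (n := n) (k := k) j) : ℕ) + 1 := by
  obtain ⟨z, hz⟩ := exists_eq_slotOf (n := n) (k := k) j
  unfold nextPt
  generalize slotOf (n := n) (k := k) j = s at *
  have key : ∀ (p : ℕ) (y : ℤ), p ≤ arcs n k →
      j + slotJump r s = p + y * (arcs n k : ℕ) → posRank k p = posRank k (slotPos s) + 1 →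
      ((slotRank (slotOf (n := n) (k := k) (j + slotJump r s)) : ℕ) : ZMod (arcs n k)) =
      (slotRank s : ℕ) + 1 := by
    intro p y h1 h2 h3
    rw [slotRank_slotOf h1 h2, h3, slotRank_eq]
    push_cast
    rfl
  match s, hz, key with
  | .inl i, hz, key =>
    refine key (i + 1) (z - 1 - r i) (by unfold arcs; omega) ?_ ?_
    · rw [hz]
      simp only [slotPos_inl, slotJump]
      push_cast
      ring
    · rw [show slotPos (n := n) (.inl i) = (i : ℕ) from rfl, posRank_of_lt i.2]
      rcases (Nat.succ_le_of_lt i.2).lt_or_eq with h | h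
      · exact posRank_of_lt h
      · rw [Nat.succ_eq_add_one] at h
        rw [h]
        exact (posRank_handle k 0).1
  | .inr (c, 0), hz, key =>
    refine key (k + 4 * c + 3) (z - 1) (by unfold arcs; omega) ?_ ?_
    · rw [hz]
      simp only [slotPos_zero, slotJump]
      push_cast
      ring
    · exact (posRank_handle k c).2.2.2.trans (congrArg (· + 1) (posRank_handle k c).1.symm)
  | .inr (c, 1), hz, key =>
    refine key (k + 4 * c + 4) (z - 1) (by unfold arcs; omega) ?_ ?_
    · rw [hz]
      simp only [slotPos_one, slotJump]
      push_cast
      ring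
    · exact (posRank_handle k (c + 1)).1.trans (congrArg (· + 1) (posRank_handle k c).2.1.symm)
  | .inr (c, 2), hz, key =>
    refine key (k + 4 * c + 1) z (by unfold arcs; omega) ?_ ?_
    · rw [hz]
      simp only [slotPos_two, slotJump]
      push_cast
      ring
    · exact (posRank_handle k c).2.1.trans (congrArg (· + 1) (posRank_handle k c).2.2.1.symm)
  | .inr (c, 3), hz, key =>
    refine key (k + 4 * c + 2) z (by unfold arcs; omega) ?_ ?_
    · rw [hz]
      simp only [slotPos_three, slotJump]
      push_cast
      ring
    · exact (posRank_handle k c).2.2.1.trans (congrArg (· + 1) (posRank_handle k c).2.2.2.symm)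

theorem slotRank_eq_zero (j : ℤ) :
    ((slotRank (slotOf (n := n) (k := k) j) : ℕ) : ZMod (arcs n k)) = 0 ↔ ((arcs n k : ℕ) : ℤ) ∣ j := by
  have hk : 0 < k := Nat.pos_of_ne_zero (NeZero.ne k)
  have h0 : ((0 : ℕ) : ZMod (arcs n k)) = 0 := Nat.cast_zero
  rw [← h0, natCast_inj (slotRank_lt _) (Nat.pos_of_ne_zero (NeZero.ne (arcs n k)))]
  constructor
  · intro h
    have h1 : slotOf (n := n) (k := k) j = .inl ⟨0, hk⟩ := slotRank_injective h
    obtain ⟨z, hz⟩ := exists_eq_slotOf (n := n) (k := k) j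
    rw [h1] at hz
    rw [hz]
    simp [slotPos]
  · rintro ⟨z, rfl⟩
    rw [slotOf_eq (s := .inl ⟨0, hk⟩) (z := z) (by simp [slotPos]; ring)]
    rfl

/-- The boundary word visits the arcs in the order of their rank. -/
theorem slotOf_nextPt_iterate (r : Fin k → ℕ) (s : Slot n k) :
    slotOf ((nextPt n r)^[slotRank s] 0) = s := by
  have h1 : ∀ l : ℕ, ((slotRank (slotOf (n := n) (k := k) ((nextPt n r)^[l] 0)) : ℕ) :
      ZMod (arcs n k)) = (l : ℕ) := by
    intro l
    induction l with
    | zero =>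
      rw [Nat.cast_zero]
      exact (slotRank_eq_zero 0).2 (dvd_zero _)
    | succ l ih => rw [Function.iterate_succ_apply', slotRank_nextPt, ih, Nat.cast_succ]
  have h2 := h1 (slotRank s)
  rw [natCast_inj (slotRank_lt _) (slotRank_lt _)] at h2
  exact slotRank_injective h2

theorem nextPt_iterate (r : Fin k → ℕ) (l : ℕ) : (nextPt n r)^[l] 0 =
    ∑ i ∈ Finset.range l, slotJump r (slotOf (n := n) (k := k) ((nextPt n r)^[i] 0)) := by
  induction l with
  | zero => rfl
  | succ l ih =>
    rw [Finset.sum_range_succ, ← ih, Function.iterate_succ_apply']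
    rfl

theorem _root_.Finset.sum_range_four_mul (F : ℕ → ℤ) (n : ℕ) : ∑ l ∈ Finset.range (4 * n), F l =
    ∑ c ∈ Finset.range n, (F (4 * c) + F (4 * c + 1) + F (4 * c + 2) + F (4 * c + 3)) := by
  induction n with
  | zero => rfl
  | succ n ih =>
    rw [Finset.sum_range_succ, ← ih, Nat.mul_succ, Finset.sum_range_succ, Finset.sum_range_succ,
      Finset.sum_range_succ, Finset.sum_range_succ]
    ring

theorem _root_.List.prod_range_four_mul {M : Type*} [Monoid M] (F : ℕ → M) (n : ℕ) :
    ((List.range (4 * n)).map F).prod =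
      (List.ofFn fun c : Fin n => F (4 * c) * F (4 * c + 1) * F (4 * c + 2) * F (4 * c + 3)).prod := by
  induction n with
  | zero => rfl
  | succ n ih =>
    rw [List.ofFn_succ', Nat.mul_succ, List.range_succ, List.range_succ, List.range_succ,
      List.range_succ]
    simp [ih, mul_assoc]

theorem _root_.List.prod_map_range {M : Type*} [Monoid M] (F : ℕ → M) (k : ℕ) :
    ((List.range k).map F).prod = (List.ofFn fun i : Fin k => F i).prod := by
  induction k with
  | zero => rfl
  | succ k ih =>
    rw [List.ofFn_succ', List.range_succ]
    simp [ih]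

/-- The displacement along the whole boundary word. -/
theorem nextPt_iterate_arcs (r : Fin k → ℕ) : (nextPt n r)^[arcs n k] 0 =
    -((arcs n k : ℕ) * ((k : ℤ) + 2 * n - 1 + ∑ i, (r i : ℤ))) := by
  rw [nextPt_iterate]
  set F := fun i => slotJump r (slotOf (n := n) (k := k) ((nextPt n r)^[i] 0)) with hF
  have hs : ∀ s : Slot n k, F (slotRank s) = slotJump r s := fun s => by
    rw [hF]
    beta_reduce
    rw [slotOf_nextPt_iterate]
  have h1 : ∑ i ∈ Finset.range k, F i =
      ∑ i : Fin k, (1 - ((arcs n k : ℕ) : ℤ) - (r i : ℕ) * (arcs n k : ℕ)) := by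
    rw [Finset.sum_range]
    exact Finset.sum_congr rfl fun i _ => hs (.inl i)
  -- A torsion arc contributes 1 - κ - r_i κ and a handle 4 - 2κ. Since κ = k + 4n, the total is
  -- -κ(k + 2n - 1 + ∑ r_i).
  have h2 : ∑ l ∈ Finset.range (4 * n), F (k + l) =
      ∑ c : Fin n, (4 - 2 * ((arcs n k : ℕ) : ℤ)) := by
    rw [Finset.sum_range_four_mul, Finset.sum_range]
    refine Finset.sum_congr rfl fun c _ => ?_
    have e0 := hs (.inr (c, 0))
    have e1 := hs (.inr (c, 1))
    have e2 := hs (.inr (c, 2))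
    have e3 := hs (.inr (c, 3))
    simp only [slotRank, slotJump, add_assoc] at e0 e1 e2 e3 ⊢
    rw [e0, e1, e2, e3]
    ring
  have h3 : ∑ i ∈ Finset.range (arcs n k), F i =
      ∑ i ∈ Finset.range k, F i + ∑ l ∈ Finset.range (4 * n), F (k + l) :=
    Finset.sum_range_add F k (4 * n)
  rw [h3, h1, h2, Finset.sum_sub_distrib, Finset.sum_const, Finset.sum_const, ← Finset.sum_mul]
  simp only [Finset.card_univ, Fintype.card_fin, nsmul_eq_mul, arcs]
  push_cast
  ring

theorem α_eq_prod (hm : ∀ i, 2 ≤ m i) (r : Fin k → ℕ) : α n m =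
    ((List.range (arcs n k)).map fun l =>
      letterVal (slotLetter hm (slotOf ((nextPt n r)^[l] 0)))).prod := by
  set F := fun l => letterVal (slotLetter hm (slotOf (n := n) (k := k) ((nextPt n r)^[l] 0))) with hF
  have hs : ∀ s : Slot n k, F (slotRank s) = letterVal (slotLetter hm s) := fun s => by
    rw [hF]
    beta_reduce
    rw [slotOf_nextPt_iterate]
  have h3 : ((List.range (arcs n k)).map F).prod =
      ((List.range k).map F).prod * ((List.range (4 * n)).map fun l => F (k + l)).prod := by
    unfold arcs
    rw [List.range_add, List.map_append, List.prod_append, List.map_map]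
    rfl
  rw [h3, List.prod_map_range, List.prod_range_four_mul, α]
  congr 3
  · funext i
    rw [show F i = _ from hs (.inl i)]
    simp [slotLetter, letterVal]
  · funext c
    have e0 := hs (.inr (c, 0))
    have e1 := hs (.inr (c, 1))
    have e2 := hs (.inr (c, 2))
    have e3 := hs (.inr (c, 3))
    simp only [slotRank, slotLetter, letterVal, add_assoc] at e0 e1 e2 e3 ⊢
    rw [e0, e1, e2, e3]
    rfl

namespace GeneratorLifts

variable (X : GeneratorLifts n m) {d : ℕ} [NeZero d] {r : Fin k → ℕ}
  (hr : ∀ i, m i * r i + 1 = d)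

omit [NeZero k] in
theorem negArc_even (c : Fin n) (h : 2 * c.1 < 2 * n) :
    negArc k (⟨2 * c, h⟩ : Fin (2 * n)) = k + 4 * c + 2 := by
  simp only [negArc]
  omega

omit [NeZero k] in
theorem negArc_odd (c : Fin n) (h : 2 * c.1 + 1 < 2 * n) :
    negArc k (⟨2 * c + 1, h⟩ : Fin (2 * n)) = k + 4 * c + 1 := by
  simp only [negArc]
  omega

omit [NeZero k] in
theorem posArc_even (c : Fin n) (h : 2 * c.1 < 2 * n) :
    posArc k (⟨2 * c, h⟩ : Fin (2 * n)) = k + 4 * c := by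
  simp only [posArc]
  omega

omit [NeZero k] in
theorem posArc_odd (c : Fin n) (h : 2 * c.1 + 1 < 2 * n) :
    posArc k (⟨2 * c + 1, h⟩ : Fin (2 * n)) = k + 4 * c + 3 := by
  simp only [posArc]
  omega

omit [NeZero k] in
theorem posArcLift_even (c : Fin n) (h : 2 * c.1 < 2 * n) :
    posArcLift k (⟨2 * c, h⟩ : Fin (2 * n)) = k + 4 * c + (arcs n k : ℕ) := by
  rw [posArcLift, posArc_even]
  simp

omit [NeZero k] in
theorem posArcLift_odd (c : Fin n) (h : 2 * c.1 + 1 < 2 * n) :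
    posArcLift k (⟨2 * c + 1, h⟩ : Fin (2 * n)) = k + 4 * c + 3 := by
  rw [posArcLift, posArc_odd]
  simp only [show (2 * c.1 + 1) % 2 = 1 by omega]
  push_cast
  ring

/-- The endpoints of the interval contracted by a letter of the boundary word. -/
theorem slotLetter_endpoints (hm : ∀ i, 2 ≤ m i) (s : Slot n k) :
    (X.letterLift r (slotLetter hm s)).1 (slotPos s + slotJump r s - 1 / 4) = slotPos s + 1 / 4 ∧
      (X.letterLift r (slotLetter hm s)).1
        (slotPos s + slotJump r s + (arcs n k : ℕ) - 3 / 4) ≤ slotPos s + 3 / 4 := by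
  have shift : ∀ (f : LineLift (arcs n k)) (x y w : ℝ) (z : ℤ), w = x + z * (arcs n k : ℕ) →
      f.1 x = y → f.1 w = y + z * (arcs n k : ℕ) := by
    rintro f x y w z rfl rfl
    exact f.apply_add_int x z
  match s with
  | .inl i =>
    have e : ∀ x, (X.coverE r i ^ (0 + 1)).1 x = (X.E i).1 x + r i * (arcs n k : ℕ) := fun x => by
      rw [coverE_pow_apply, zero_add, pow_one, one_mul]
    simp only [slotLetter, letterLift, e, slotPos_inl, slotJump]
    constructor
    · rw [shift _ _ _ _ (-r i) ?_ (X.E_apply i)]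
      · push_cast
        ring
      · push_cast
        ring
    · have h1 := X.E_le i 1 one_pos (hm i)
      rw [pow_one] at h1
      rw [shift _ ((i : ℕ) + 1 / 4) _ _ (-r i) ?_ rfl]
      · push_cast
        linarith
      · push_cast
        ring
  | .inr (c, 0) =>
    have h1 := X.H_left ⟨2 * c, by omega⟩
    have h2 := X.H_right ⟨2 * c, by omega⟩
    rw [negArc_even, posArcLift_even] at h1 h2
    push_cast at h1 h2
    simp only [slotLetter, letterLift, slotPos_zero, slotJump]
    constructor
    · rw [shift _ _ _ _ (-1) ?_ h1]
      · push_cast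
        ring
      · push_cast
        ring
    · rw [shift _ _ _ _ (-1) ?_ h2]
      · push_cast
        linarith
      · push_cast
        ring
  | .inr (c, 1) =>
    have h1 := X.H_inv_left ⟨2 * c + 1, by omega⟩
    have h2 := X.H_inv_right ⟨2 * c + 1, by omega⟩
    rw [negArc_odd, posArcLift_odd] at h1 h2
    push_cast at h1 h2
    simp only [slotLetter, letterLift, slotPos_one, slotJump]
    constructor
    · rw [shift _ _ _ _ (-1) ?_ h1]
      · push_cast
        ring
      · push_cast
        ring
    · rw [shift _ _ _ _ (-1) ?_ h2]
      · push_cast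
        linarith
      · push_cast
        ring
  | .inr (c, 2) =>
    have h1 := X.H_inv_left ⟨2 * c, by omega⟩
    have h2 := X.H_inv_right ⟨2 * c, by omega⟩
    rw [negArc_even, posArcLift_even] at h1 h2
    push_cast at h1 h2
    simp only [slotLetter, letterLift, slotPos_two, slotJump]
    constructor
    · rw [shift _ _ _ _ (-1) ?_ h1]
      · push_cast
        ring
      · push_cast
        ring
    · rw [shift _ _ _ _ (-1) ?_ h2]
      · push_cast
        linarith
      · push_cast
        ring
  | .inr (c, 3) =>
    have h1 := X.H_left ⟨2 * c + 1, by omega⟩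
    have h2 := X.H_right ⟨2 * c + 1, by omega⟩
    rw [negArc_odd, posArcLift_odd] at h1 h2
    push_cast at h1 h2
    simp only [slotLetter, letterLift, slotPos_three, slotJump]
    constructor
    · rw [shift _ _ _ _ 0 ?_ h1]
      · push_cast
        ring
      · push_cast
        ring
    · rw [shift _ _ _ _ 0 ?_ h2]
      · push_cast
        linarith
      · push_cast
        ring

/-- The ping-pong system of the action on the `d`-fold cover. -/
def system (hm : ∀ i, 2 ≤ m i) (h2 : 2 ≤ arcs n k)
    (hco : IsCoprime ((k : ℤ) + 2 * n - 1 + ∑ i, (r i : ℤ)) (d : ℤ)) :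
    PingPongSystem (CyclicFreeProduct n m) (arcs n k) d (Letter n m) where
  σ := X.rep hr
  val := letterVal
  lift := X.letterLift r
  toCircle_lift := X.toCircle_letterLift hr
  target s := (letterTarget s : ℕ)
  source s := (letterSource s : ℕ)
  ping := X.letterLift_ping
  mul_cases s s' h :=
    letter_mul_cases hm s s' ((natCast_inj (letterTarget_lt _) (letterSource_lt _)).1 h)
  sep s t h := by
    rcases letter_sep hm s t ((natCast_inj (letterTarget_lt _) (letterTarget_lt _)).1 h) with
      h1 | ⟨u, h1, h2⟩
    · exact Or.inl h1
    · exact Or.inr ⟨u, h1, by rw [h2]⟩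
  generate := exists_word hm
  two_le := h2
  edge j := slotLetter hm (slotOf j)
  next := nextPt n r
  lift_edge j := by
    obtain ⟨z, hz⟩ := exists_eq_slotOf (n := n) (k := k) j
    have h1 := (X.slotLetter_endpoints (r := r) hm (slotOf j)).1
    have hz' : (j : ℝ) = slotPos (slotOf (n := n) (k := k) j) + z * (arcs n k : ℕ) := by
      exact_mod_cast congrArg (Int.cast : ℤ → ℝ) hz
    have h3 := (X.letterLift r (slotLetter hm (slotOf j))).apply_add_int
      (slotPos (slotOf (n := n) (k := k) j) + slotJump r (slotOf (n := n) (k := k) j) - 1 / 4) z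
    rw [h1] at h3
    rw [nextPt, Int.cast_add]
    convert h3 using 1
    · congr 1
      linarith
    · linarith
  lift_edge_lt j := by
    obtain ⟨z, hz⟩ := exists_eq_slotOf (n := n) (k := k) j
    have h1 := (X.slotLetter_endpoints (r := r) hm (slotOf j)).2
    have hz' : (j : ℝ) = slotPos (slotOf (n := n) (k := k) j) + z * (arcs n k : ℕ) := by
      exact_mod_cast congrArg (Int.cast : ℤ → ℝ) hz
    have h3 := (X.letterLift r (slotLetter hm (slotOf j))).apply_add_int
      (slotPos (slotOf (n := n) (k := k) j) + slotJump r (slotOf (n := n) (k := k) j) +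
        (arcs n k : ℕ) - 3 / 4) z
    have h4 : (2 : ℝ) ≤ (arcs n k : ℕ) := by exact_mod_cast h2
    refine lt_of_lt_of_le ((X.letterLift r (slotLetter hm (slotOf j))).lt_iff.2 ?_)
      (h3.le.trans ?_)
    · rw [nextPt, Int.cast_add]
      linarith
    · linarith
  edge_add j := by rw [slotOf_add]
  next_add j := by rw [nextPt, nextPt, slotOf_add]; ring
  rank j := (slotRank (slotOf (n := n) (k := k) j) : ℕ)
  rank_next := slotRank_nextPt r
  rank_eq_zero := slotRank_eq_zero
  bdry := α n m
  bdry_eq := α_eq_prod hm r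
  shift := (k : ℤ) + 2 * n - 1 + ∑ i, (r i : ℤ)
  next_iterate := nextPt_iterate_arcs r
  coprime := hco
  lift_eq_one_of_fixed := X.eq_one_of_fixed hr hm

end GeneratorLifts

end CyclicFreeProduct

end

/-! ### Covering, ping-pong and Fuchsian properties -/

noncomputable section

namespace CyclicFreeProduct

namespace GeneratorLifts

open LineLift

variable {n k : ℕ} [NeZero k] {m : Fin k → ℕ} (X : GeneratorLifts n m) {d : ℕ} [NeZero d]
  {r : Fin k → ℕ} (hr : ∀ i, m i * r i + 1 = d)

theorem _root_.nsmul_circlePt {N : ℕ} [NeZero N] (d : ℕ) [NeZero d] (x : ℝ) :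
    d • circlePt (N * d) x = circlePt (N * (1 : ℕ)) x := by
  have hd : (d : ℝ) ≠ 0 := by exact_mod_cast NeZero.ne d
  have hN : (N : ℝ) ≠ 0 := by exact_mod_cast NeZero.ne N
  simp only [circlePt]
  rw [← AddCircle.coe_nsmul, nsmul_eq_mul, Nat.cast_one]
  congr 1
  field_simp

theorem isCoverLift (hm : ∀ i, 2 ≤ m i) : IsCoverLift d X.baseRep (X.rep hr) := by
  intro g p
  obtain ⟨f, h1, h2⟩ := X.exists_common_lift hr hm g
  obtain ⟨x, rfl⟩ := circlePt_surjective (period_pos (arcs n k) d) p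
  rw [← h1, ← h2, toCircle_circlePt, nsmul_circlePt, nsmul_circlePt, toCircle_circlePt]

/-- The target arc lies between consecutive translates of the source arc, so the lift moves the left
end of the contracted interval right and its right end left. -/
theorem exists_fixed_h (j : Fin (2 * n)) : ∃ y, (X.rep hr (h n m j)).1 y = y := by
  obtain ⟨h1, h2⟩ := negArc_lt_posArcLift (k := k) j
  have h1' : (negArc k j : ℝ) + 1 ≤ posArcLift k j := by exact_mod_cast h1
  have h2' : (posArcLift k j : ℝ) + 1 ≤ negArc k j + (arcs n k : ℕ) := by exact_mod_cast h2
  have h3 := X.H_left j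
  have h4 := X.H_right j
  have hc : Continuous fun x => (X.H j).1 x - x := (X.H j).continuous.sub continuous_id
  obtain ⟨y, -, hy⟩ := intermediate_value_Icc' (f := fun x => (X.H j).1 x - x)
    (a := (negArc k j : ℝ) + 3 / 4) (b := (negArc k j : ℝ) + (arcs n k : ℕ) + 1 / 4) (by linarith)
    hc.continuousOn (show (0 : ℝ) ∈ _ by
      rw [h3, h4]
      constructor <;> linarith)
  refine ⟨circlePt ((arcs n k : ℕ) * d) y, ?_⟩
  rw [rep_h, toCircle_circlePt, sub_eq_zero.1 hy]

/-- The arc of the circle with a given label. -/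
def arc (N : ℕ) (a : ℤ) : Set UnitAddCircle :=
  circlePt (N * (1 : ℕ)) '' Set.Icc (a + 1 / 4) (a + 3 / 4)

theorem arc_add {N : ℕ} [NeZero N] (a z : ℤ) : arc N (a + z * N) ⊆ arc N a := by
  rintro _ ⟨x, ⟨h1, h2⟩, rfl⟩
  push_cast at h1 h2
  refine ⟨x + (-z : ℤ) * (N * (1 : ℕ)), ⟨?_, ?_⟩, ?_⟩
  · push_cast
    linarith
  · push_cast
    linarith
  · exact circlePt_add_int_mul (period_pos N 1) _ _

theorem isClosed_arc (N : ℕ) (a : ℤ) : IsClosed (arc N a) :=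
  (isCompact_Icc.image ((AddCircle.continuous_mk' 1).comp (continuous_id.div_const _))).isClosed

theorem isConnected_arc (N : ℕ) (a : ℤ) : IsConnected (arc N a) :=
  (isConnected_Icc (by linarith)).image _
    ((AddCircle.continuous_mk' 1).comp (continuous_id.div_const _)).continuousOn

theorem disjoint_arc {N : ℕ} [NeZero N] {a b : ℕ} (ha : a < N) (hb : b < N) (hab : a ≠ b) :
    Disjoint (arc N a) (arc N b) := by
  rw [Set.disjoint_left]
  rintro _ ⟨x, ⟨h1, h2⟩, rfl⟩ ⟨y, ⟨h3, h4⟩, e⟩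
  obtain ⟨z, hz⟩ := (circlePt_eq_iff (period_pos N 1)).1 e
  push_cast at h1 h2 h3 h4
  rw [Nat.cast_one, mul_one] at hz
  have a1 : ((a : ℤ) : ℝ) < ((b + z * N + 1 : ℤ) : ℝ) := by push_cast; linarith
  have a2 : ((b + z * N : ℤ) : ℝ) < ((a + 1 : ℤ) : ℝ) := by push_cast; linarith
  have a3 := Int.cast_lt.1 a1
  have a4 := Int.cast_lt.1 a2
  have h5 : (a : ℤ) = b + z * N := by omega
  have h6 : ((a : ℤ) : ZMod N) = (b : ℤ) := by rw [h5]; simp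
  rw [Int.cast_natCast, Int.cast_natCast, natCast_inj ha hb] at h6
  exact hab h6

theorem _root_.LineLift.image_compl_arc {N : ℕ} [NeZero N] {f : LineLift N} {a b : ℤ}
    (h1 : (a : ℝ) + 1 / 4 ≤ f.1 (b + 3 / 4)) (h2 : f.1 (b + N + 1 / 4) ≤ a + 3 / 4) :
    (toCircle 1 f).1 '' (arc N b)ᶜ ⊆ arc N a := by
  rintro _ ⟨p, hp, rfl⟩
  obtain ⟨x, rfl, h3, h4⟩ := exists_circlePt_mem_Ico (period_pos N 1) (b + 1 / 4) p
  rw [toCircle_circlePt]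
  rw [Nat.cast_one, mul_one] at h4
  have h5 : (b : ℝ) + 3 / 4 < x := by
    by_contra! h
    exact hp ⟨x, ⟨h3, h⟩, rfl⟩
  exact ⟨_, ⟨h1.trans (f.le_iff.2 h5.le), (f.le_iff.2 (by linarith)).trans h2⟩, rfl⟩

theorem isPingPongAction : IsPingPongAction X.baseRep := by
  refine ⟨fun i => arc (arcs n k) (i : ℕ), fun j => arc (arcs n k) (posArc k j : ℕ),
    fun j => arc (arcs n k) (negArc k j : ℕ), ?_, ?_, ?_, ?_⟩
  · rintro (i | j | j)
    · exact ⟨isClosed_arc _ _, isConnected_arc _ _⟩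
    · exact ⟨isClosed_arc _ _, isConnected_arc _ _⟩
    · exact ⟨isClosed_arc _ _, isConnected_arc _ _⟩
  · have hi : ∀ i : Fin k, (i : ℕ) < arcs n k := fun i => i.2.trans_le (Nat.le_add_right _ _)
    rintro (i | j | j) (i' | j' | j') hne
    · exact disjoint_arc (hi _) (hi _) fun h => hne (by rw [Fin.ext h])
    · exact disjoint_arc (hi _) (posArc_lt _) (i.2.trans_le (le_posArc j')).ne
    · exact disjoint_arc (hi _) (negArc_lt _) (i.2.trans_le (le_negArc j')).ne
    · exact disjoint_arc (posArc_lt _) (hi _) (i'.2.trans_le (le_posArc j)).ne'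
    · exact disjoint_arc (posArc_lt _) (posArc_lt _) fun h => hne (by rw [posArc_injective h])
    · exact disjoint_arc (posArc_lt _) (negArc_lt _) (posArc_ne_negArc j j')
    · exact disjoint_arc (negArc_lt _) (hi _) (i'.2.trans_le (le_negArc j)).ne'
    · exact disjoint_arc (negArc_lt _) (posArc_lt _) (posArc_ne_negArc j' j).symm
    · exact disjoint_arc (negArc_lt _) (negArc_lt _) fun h => hne (by rw [negArc_injective h])
  · intro i j hj hjm
    rw [map_pow, baseRep, rep_e, toCircle_one_coverE, ← map_pow]
    have h1 := LineLift.image_compl_arc (f := X.E i ^ j) (a := (i : ℕ))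
      (b := (i : ℕ) + (-1 : ℤ) * (arcs n k : ℕ)) (by
        have := X.le_E i j hj hjm
        push_cast
        rw [neg_one_mul, ← sub_eq_add_neg]
        exact this) (by
        have := X.E_le i j hj hjm
        push_cast
        rw [neg_one_mul, neg_add_cancel_right]
        exact this)
    refine (Set.image_mono (Set.compl_subset_compl.2 ?_)).trans h1
    exact arc_add _ _
  · intro j
    rw [baseRep, rep_h]
    have h1 := LineLift.image_compl_arc (f := X.H j) (a := posArcLift k j) (b := (negArc k j : ℕ))
      (by simpa using (X.H_left j).ge) (by simpa using (X.H_right j).le)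
    refine h1.trans ?_
    rw [posArcLift]
    exact arc_add _ _

/-- Points in arcs stay at distance at least 1/4 from the multiples of N. Reduce modulo N, fold at
N/2, and use that cosine decreases on [0, π]. -/
theorem cos_le_of_mem_arc {N : ℕ} [NeZero N] {j : ℤ} {x : ℝ} (h1 : (j : ℝ) + 1 / 4 < x)
    (h2 : x < j + 3 / 4) :
    Real.cos (2 * (Real.pi * (x / N))) ≤ Real.cos (2 * (Real.pi / (4 * N))) := by
  have hN : (0 : ℝ) < N := by exact_mod_cast Nat.pos_of_ne_zero (NeZero.ne N)
  have hN1 : (1 : ℝ) ≤ N := by exact_mod_cast Nat.pos_of_ne_zero (NeZero.ne N)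
  have hpi := Real.pi_pos
  have hNZ : (0 : ℤ) < N := by exact_mod_cast Nat.pos_of_ne_zero (NeZero.ne N)
  set q := j / N
  have b1 : q * N ≤ j := Int.ediv_mul_le j hNZ.ne'
  have b2 : j + 1 ≤ (q + 1) * N := Int.lt_ediv_add_one_mul_self j hNZ
  have b1' : (q : ℝ) * N ≤ j := by exact_mod_cast b1
  have b2' : (j : ℝ) + 1 ≤ (q + 1) * N := by exact_mod_cast b2
  set t := x - q * N with ht
  have t1 : 1 / 4 < t := by linarith
  have t2 : t < N - 1 / 4 := by linarith
  have e : 2 * (Real.pi * (x / N)) = 2 * (Real.pi * (t / N)) + q * (2 * Real.pi) := by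
    rw [ht]
    field_simp
    ring
  have e2 : 2 * (Real.pi / (4 * N)) = 2 * (Real.pi * ((1 / 4) / N)) := by
    field_simp
  rw [e, Real.cos_add_int_mul_two_pi, e2]
  have mono : ∀ {u v : ℝ}, u ≤ v → 2 * (Real.pi * (u / N)) ≤ 2 * (Real.pi * (v / N)) := by
    intro u v huv
    gcongr
  rcases le_total t (N / 2) with h | h
  · refine Real.cos_le_cos_of_nonneg_of_le_pi (by positivity) ((mono h).trans (le_of_eq ?_))
      (mono t1.le)
    field_simp
  · rw [← Real.cos_two_pi_sub (2 * (Real.pi * (t / N)))]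
    have e3 : 2 * Real.pi - 2 * (Real.pi * (t / N)) = 2 * (Real.pi * ((N - t) / N)) := by
      field_simp
    rw [e3]
    refine Real.cos_le_cos_of_nonneg_of_le_pi (by positivity)
      ((mono (show N - t ≤ N / 2 by linarith)).trans (le_of_eq ?_)) (mono (by linarith))
    field_simp

/-- Matrices moving the boundary point of 0 by less than the half-width of a gap form a
neighbourhood of the identity. Ping-pong leaves only the trivial element there, which gives
injectivity and discreteness at once. -/
theorem isFuchsianAction (hm : ∀ i, 2 ≤ m i) (h2 : 2 ≤ arcs n k) : IsFuchsianAction X.baseRep := by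
  obtain ⟨A, hA⟩ := exists_psl_hom X.baseRep (X.baseRep_mem_mobius hm)
  set S := X.system (zero_order m) hm h2 (by
    rw [Nat.cast_one]
    exact isCoprime_one_right) with hS
  set ε := Real.sin (Real.pi / (4 * (arcs n k : ℕ))) ^ 2 with hε
  have hN : (1 : ℝ) ≤ (arcs n k : ℕ) := by
    exact_mod_cast Nat.pos_of_ne_zero (NeZero.ne (arcs n k))
  have hεpos : 0 < ε := by
    have hpi := Real.pi_pos
    refine pow_pos (Real.sin_pos_of_pos_of_lt_pi (by positivity) ?_) 2
    exact div_lt_self hpi (by linarith)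
  -- The second column is the image of [0 : 1], and the inequality bounds sin² of its angle by ε.
  set U₀ : Set SL(2, ℝ) := {B | B.1 0 1 ^ 2 < ε * (B.1 0 1 ^ 2 + B.1 1 1 ^ 2)} with hU₀
  have hU₀o : IsOpen U₀ := by
    have hc : ∀ i j : Fin 2, Continuous fun B : SL(2, ℝ) => B.1 i j := fun i j =>
      (continuous_apply j).comp ((continuous_apply i).comp continuous_subtype_val)
    exact isOpen_lt ((hc 0 1).pow 2)
      (continuous_const.mul (((hc 0 1).pow 2).add ((hc 1 1).pow 2)))
  set U : Set (Matrix.ProjectiveSpecialLinearGroup (Fin 2) ℝ) :=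
    (QuotientGroup.mk : SL(2, ℝ) → SL(2, ℝ) ⧸ Subgroup.center SL(2, ℝ)) '' U₀ with hU
  have hUo : IsOpen U := QuotientGroup.isOpenMap_coe _ hU₀o
  have h1U : (1 : Matrix.ProjectiveSpecialLinearGroup (Fin 2) ℝ) ∈ U := by
    refine ⟨1, ?_, rfl⟩
    rw [hU₀]
    simpa using hεpos
  have key : ∀ g, A g ∈ U → g = 1 := by
    intro g hg
    obtain ⟨B, hB, hBg⟩ := hg
    obtain ⟨f, hf⟩ := S.exists_isLift g
    rcases hf.eq_one_or_mem_arc 0 with h | ⟨j, h3, h4⟩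
    · exact h
    exfalso
    have h5 := hA g 0
    have h6 : (X.baseRep g).1 0 = ((f.1 0 / (arcs n k : ℕ) : ℝ) : UnitAddCircle) := by
      have := S.σ_apply_zero hf
      rw [Nat.cast_one, mul_one] at this
      exact this
    have h7 : boundaryPoint 0 = Projectivization.mk ℝ ![0, 1] (by simp) := by
      have := boundaryPoint_coe 0
      simpa using this
    rw [h6, boundaryPoint_coe, h7, ← hBg, eq_comm] at h5
    obtain ⟨s, hs⟩ := (psl_smul_mk_eq_iff B _ _).1 h5
    have e0 : s * Real.sin (Real.pi * (f.1 0 / (arcs n k : ℕ))) = B.1 0 1 := by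
      simpa [Matrix.mulVec, dotProduct] using congrFun hs 0
    have e1 : s * Real.cos (Real.pi * (f.1 0 / (arcs n k : ℕ))) = B.1 1 1 := by
      simpa [Matrix.mulVec, dotProduct] using congrFun hs 1
    have hB' : B.1 0 1 ^ 2 < ε * (B.1 0 1 ^ 2 + B.1 1 1 ^ 2) := hB
    rw [Int.cast_zero] at h3 h4
    have h8 := cos_le_of_mem_arc (N := arcs n k) h3 h4
    have h9 : ε ≤ Real.sin (Real.pi * (f.1 0 / (arcs n k : ℕ))) ^ 2 := by
      rw [hε, Real.sin_sq_eq_half_sub, Real.sin_sq_eq_half_sub]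
      linarith
    have h10 := Real.sin_sq_add_cos_sq (Real.pi * (f.1 0 / (arcs n k : ℕ)))
    rw [← e0, ← e1] at hB'
    nlinarith [mul_le_mul_of_nonneg_left h9 (sq_nonneg s)]
  refine ⟨A, (injective_iff_map_eq_one A).2 fun g hg => key g (hg ▸ h1U), ?_, hA⟩
  refine discreteTopology_of_isOpen_singleton_one ?_
  have : ({1} : Set A.range) = Subtype.val ⁻¹' U := by
    ext ⟨x, g, rfl⟩
    rw [Set.mem_singleton_iff, Set.mem_preimage]
    constructor
    · intro h
      rw [h]
      exact h1U
    · intro h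
      refine Subtype.ext ?_
      change A g = 1
      rw [key g h, map_one]
  rw [this]
  exact hUo.preimage continuous_subtype_val

omit [NeZero d] in
/-- The torsion generators move every point of the line, up to translation. -/
theorem coverE_apply_ne (hm : ∀ i, 2 ≤ m i) (hr : ∀ i, m i * r i + 1 = d) (i : Fin k) (x : ℝ)
    (z : ℤ) : (X.coverE r i).1 x ≠ x + z * (arcs n k : ℕ) := by
  intro h
  have hN : ((arcs n k : ℕ) : ℝ) ≠ 0 := by exact_mod_cast NeZero.ne (arcs n k)
  have h1 : ∀ j : ℕ, (X.coverE r i ^ j).1 x = x + (j * z : ℤ) * (arcs n k : ℕ) := by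
    intro j
    induction j with
    | zero => simp
    | succ j ih =>
      rw [pow_succ', LineLift.mul_apply, ih, apply_add_int, h]
      push_cast
      ring
  have h2 := h1 (m i)
  rw [X.coverE_pow_order hr, LineLift.translate_apply] at h2
  have h3 : ((m i * z : ℤ) : ℝ) = ((d : ℤ) : ℝ) := by
    refine mul_right_cancel₀ hN ?_
    push_cast at h2 ⊢
    linarith
  have h4 : (m i : ℤ) * z = d := by exact_mod_cast h3
  -- A fixed point modulo κ would give m_i z = m_i r_i + 1, impossible for m_i ≥ 2.
  rw [← hr i] at h4
  have h5 : (m i : ℤ) ∣ 1 := ⟨z - r i, by push_cast at h4; linarith⟩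
  have h6 := Int.le_of_dvd one_pos h5
  have := hm i
  omega

end GeneratorLifts

end CyclicFreeProduct

end

/-! ### The infinite family of covering degrees -/

/-- The degrees `d` and the shifts `r` for which the boundary word winds around the `d`-fold cover
with a single orbit form infinite families. -/
theorem exists_coprime_degrees {n k : ℕ} {m : Fin k → ℕ} (hm : ∀ i, 2 ≤ m i) (hk : 1 ≤ k)
    (hcyc : ¬ (n = 0 ∧ k = 1)) (hdih : ¬ (n = 0 ∧ k = 2 ∧ ∀ i, m i = 2)) :
    ∃ D : Set ℕ, D.Infinite ∧ ∀ d ∈ D, Odd d ∧ ∃ r : Fin k → ℕ, (∀ i, m i * r i + 1 = d) ∧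
      IsCoprime ((k : ℤ) + 2 * n - 1 + ∑ i, (r i : ℤ)) (d : ℤ) := by
  set M := ∏ i, m i with hM
  have hMpos : 0 < M := Finset.prod_pos fun i _ => by have := hm i; omega
  choose q hq using fun i => Finset.dvd_prod_of_mem m (Finset.mem_univ i)
  simp only [← hM] at hq
  -- This is -M times the orbifold Euler characteristic, as q_i = M / m_i.
  set N₀ : ℤ := M * (k + 2 * n - 1) - ∑ i, (q i : ℤ) with hN₀
  have h2q : ∀ i, 0 ≤ (M : ℤ) - 2 * q i := fun i => by
    have h1 : 2 * q i ≤ M := by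
      rw [hq i]
      exact Nat.mul_le_mul_right _ (hm i)
    have h2 : (2 : ℤ) * q i ≤ M := by exact_mod_cast h1
    linarith
  have hsum : 2 * N₀ = M * ((k : ℤ) + 4 * n - 2) + ∑ i, ((M : ℤ) - 2 * q i) := by
    rw [Finset.sum_sub_distrib, ← Finset.mul_sum, hN₀]
    simp only [Finset.sum_const, Finset.card_univ, Fintype.card_fin, nsmul_eq_mul]
    ring
  have hM' : (0 : ℤ) < M := by exact_mod_cast hMpos
  have hN : N₀ ≠ 0 := by
    intro h0
    rw [h0, mul_zero] at hsum
    have hs := Finset.sum_nonneg fun i (_ : i ∈ Finset.univ) => h2q i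
    have h3 : (k : ℤ) + 4 * n - 2 ≤ 0 := by
      by_contra! h
      have := mul_pos hM' h
      linarith
    have h4 : n = 0 ∧ k = 2 := by omega
    obtain ⟨rfl, rfl⟩ := h4
    refine hdih ⟨rfl, rfl, fun i => ?_⟩
    have h5 : ∑ i, ((M : ℤ) - 2 * q i) = 0 := by
      rw [hsum]
      simp
    have h6 := (Finset.sum_eq_zero_iff_of_nonneg fun i _ => h2q i).1 h5 i (Finset.mem_univ i)
    have h7 : 2 * q i = m i * q i := by
      rw [← hq i]
      have : (M : ℤ) = 2 * q i := by linarith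
      exact_mod_cast this.symm
    have h8 : 0 < q i := Nat.pos_of_ne_zero fun h => by
      rw [hq i, h, mul_zero] at hMpos
      exact lt_irrefl _ hMpos
    exact (Nat.eq_of_mul_eq_mul_right h8 h7).symm
  have hpos : 0 < N₀.natAbs := Int.natAbs_pos.2 hN
  -- Such d is odd, congruent to 1 modulo every m_i, and coprime to N₀.
  refine ⟨Set.range fun j : ℕ => 1 + 2 * (j * (M * N₀.natAbs)),
    Set.infinite_range_of_injective fun j j' h => ?_, ?_⟩
  · have h1 : j * (M * N₀.natAbs) = j' * (M * N₀.natAbs) := by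
      have h0 : 1 + 2 * (j * (M * N₀.natAbs)) = 1 + 2 * (j' * (M * N₀.natAbs)) := h
      omega
    exact Nat.eq_of_mul_eq_mul_right (Nat.mul_pos hMpos hpos) h1
  · rintro _ ⟨j, rfl⟩
    refine ⟨by simp only; exact ⟨j * (M * N₀.natAbs), by ring⟩,
      fun i => 2 * (j * (q i * N₀.natAbs)), fun i => ?_, ?_⟩
    · simp only
      rw [hq i]
      ring
    · set d : ℕ := 1 + 2 * (j * (M * N₀.natAbs)) with hd
      have hdz : (d : ℤ) = 1 + 2 * (j * (M * |N₀|)) := by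
        rw [hd]
        push_cast
        ring
      have h1 : IsCoprime N₀ (d : ℤ) := by
        rw [hdz]
        obtain h | h := abs_choice N₀
        · rw [h]
          exact ⟨-(2 * (j * M)), 1, by ring⟩
        · rw [h]
          exact ⟨2 * (j * M), 1, by ring⟩
      -- Since M r_i = q_i (d - 1), M times the shift is N₀ modulo d, so coprimality passes from N₀
      -- to the shift.
      have h2 : (M : ℤ) * ((k : ℤ) + 2 * n - 1 + ∑ i, ((2 * (j * (q i * N₀.natAbs)) : ℕ) : ℤ)) =
          N₀ + d * ∑ i, (q i : ℤ) := by
        have h3 : ∑ i, ((2 * (j * (q i * N₀.natAbs)) : ℕ) : ℤ) =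
            2 * (j * |N₀|) * ∑ i, (q i : ℤ) := by
          rw [Finset.mul_sum]
          refine Finset.sum_congr rfl fun i _ => ?_
          push_cast
          ring
        rw [h3, hN₀, hdz]
        ring
      have h3 : IsCoprime (N₀ + d * ∑ i, (q i : ℤ)) (d : ℤ) :=
        IsCoprime.add_mul_left_left h1 _
      rw [← h2] at h3
      exact IsCoprime.of_mul_left_right h3

/-! ### Assembly of the family of orders -/

open CyclicFreeProduct in
theorem theorem1p1 (n k : ℕ) (m : Fin k → ℕ) (hk : 1 ≤ k) (hm : ∀ i, 2 ≤ m i)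
    (hcyc : ¬ (n = 0 ∧ k = 1)) (hdih : ¬ (n = 0 ∧ k = 2 ∧ ∀ i, m i = 2)) :
    ∃ (ρ : CyclicFreeProduct n m →* HomeoPlus) (x₀ : UnitAddCircle) (D : Set ℕ)
      (c : ℕ → GroupCircularOrder (CyclicFreeProduct n m)),
      IsFuchsianAction ρ ∧ IsPingPongAction ρ ∧ D.Infinite ∧
      (∀ d ∈ D, 0 < d ∧ (c d).IsIsolated ∧
        (c d).IsLinearPart (Subgroup.zpowers (α n m ^ d)) ∧
        ∃ (σ : CyclicFreeProduct n m →* HomeoPlus) (x : UnitAddCircle),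
          IsCoverLift d ρ σ ∧ (∀ j, ∃ y, (σ (h n m j)).1 y = y) ∧ d • x = x₀ ∧
          ∀ g₁ g₂ g₃, (c d).toFun g₁ g₂ g₃ = circleOrd ((σ g₁).1 x) ((σ g₂).1 x) ((σ g₃).1 x)) ∧
      ∀ d ∈ D, ∀ d' ∈ D, d ≠ d' →
        ∀ φ : CyclicFreeProduct n m ≃* CyclicFreeProduct n m, c d ≠ (c d').autImage φ := by
  have : NeZero k := ⟨by omega⟩
  obtain ⟨X⟩ := nonempty_generatorLifts (n := n) hm
  obtain ⟨D, hD, hdeg⟩ := exists_coprime_degrees hm hk hcyc hdih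
  have h2 : 2 ≤ arcs n k := by
    unfold arcs
    omega
  let S₁ := X.system (GeneratorLifts.zero_order m) hm h2 (by
    rw [Nat.cast_one]
    exact isCoprime_one_right)
  have main : ∀ d, ∃ c : GroupCircularOrder (CyclicFreeProduct n m), d ∈ D →
      c.IsIsolated ∧ c.IsLinearPart (Subgroup.zpowers (α n m ^ d)) ∧
        ∃ (σ : CyclicFreeProduct n m →* HomeoPlus) (x : UnitAddCircle),
          IsCoverLift d X.baseRep σ ∧ (∀ j, ∃ y, (σ (h n m j)).1 y = y) ∧ d • x = 0 ∧
          ∀ g₁ g₂ g₃, c.toFun g₁ g₂ g₃ = circleOrd ((σ g₁).1 x) ((σ g₂).1 x) ((σ g₃).1 x) := by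
    intro d
    by_cases hd : d ∈ D
    · obtain ⟨hodd, r, hr, hco⟩ := hdeg d hd
      have : NeZero d := ⟨hodd.pos.ne'⟩
      let S := X.system hr hm h2 hco
      refine ⟨S.order, fun _ => ⟨S.isIsolated_order, S.isLinearPart ?_, X.rep hr, 0,
        X.isCoverLift hr hm, X.exists_fixed_h hr, smul_zero d, S.order_toFun⟩⟩
      -- A torsion generator serves as the element without fixed points on the base circle.
      exact ⟨e n m ⟨0, hk⟩, X.coverE r ⟨0, hk⟩, (X.rep_e hr _).symm, X.coverE_apply_ne hm hr _⟩
    · exact ⟨S₁.order, fun h => absurd h hd⟩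
  choose c hc using main
  refine ⟨X.baseRep, 0, D, c, X.isFuchsianAction hm h2, X.isPingPongAction, hD,
    fun d hd => ⟨(hdeg d hd).1.pos, hc d hd⟩, fun d hd d' hd' hne φ hφ => hne ?_⟩
  have hinj : Function.Injective fun i : ℤ => α n m ^ i := S₁.bdry_zpow_injective
  have hroot : ∀ (g : CyclicFreeProduct n m) (d : ℕ) (i : ℤ), Odd d → i ≠ 0 →
      g ^ d = α n m ^ i → g ∈ Subgroup.zpowers (α n m) :=
    fun g d i h1 h2 h3 => S₁.mem_zpowers_bdry_of_pow_eq h1 h2 h3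
  have hφ' : c d' = (c d).autImage φ.symm := by
    rw [hφ, GroupCircularOrder.autImage_symm_autImage]
  exact Nat.dvd_antisymm
    ((hc d hd).2.1.dvd_of_eq_autImage hinj hroot (hdeg d hd).1 (hdeg d' hd').1.pos.ne'
      (hc d' hd').2.1 hφ)
    ((hc d' hd').2.1.dvd_of_eq_autImage hinj hroot (hdeg d' hd').1 (hdeg d hd).1.pos.ne'
      (hc d hd).2.1 hφ')
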